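/- \textbf{Definitions.} A centrally symmetric convex domain is a compact convex set $K\subset\mathbb R^2$ with nonempty interior that has a center of symmetry. $\delta(K)$ is the greatest density $\mathrm{area}(K)/\mathrm{covol}(\Lambda)$ over all lattices $\Lambda$ for which the translates $v+K$, $v\in\Lambda$, have disjoint interiors; $\delta_{\min}$ is the infimum of $\delta$ over all centrally symmetric convex domains; $K$ is \emph{miserly} if $\delta(K)=\delta_{\min}$. Write $u\wedge v$ for the determinant with columns $u,v\in\mathbb R^2$. A \emph{multi-curve} on $[t_0,t_1]$, $t_0<t_1$, is a family of $C^1$ curves $\sigma_j:[t_0,t_1]\to\mathbb R^2$, $j\in\mathbb Z/6\mathbb Z$, with $\sigma_j+\sigma_{j+2}+\sigma_{j+4}=0$, $\sigma_{j+3}=-\sigma_j$ and $\sigma_j\wedge\sigma_{j+2}=\sqrt3/2$ for all $j$ and $t$. It has \emph{well-defined rank} if it is $C^2$ and each $\sigma_j$ either is a line segment or has nonzero curvature on $(t_0,t_1)$; its \emph{rank} is then the number of $j\in\{0,2,4\}$ for which $\sigma_j$ is not a line segment. It \emph{parametrizes a segment of the boundary} of $K$ if, for a center of symmetry $c$ of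 $K$ and some $r>0$, all points $c+r\sigma_j(t)$ lie on $\partial K$. Let $I_j$ be the signed area $\frac12\int_{t_0}^{t_1}\sigma_j\wedge\sigma_j'\,dt$ enclosed by the segment from $0$ to $\sigma_j(t_0)$, the curve $\sigma_j$, and the segment from $\sigma_j(t_1)$ to $0$. A \emph{rank-preserving variation} of a rank two multi-curve $\sigma$ is a family $\sigma^\varepsilon_j(t)$, of class $C^2$ in $(\varepsilon,t)$, with $\sigma^0=\sigma$, with $\sigma^\varepsilon=\sigma$ for $t$ outside a fixed compact subinterval of $(t_0,t_1)$, and such that $\sigma^\varepsilon$ is a multi-curve of rank two for all small $\varepsilon$. \textbf{Theorem.} (1) Let $K$ be a miserly domain. Then no segment of the boundary of $K$ is parametrized by a rank two multi-curve. (2) The first variation in area along rank-preserving variations is non-zero at every rank two multi-curve $\sigma$: there are a rank-preserving variation $\sigma^\varepsilon$ and a number $d\ne0$ such that, at $\varepsilon=0$, $\frac{d}{d\varepsilon}\sum_{j}I_j(\sigma^\varepsilon)=2d$, and $\frac{d}{d\varepsilon}\bigl(I_{k+1}(\sigma^\varepsilon)+I_{k+2}(\sigma^\varepsilon)\bigr)=d$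 for every $k$ for which $\sigma_k$ is a line segment. (3) Let $\sigma$ be a rank two multi-curve on $[t_0,t_1]$ that parametrizes a segment of the boundary of a centrally symmetric convex domain counterclockwise ($\sigma_j\wedge\sigma_j'\ge0$ on $(t_0,t_1)$ for all $j$). Then there are an index $k$ for which $\sigma_k$ is a line segment, a matrix $g\in SL_2(\mathbb R)$, and $C^2$ functions $x,s$ on $[t_0,t_1]$ with $-1<s<1$, $s'>0$, $x'<0$ on $(t_0,t_1)$ such that $$g\sigma_k=\begin{pmatrix}-x\\-1\end{pmatrix},\quad g\sigma_{k+1}=\frac12\begin{pmatrix}1&x\\0&1\end{pmatrix}\begin{pmatrix}\sqrt3\\ s-1\end{pmatrix},\quad g\sigma_{k+2}=\frac12\begin{pmatrix}1&x\\0&1\end{pmatrix}\begin{pmatrix}\sqrt3\\ s+1\end{pmatrix},$$ and the areas $A_j$ of the regions swept out by the line segments from $0$ to the points of $\sigma_j$ satisfy $$A_{k+1}+A_{k+2}=\int_{t_0}^{t_1}\tfrac14\bigl(\sqrt3\,s'-(1+s^2)x'\bigr)\,dt.$$ Moreover, for every rank-preserving variation $\sigma^\varepsilon$ of such a $\sigma$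 and all sufficiently small $\varepsilon$, for every $j$ the signed area $I_j(\sigma^\varepsilon)$ equals the area of the region swept out by the line segments from $0$ to the points of $\sigma^\varepsilon_j$. -/

import Mathlib

open Set Filter Topology MeasureTheory
open scoped Real

noncomputable section

namespace Reinhardt

/-- The Euclidean plane. -/
abbrev Plane : Type := EuclideanSpace ℝ (Fin 2)

/-- The determinant with columns `u` and `v`. -/
def wedge (u v : Plane) : ℝ := u 0 * v 1 - u 1 * v 0

/-- The linear action of `SL₂(ℝ)` on the plane. -/
def act (g : Matrix.SpecialLinearGroup (Fin 2) ℝ) (p : Plane) : Plane :=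
  !₂[g 0 0 * p 0 + g 0 1 * p 1, g 1 0 * p 0 + g 1 1 * p 1]

/-! ### Convex domains, lattice packings, miserly domains -/

/-- `c` is a center of symmetry of `K`. -/
def IsCenter (K : Set Plane) (c : Plane) : Prop :=
  ∀ p ∈ K, (2 : ℝ) • c - p ∈ K

/-- A centrally symmetric convex domain: a compact convex set with nonempty interior and
a center of symmetry. -/
structure IsSymmetricConvexDomain (K : Set Plane) : Prop where
  isCompact : IsCompact K
  convex : Convex ℝ K
  interior_nonempty : (interior K).Nonempty
  symmetric : ∃ c, IsCenter K c

/-- The translates of `K` by the elements of `L` have pairwise disjoint interiors. -/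
def IsLatticePacking (K : Set Plane) (L : Submodule ℤ Plane) : Prop :=
  ∀ v ∈ L, ∀ w ∈ L, v ≠ w →
    Disjoint (interior ((fun p => v + p) '' K)) (interior ((fun p => w + p) '' K))

/-- The densities of the lattice packings of `K`: area of `K` over co-area of the lattice. -/
def latticeDensities (K : Set Plane) : Set ℝ :=
  {d | ∃ (L : Submodule ℤ Plane) (_ : DiscreteTopology L) (_ : IsZLattice ℝ L),
    IsLatticePacking K L ∧ d = (volume K).toReal / ZLattice.covolume L}

/-- The greatest density of a lattice packing of `K`. -/
def deltaLat (K : Set Plane) : ℝ := sSup (latticeDensities K)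

/-- The infimum of `deltaLat` over all centrally symmetric convex domains. -/
def deltaMin : ℝ := sInf {d | ∃ K : Set Plane, IsSymmetricConvexDomain K ∧ d = deltaLat K}

/-- A miserly domain realizes the lower bound `deltaMin`. -/
def IsMiserly (K : Set Plane) : Prop :=
  IsSymmetricConvexDomain K ∧ deltaLat K = deltaMin

/-! ### Multi-curves and their rank -/

/-- Multi-points, indexed by `ℤ/6ℤ`. -/
def IsMultiPoint (u : ZMod 6 → Plane) : Prop :=
  ∀ j, u j + u (j + 2) + u (j + 4) = 0 ∧ u (j + 3) = -u j ∧
    wedge (u j) (u (j + 2)) = √3 / 2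

/-- Multi-curves on `[t₀, t₁]`; the values of `σ` outside `[t₀, t₁]` are irrelevant. -/
structure IsMultiCurve (σ : ZMod 6 → ℝ → Plane) (t₀ t₁ : ℝ) : Prop where
  lt : t₀ < t₁
  contDiffOn : ∀ j, ContDiffOn ℝ 1 (σ j) (Icc t₀ t₁)
  multiPoint : ∀ t ∈ Icc t₀ t₁, IsMultiPoint (fun j => σ j t)

/-- The curve `γ` on `[t₀, t₁]` is a (nondegenerate) line segment. -/
def IsLineSegment (γ : ℝ → Plane) (t₀ t₁ : ℝ) : Prop :=
  ∃ a b : Plane, a ≠ b ∧ γ '' Icc t₀ t₁ = segment ℝ a b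

/-- The signed curvature of a plane curve (it is `0` where the velocity vanishes). -/
def curvature (γ : ℝ → Plane) (t : ℝ) : ℝ :=
  wedge (deriv γ t) (deriv (deriv γ) t) / ‖deriv γ t‖ ^ 3

/-- The multi-curve `σ` is `C²` and each of its curves either is a line segment or has
nonzero curvature on the open interval. -/
structure HasWellDefinedRank (σ : ZMod 6 → ℝ → Plane) (t₀ t₁ : ℝ) : Prop where
  isMultiCurve : IsMultiCurve σ t₀ t₁
  contDiffOn : ∀ j, ContDiffOn ℝ 2 (σ j) (Icc t₀ t₁)
  segment_or_curved : ∀ j, IsLineSegment (σ j) t₀ t₁ ∨ ∀ t ∈ Ioo t₀ t₁, curvature (σ j) t ≠ 0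

/-- The number of even indices `j` for which `σ j` is not a line segment. -/
def rank (σ : ZMod 6 → ℝ → Plane) (t₀ t₁ : ℝ) : ℕ :=
  {j : ZMod 6 | j ∈ ({0, 2, 4} : Set (ZMod 6)) ∧ ¬ IsLineSegment (σ j) t₀ t₁}.ncard

/-- `σ` is a multi-curve on `[t₀, t₁]` of well-defined rank `k`. -/
def HasRank (σ : ZMod 6 → ℝ → Plane) (t₀ t₁ : ℝ) (k : ℕ) : Prop :=
  HasWellDefinedRank σ t₀ t₁ ∧ rank σ t₀ t₁ = k

/-- The multi-curve `σ` parametrizes (six arcs of) the boundary of `K`, after `K` has been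
recentered at the origin and rescaled. -/
def ParametrizesBoundary (K : Set Plane) (σ : ZMod 6 → ℝ → Plane) (t₀ t₁ : ℝ) : Prop :=
  ∃ (c : Plane) (r : ℝ), IsCenter K c ∧ 0 < r ∧
    ∀ j, ∀ t ∈ Icc t₀ t₁, c + r • σ j t ∈ frontier K

/-- The curves of `σ` move counterclockwise around the origin. -/
def IsCounterclockwise (σ : ZMod 6 → ℝ → Plane) (t₀ t₁ : ℝ) : Prop :=
  ∀ j, ∀ t ∈ Ioo t₀ t₁, 0 ≤ wedge (σ j t) (deriv (σ j) t)

/-! ### Areas and variations -/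

/-- The area of the region bounded by the segment from the origin to `γ t₀`, the curve `γ` on
`[t₀, t₁]`, and the segment from `γ t₁` to the origin, for a curve `γ` that runs around the
origin: this region is the union of the segments from the origin to the points of `γ`. -/
def sectorArea (γ : ℝ → Plane) (t₀ t₁ : ℝ) : ℝ :=
  (volume {p : Plane | ∃ t ∈ Icc t₀ t₁, p ∈ segment ℝ 0 (γ t)}).toReal

/-- The signed area enclosed by the closed curve made of the segment from the origin to `γ t₀`,
the curve `γ` on `[t₀, t₁]`, and the segment from `γ t₁` to the origin, as the line integral of
`(x dy - y dx) / 2` (to which the two segments do not contribute). -/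
def signedArea (γ : ℝ → Plane) (t₀ t₁ : ℝ) : ℝ :=
  (1 / 2) * ∫ t in t₀..t₁, wedge (γ t) (deriv γ t)

/-- `Φ` is a variation of the multi-curve `σ` of rank `k`, of class `C²`, with compact support in
the open interval, through multi-curves of the same rank `k`. -/
structure IsRankPreservingVariation (σ : ZMod 6 → ℝ → Plane) (t₀ t₁ : ℝ) (k : ℕ)
    (Φ : ℝ → ZMod 6 → ℝ → Plane) : Prop where
  contDiffOn : ∀ j, ContDiffOn ℝ 2 (fun p : ℝ × ℝ => Φ p.1 j p.2) (univ ×ˢ Icc t₀ t₁)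
  zero : ∀ j, ∀ t ∈ Icc t₀ t₁, Φ 0 j t = σ j t
  support : ∃ a b, t₀ < a ∧ a ≤ b ∧ b < t₁ ∧
    ∀ ε j, ∀ t ∈ Icc t₀ t₁, t ∉ Icc a b → Φ ε j t = σ j t
  hasRank : ∀ᶠ ε in 𝓝 (0 : ℝ), HasRank (Φ ε) t₀ t₁ k

/-- The multi-curve `σ` on `[t₀, t₁]` has skew coordinates `x`, `s` with respect to the index `k`
of a curve moving along a line, after the special linear transformation `g` which moves this line
to `y = -1`. The second factors are `(√3, s - 1) / 2` and `(√3, s + 1) / 2`, the midpoints of two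
sides of a hexagon; the first factor is the skew transformation by `x`. -/
structure SkewCoordinates (σ : ZMod 6 → ℝ → Plane) (t₀ t₁ : ℝ) (k : ZMod 6)
    (g : Matrix.SpecialLinearGroup (Fin 2) ℝ) (x s : ℝ → ℝ) : Prop where
  isLineSegment : IsLineSegment (σ k) t₀ t₁
  contDiffOn_x : ContDiffOn ℝ 2 x (Icc t₀ t₁)
  contDiffOn_s : ContDiffOn ℝ 2 s (Icc t₀ t₁)
  eq_zero : ∀ t ∈ Icc t₀ t₁, act g (σ k t) = !₂[-x t, -1]
  eq_one : ∀ t ∈ Icc t₀ t₁,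
    act g (σ (k + 1) t) = (1 / 2 : ℝ) • !₂[√3 + x t * (s t - 1), s t - 1]
  eq_two : ∀ t ∈ Icc t₀ t₁,
    act g (σ (k + 2) t) = (1 / 2 : ℝ) • !₂[√3 + x t * (s t + 1), s t + 1]
  s_mem : ∀ t ∈ Ioo t₀ t₁, s t ∈ Ioo (-1 : ℝ) 1
  deriv_s_pos : ∀ t ∈ Ioo t₀ t₁, 0 < deriv s t
  deriv_x_neg : ∀ t ∈ Ioo t₀ t₁, deriv x t < 0

end Reinhardt

end

open Set Filter Topology MeasureTheory
open scoped Real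

noncomputable section

namespace Reinhardt

/-! ### The wedge product -/

/-! Everything rests on one deformation. In a rank two multi-curve a single opposite pair `±σ k` is
straight, and `σ (k + 1) - σ (k + 2) = σ k`. Adding the same multiple `m t • σ k t` to `σ (k + 1)`
and `σ (k + 2)` slides this chord along its own direction. All multi-curve relations survive, since
`σ k ∧ σ (k + 2)` does not see the change.

First variation. An integration by parts (`signedArea_add_smul`) gives the derivative of the area as
the integral of `m * (σ k ∧ (σ (k + 1) + σ (k + 2))')`. If the second factor vanished throughout,
differentiating `σ k ∧ (σ (k + 1) + σ (k + 2)) = √3` would make the sum parallel to the line of `σ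
k`; then `σ (k + 2)` would move along that line and have zero curvature
(`HasRank.exists_wedge_ne_zero`). A bump function `m` thus gives a nonzero derivative.

Miserly domains. After an affine normalization the body lies in the strip `|y| ≤ 1`, with flat sides
on its edges. Near two heights `(a ± 1) / 2` its right boundary is `y ↦ √3 / 2 + y * X (2 * y ∓ 1)`,
with the same function `X` at both (`IsSkewGraph.profile_eq`). Replacing `X` by `X + ε n`, for a
bump `n` at `a ≠ 0`, changes the area by a quantity of the sign of `ε * a`, so the area can be
decreased; strict curvature keeps the body convex. The critical determinant does not drop: the
inscribed hexagon of the old body spans a packing lattice `L₀`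
(`IsSymmBody.hexagon_notMem_interior`), and a lattice that packs the new body but not the old one
has half of a vector in the thin gap between the two boundaries. Such a point is a side of a
parallelogram, inscribed in the new body, of area at least `√3 / 2` (`IsProfile.exists_triangle`),
which bounds the covolume below by that of `L₀` (`IsSymmBody.le_covolume`). The new body therefore
has smaller `deltaLat`.

Skew coordinates. Moving the support line of `σ k` to height `-1` produces `x` and `s`. Nonzero
curvature upgrades weak inequalities to strict ones, and a support line argument gives `s' > 0`. The
curves then turn strictly counterclockwise inside half planes, so polar integration identifies swept
area and signed area (`IsSweeping.sectorArea_eq`), and this persists under small compactly supported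
variations. -/

theorem wedge_add_left (u v w : Plane) : wedge (u + v) w = wedge u w + wedge v w := by
  simp only [wedge, PiLp.add_apply]; ring

theorem wedge_add_right (u v w : Plane) : wedge u (v + w) = wedge u v + wedge u w := by
  simp only [wedge, PiLp.add_apply]; ring

theorem wedge_smul_left (a : ℝ) (u v : Plane) : wedge (a • u) v = a * wedge u v := by
  simp only [wedge, PiLp.smul_apply, smul_eq_mul]; ring

theorem wedge_smul_right (a : ℝ) (u v : Plane) : wedge u (a • v) = a * wedge u v := by
  simp only [wedge, PiLp.smul_apply, smul_eq_mul]; ring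

theorem wedge_neg_left (u v : Plane) : wedge (-u) v = -wedge u v := by
  simp only [wedge, PiLp.neg_apply]; ring

theorem wedge_neg_right (u v : Plane) : wedge u (-v) = -wedge u v := by
  simp only [wedge, PiLp.neg_apply]; ring

theorem wedge_sub_left (u v w : Plane) : wedge (u - v) w = wedge u w - wedge v w := by
  simp only [wedge, PiLp.sub_apply]; ring

theorem wedge_sub_right (u v w : Plane) : wedge u (v - w) = wedge u v - wedge u w := by
  simp only [wedge, PiLp.sub_apply]; ring

@[simp] theorem wedge_self (u : Plane) : wedge u u = 0 := by
  simp only [wedge]; ring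

@[simp] theorem wedge_zero_left (u : Plane) : wedge 0 u = 0 := by simp [wedge]

@[simp] theorem wedge_zero_right (u : Plane) : wedge u 0 = 0 := by simp [wedge]

theorem wedge_swap (u v : Plane) : wedge u v = -wedge v u := by
  simp only [wedge]; ring

/-- Two vectors annihilated by the wedge product with a nonzero vector are parallel. -/
theorem wedge_eq_zero_of_wedge_eq_zero {v a b : Plane} (hv : v ≠ 0) (ha : wedge v a = 0)
    (hb : wedge v b = 0) : wedge a b = 0 := by
  have h0 : v 0 * wedge a b = 0 := by
    have : v 0 * wedge a b = a 0 * wedge v b - b 0 * wedge v a := by simp only [wedge]; ring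
    rw [this, ha, hb]; ring
  have h1 : v 1 * wedge a b = 0 := by
    have : v 1 * wedge a b = a 1 * wedge v b - b 1 * wedge v a := by simp only [wedge]; ring
    rw [this, ha, hb]; ring
  by_contra h
  apply hv
  ext i
  fin_cases i
  · exact (mul_eq_zero.mp h0).resolve_right h
  · exact (mul_eq_zero.mp h1).resolve_right h

theorem eq_zero_of_wedge_eq_zero {u v a : Plane} (huv : wedge u v ≠ 0) (hu : wedge u a = 0)
    (hv : wedge v a = 0) : a = 0 := by
  have h0 : wedge u v * a 0 = 0 := by
    have : wedge u v * a 0 = v 0 * wedge u a - u 0 * wedge v a := by simp only [wedge]; ring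
    rw [this, hu, hv]; ring
  have h1 : wedge u v * a 1 = 0 := by
    have : wedge u v * a 1 = v 1 * wedge u a - u 1 * wedge v a := by simp only [wedge]; ring
    rw [this, hu, hv]; ring
  ext i
  fin_cases i
  · exact (mul_eq_zero.mp h0).resolve_left huv
  · exact (mul_eq_zero.mp h1).resolve_left huv

theorem hasDerivAt_apply {f : ℝ → Plane} {f' : Plane} {t : ℝ} (hf : HasDerivAt f f' t)
    (i : Fin 2) : HasDerivAt (fun τ => f τ i) (f' i) t :=
  ((EuclideanSpace.proj i : Plane →L[ℝ] ℝ).hasFDerivAt.comp_hasDerivAt t hf)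

theorem hasDerivAt_wedge {f g : ℝ → Plane} {f' g' : Plane} {t : ℝ} (hf : HasDerivAt f f' t)
    (hg : HasDerivAt g g' t) :
    HasDerivAt (fun τ => wedge (f τ) (g τ)) (wedge f' (g t) + wedge (f t) g') t := by
  have := ((hasDerivAt_apply hf 0).mul (hasDerivAt_apply hg 1)).sub
    ((hasDerivAt_apply hf 1).mul (hasDerivAt_apply hg 0))
  refine HasDerivAt.congr_deriv this ?_
  simp only [wedge]; ring

theorem contDiffOn_apply {E : Type*} [NormedAddCommGroup E] [NormedSpace ℝ E] {n : WithTop ℕ∞}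
    {f : E → Plane} {S : Set E} (hf : ContDiffOn ℝ n f S) (i : Fin 2) :
    ContDiffOn ℝ n (fun τ => f τ i) S :=
  (EuclideanSpace.proj i : Plane →L[ℝ] ℝ).contDiff.comp_contDiffOn hf

theorem continuousAt_wedge {X : Type*} [TopologicalSpace X] {f g : X → Plane} {x : X}
    (hf : ContinuousAt f x) (hg : ContinuousAt g x) :
    ContinuousAt (fun τ => wedge (f τ) (g τ)) x := by
  unfold wedge
  have h : ∀ {u : X → Plane} (i : Fin 2), ContinuousAt u x → ContinuousAt (fun τ => u τ i) x :=
    fun i hu => (EuclideanSpace.proj i : Plane →L[ℝ] ℝ).continuous.continuousAt.comp hu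
  exact ((h 0 hf).mul (h 1 hg)).sub ((h 1 hf).mul (h 0 hg))

theorem continuousOn_wedge {X : Type*} [TopologicalSpace X] {f g : X → Plane} {S : Set X}
    (hf : ContinuousOn f S) (hg : ContinuousOn g S) :
    ContinuousOn (fun τ => wedge (f τ) (g τ)) S := by
  unfold wedge
  have h : ∀ {u : X → Plane} (i : Fin 2), ContinuousOn u S → ContinuousOn (fun τ => u τ i) S :=
    fun i hu => (EuclideanSpace.proj i : Plane →L[ℝ] ℝ).continuous.comp_continuousOn hu
  exact ((h 0 hf).mul (h 1 hg)).sub ((h 1 hf).mul (h 0 hg))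

/-- Restricted to interior times, where `deriv` does not see the irrelevant values outside the
interval. -/
theorem hasDerivAt_of_contDiffOn_two {E : Type*} [NormedAddCommGroup E] [NormedSpace ℝ E]
    {f : ℝ → E} {t₀ t₁ t : ℝ} (hf : ContDiffOn ℝ 2 f (Icc t₀ t₁)) (ht : t ∈ Ioo t₀ t₁) :
    HasDerivAt f (deriv f t) t ∧ HasDerivAt (deriv f) (deriv (deriv f) t) t ∧
      ContinuousAt (deriv (deriv f)) t := by
  have h2 := hf.mono Ioo_subset_Icc_self
  have h1 : ContDiffOn ℝ 1 (deriv f) (Ioo t₀ t₁) := h2.deriv_of_isOpen isOpen_Ioo (by norm_num)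
  have hn := isOpen_Ioo.mem_nhds ht
  exact ⟨((h2.contDiffAt hn).differentiableAt two_ne_zero).hasDerivAt,
    ((h1.contDiffAt hn).differentiableAt one_ne_zero).hasDerivAt,
    (h1.continuousOn_deriv_of_isOpen isOpen_Ioo le_rfl).continuousAt hn⟩

/-! ### Multi-points -/

theorem index_cases : ∀ k j : ZMod 6,
    j = k ∨ j = k + 1 ∨ j = k + 2 ∨ j = k + 3 ∨ j = k + 4 ∨ j = k + 5 := by decide

theorem IsMultiPoint.add_three {u : ZMod 6 → Plane} (h : IsMultiPoint u) (k : ZMod 6) :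
    u (k + 3) = -u k := (h k).2.1

theorem IsMultiPoint.add_four {u : ZMod 6 → Plane} (h : IsMultiPoint u) (k : ZMod 6) :
    u (k + 4) = -u k - u (k + 2) := by
  have := (h k).1
  rw [← sub_eq_zero, ← this]; abel

theorem IsMultiPoint.add_one {u : ZMod 6 → Plane} (h : IsMultiPoint u) (k : ZMod 6) :
    u (k + 1) = u k + u (k + 2) := by
  have h4 := h.add_four k
  have h1 := h.add_three (k + 1)
  rw [show k + 1 + 3 = k + 4 by ring, h4] at h1
  rw [← neg_inj, ← h1]; abel

theorem IsMultiPoint.add_five {u : ZMod 6 → Plane} (h : IsMultiPoint u) (k : ZMod 6) :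
    u (k + 5) = -u (k + 2) := by
  have := h.add_three (k + 2)
  rwa [show k + 2 + 3 = k + 5 by ring] at this

/-- The vectors at `k` and `k + 2` determine a multi-point, so a check at one index is enough. -/
theorem isMultiPoint_of {u : ZMod 6 → Plane} (k : ZMod 6) (h1 : u (k + 1) = u k + u (k + 2))
    (h3 : u (k + 3) = -u k) (h4 : u (k + 4) = -u k - u (k + 2)) (h5 : u (k + 5) = -u (k + 2))
    (hw : wedge (u k) (u (k + 2)) = √3 / 2) : IsMultiPoint u := by
  have hw' : wedge (u (k + 2)) (u k) = -(√3 / 2) := by rw [wedge_swap, hw]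
  have e : ∀ k : ZMod 6, k + 1 + 2 = k + 3 ∧ k + 1 + 4 = k + 5 ∧ k + 1 + 3 = k + 4 ∧
    k + 2 + 2 = k + 4 ∧ k + 2 + 4 = k ∧ k + 2 + 3 = k + 5 ∧ k + 3 + 2 = k + 5 ∧
    k + 3 + 4 = k + 1 ∧ k + 3 + 3 = k ∧ k + 4 + 2 = k ∧ k + 4 + 4 = k + 2 ∧ k + 4 + 3 = k + 1 ∧
    k + 5 + 2 = k + 1 ∧ k + 5 + 4 = k + 3 ∧ k + 5 + 3 = k + 2 := by decide
  obtain ⟨e1, e2, e3, e4, e5, e6, e7, e8, e9, e10, e11, e12, e13, e14, e15⟩ := e k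
  intro j
  rcases index_cases k j with rfl | rfl | rfl | rfl | rfl | rfl <;>
  · simp only [e1, e2, e3, e4, e5, e6, e7, e8, e9, e10, e11, e12, e13, e14, e15, h1, h3, h4, h5]
    refine ⟨by abel, by first | trivial | abel, ?_⟩
    try simp only [wedge_add_left, wedge_add_right, wedge_neg_left, wedge_neg_right, wedge_sub_left,
      wedge_sub_right, wedge_self, hw, hw']
    try ring

/-! ### Line segments, curvature and rank -/

/-- A line segment lies on a line. -/
theorem IsLineSegment.exists_wedge_eq {γ : ℝ → Plane} {t₀ t₁ : ℝ} (h : IsLineSegment γ t₀ t₁) :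
    ∃ v : Plane, v ≠ 0 ∧ ∃ c : ℝ, ∀ t ∈ Icc t₀ t₁, wedge v (γ t) = c := by
  obtain ⟨a, b, hab, him⟩ := h
  refine ⟨b - a, sub_ne_zero.mpr hab.symm, wedge (b - a) a, fun t ht => ?_⟩
  have hmem : γ t ∈ segment ℝ a b := him ▸ mem_image_of_mem γ ht
  obtain ⟨x, y, -, -, hxy, he⟩ := hmem
  rw [← he, wedge_add_right, wedge_smul_right, wedge_smul_right]
  have hb : wedge (b - a) b = wedge (b - a) a := by simp only [wedge, PiLp.sub_apply]; ring
  rw [hb, ← add_mul, hxy, one_mul]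

/-- Where `γ` is not differentiable, `deriv` has the default value zero and the claim is trivial. -/
theorem deriv_apply_eq_zero {γ : ℝ → Plane} {v : Plane} {c t : ℝ}
    (h : ∀ᶠ τ in 𝓝 t, wedge v (γ τ) = c) : wedge v (deriv γ t) = 0 := by
  by_cases hd : DifferentiableAt ℝ γ t
  · have h1 := hasDerivAt_wedge (hasDerivAt_const t v) hd.hasDerivAt
    have h2 : HasDerivAt (fun τ => wedge v (γ τ)) 0 t :=
      (hasDerivAt_const t c).congr_of_eventuallyEq h
    simpa using h1.unique h2
  · rw [deriv_zero_of_not_differentiableAt hd, wedge_zero_right]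

theorem IsLineSegment.exists_wedge_deriv {γ : ℝ → Plane} {t₀ t₁ : ℝ}
    (h : IsLineSegment γ t₀ t₁) :
    ∃ v : Plane, v ≠ 0 ∧ ∀ t ∈ Ioo t₀ t₁, wedge v (deriv γ t) = 0 := by
  obtain ⟨v, hv, c, hc⟩ := h.exists_wedge_eq
  refine ⟨v, hv, fun t ht => deriv_apply_eq_zero (c := c) ?_⟩
  filter_upwards [Icc_mem_nhds ht.1 ht.2] with τ hτ using hc τ hτ

theorem curvature_eq_zero {γ : ℝ → Plane} {v : Plane} {t : ℝ} (hv : v ≠ 0)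
    (h : ∀ᶠ τ in 𝓝 t, wedge v (deriv γ τ) = 0) : curvature γ t = 0 := by
  have h2 : wedge v (deriv (deriv γ) t) = 0 := deriv_apply_eq_zero h
  rw [curvature, wedge_eq_zero_of_wedge_eq_zero hv h.self_of_nhds h2, zero_div]

theorem IsLineSegment.curvature_eq_zero {γ : ℝ → Plane} {t₀ t₁ t : ℝ}
    (h : IsLineSegment γ t₀ t₁) (ht : t ∈ Ioo t₀ t₁) : curvature γ t = 0 := by
  obtain ⟨v, hv, hd⟩ := h.exists_wedge_deriv
  refine Reinhardt.curvature_eq_zero hv ?_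
  filter_upwards [Ioo_mem_nhds ht.1 ht.2] with τ hτ using hd τ hτ

/-- The quotient loses nothing: a zero denominator means zero velocity, and then the numerator
vanishes too. -/
theorem curvature_ne_zero_iff {γ : ℝ → Plane} {t : ℝ} :
    curvature γ t ≠ 0 ↔ wedge (deriv γ t) (deriv (deriv γ) t) ≠ 0 := by
  rw [curvature, Ne, Ne, div_eq_zero_iff, not_or]
  refine ⟨fun h => h.1, fun h => ⟨h, fun h0 => h ?_⟩⟩
  have : deriv γ t = 0 := by simpa using h0
  rw [this, wedge_zero_left]

/-- A line segment is not constant. -/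
theorem IsLineSegment.exists_deriv_ne_zero {γ : ℝ → Plane} {t₀ t₁ : ℝ}
    (h : IsLineSegment γ t₀ t₁) (hc : ContDiffOn ℝ 1 γ (Icc t₀ t₁)) (hlt : t₀ < t₁) :
    ∃ t ∈ Ioo t₀ t₁, deriv γ t ≠ 0 := by
  by_contra! hne
  obtain ⟨a, b, hab, him⟩ := h
  obtain ⟨ta, hta, rfl⟩ : a ∈ γ '' Icc t₀ t₁ := him ▸ left_mem_segment ℝ a b
  obtain ⟨tb, htb, rfl⟩ : b ∈ γ '' Icc t₀ t₁ := him ▸ right_mem_segment ℝ _ b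
  have hd : DifferentiableOn ℝ γ (Ioo t₀ t₁) :=
    (hc.differentiableOn one_ne_zero).mono Ioo_subset_Icc_self
  obtain ⟨c, hconst⟩ := isOpen_Ioo.exists_is_const_of_deriv_eq_zero isPreconnected_Ioo hd hne
  have heq : EqOn γ (fun _ => c) (Icc t₀ t₁) :=
    Set.EqOn.of_subset_closure (fun t ht => hconst t ht) hc.continuousOn continuousOn_const
      Ioo_subset_Icc_self (by rw [closure_Ioo hlt.ne])
  exact hab ((heq hta).trans (heq htb).symm)

theorem neg_isLineSegment {γ δ : ℝ → Plane} {t₀ t₁ : ℝ} (h : IsLineSegment γ t₀ t₁)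
    (hδ : ∀ t ∈ Icc t₀ t₁, δ t = -γ t) : IsLineSegment δ t₀ t₁ := by
  obtain ⟨a, b, hab, him⟩ := h
  refine ⟨-a, -b, fun h => hab (neg_inj.mp h), ?_⟩
  have : δ '' Icc t₀ t₁ = (fun p => -p) '' (γ '' Icc t₀ t₁) := by
    rw [image_image]; exact image_congr hδ
  rw [this, him]
  have := image_segment ℝ (-(LinearMap.id : Plane →ₗ[ℝ] Plane)).toAffineMap a b
  simpa using this

theorem IsMultiCurve.isLineSegment_add_three {σ : ZMod 6 → ℝ → Plane} {t₀ t₁ : ℝ}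
    (hσ : IsMultiCurve σ t₀ t₁) (j : ZMod 6) :
    IsLineSegment (σ (j + 3)) t₀ t₁ ↔ IsLineSegment (σ j) t₀ t₁ := by
  have h := fun t ht => (hσ.multiPoint t ht).add_three j
  refine ⟨fun hj => neg_isLineSegment hj fun t ht => ?_, fun hj => neg_isLineSegment hj h⟩
  rw [h t ht, neg_neg]

/-- In a multi-curve of rank two, exactly one of the three pairs of opposite curves consists of
line segments. -/
theorem HasRank.exists_index {σ : ZMod 6 → ℝ → Plane} {t₀ t₁ : ℝ} (h : HasRank σ t₀ t₁ 2) :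
    ∃ k : ZMod 6, ∀ j, IsLineSegment (σ j) t₀ t₁ ↔ j = k ∨ j = k + 3 := by
  classical
  have hr := h.2
  have h3 := h.1.isMultiCurve.isLineSegment_add_three
  rw [rank] at hr
  generalize hP : (fun j => IsLineSegment (σ j) t₀ t₁) = P
  have hP' : ∀ j, IsLineSegment (σ j) t₀ t₁ ↔ P j := fun j => by rw [← hP]
  simp only [hP'] at hr h3 ⊢
  have e : {j : ZMod 6 | j ∈ ({0, 2, 4} : Set (ZMod 6)) ∧ ¬ P j} =
      ↑(({0, 2, 4} : Finset (ZMod 6)).filter (fun j => ¬ P j)) := by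
    ext j; simp
  rw [e, Set.ncard_coe_finset] at hr
  have a3 : P 3 ↔ P 0 := by simpa using h3 0
  have a5 : P 5 ↔ P 2 := h3 2
  have a1 : P 1 ↔ P 4 := h3 4
  -- Each opposite pair is represented by one even index, which reduces the claim to three truth
  -- values and a finite check.
  have hall : ∀ k : ZMod 6, (∀ j, P j ↔ j = k ∨ j = k + 3) ↔
      (P 0 ↔ k = 0 ∨ k = 3) ∧ (P 2 ↔ k = 2 ∨ k = 5) ∧ (P 4 ↔ k = 4 ∨ k = 1) := by
    intro k
    constructor
    · intro hj
      rw [hj, hj, hj]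
      clear hj; revert k; decide
    · rintro ⟨q0, q2, q4⟩ j
      have : j = 0 ∨ j = 1 ∨ j = 2 ∨ j = 3 ∨ j = 4 ∨ j = 5 := by revert j; decide
      rcases this with rfl | rfl | rfl | rfl | rfl | rfl
      · rw [q0]; clear q0 q2 q4; revert k; decide
      · rw [a1, q4]; clear q0 q2 q4; revert k; decide
      · rw [q2]; clear q0 q2 q4; revert k; decide
      · rw [a3, q0]; clear q0 q2 q4; revert k; decide
      · rw [q4]; clear q0 q2 q4; revert k; decide
      · rw [a5, q2]; clear q0 q2 q4; revert k; decide
  simp only [hall]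
  by_cases h0 : P 0 <;> by_cases h2 : P 2 <;> by_cases h4 : P 4 <;>
    simp only [h0, h2, h4, Finset.filter_insert, Finset.filter_singleton, not_true_eq_false,
      not_false_eq_true, if_true, if_false] at hr ⊢
  all_goals first
    | exact absurd hr (by decide)
    | exact ⟨0, by decide⟩
    | exact ⟨2, by decide⟩
    | exact ⟨4, by decide⟩

theorem rank_eq_two {σ : ZMod 6 → ℝ → Plane} {t₀ t₁ : ℝ} {k : ZMod 6}
    (h : ∀ j, IsLineSegment (σ j) t₀ t₁ ↔ j = k ∨ j = k + 3) : rank σ t₀ t₁ = 2 := by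
  have e : {j : ZMod 6 | j ∈ ({0, 2, 4} : Set (ZMod 6)) ∧ ¬ IsLineSegment (σ j) t₀ t₁} =
      ↑(({0, 2, 4} : Finset (ZMod 6)).filter (fun j => ¬ (j = k ∨ j = k + 3))) := by
    ext j; simp [h]
  rw [rank, e, Set.ncard_coe_finset]
  clear e h
  revert k; decide

theorem HasRank.curvature_ne_zero {σ : ZMod 6 → ℝ → Plane} {t₀ t₁ : ℝ} {k : ZMod 6}
    (hσ : HasRank σ t₀ t₁ 2) (h : ∀ j, IsLineSegment (σ j) t₀ t₁ ↔ j = k ∨ j = k + 3)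
    {t : ℝ} {j : ZMod 6} (hj : j ≠ k ∧ j ≠ k + 3) (ht : t ∈ Ioo t₀ t₁) :
    wedge (deriv (σ j) t) (deriv (deriv (σ j)) t) ≠ 0 := by
  refine curvature_ne_zero_iff.mp
    ((hσ.1.segment_or_curved j).resolve_left (fun hl => ?_) t ht)
  rcases (h j).mp hl with h | h
  exacts [hj.1 h, hj.2 h]

/-! ### Signed areas along perturbed curves -/

theorem hasDerivAt_derivWithin {γ : ℝ → Plane} {t₀ t₁ t : ℝ}
    (hγ : ContDiffOn ℝ 1 γ (Icc t₀ t₁)) (ht : t ∈ Ioo t₀ t₁) :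
    HasDerivAt γ (derivWithin γ (Icc t₀ t₁) t) t := by
  have hn := Icc_mem_nhds ht.1 ht.2
  rw [derivWithin_of_mem_nhds hn]
  exact ((hγ.contDiffAt hn).differentiableAt one_ne_zero).hasDerivAt

/-- The two derivatives agree in the open interval. For a C¹ curve `derivWithin` is moreover
continuous up to the end points. -/
theorem signedArea_eq_derivWithin (γ : ℝ → Plane) {t₀ t₁ : ℝ} (h : t₀ ≤ t₁) :
    signedArea γ t₀ t₁ =
      (1 / 2) * ∫ t in t₀..t₁, wedge (γ t) (derivWithin γ (Icc t₀ t₁) t) := by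
  unfold signedArea
  congr 1
  rw [intervalIntegral.integral_of_le h, intervalIntegral.integral_of_le h,
    integral_Ioc_eq_integral_Ioo, integral_Ioc_eq_integral_Ioo]
  refine setIntegral_congr_fun measurableSet_Ioo fun t ht => ?_
  simp only [derivWithin_of_mem_nhds (Icc_mem_nhds ht.1 ht.2)]

theorem signedArea_congr {γ δ : ℝ → Plane} {t₀ t₁ : ℝ} (h : t₀ ≤ t₁) (he : EqOn γ δ (Icc t₀ t₁)) :
    signedArea γ t₀ t₁ = signedArea δ t₀ t₁ := by
  rw [signedArea_eq_derivWithin γ h, signedArea_eq_derivWithin δ h]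
  congr 1
  refine intervalIntegral.integral_congr fun t ht => ?_
  rw [uIcc_of_le h] at ht
  simp only [he ht, derivWithin_congr he (he ht)]

theorem signedArea_neg (γ : ℝ → Plane) (t₀ t₁ : ℝ) :
    signedArea (fun t => -γ t) t₀ t₁ = signedArea γ t₀ t₁ := by
  unfold signedArea
  congr 1
  refine intervalIntegral.integral_congr fun t _ => ?_
  simp only [deriv.fun_neg, wedge_neg_left, wedge_neg_right, neg_neg]

theorem continuousOn_wedge_derivWithin {γ δ : ℝ → Plane} {t₀ t₁ : ℝ} (h : t₀ < t₁)
    (hγ : ContDiffOn ℝ 1 γ (Icc t₀ t₁)) (hδ : ContDiffOn ℝ 1 δ (Icc t₀ t₁)) :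
    ContinuousOn (fun t => wedge (γ t) (derivWithin δ (Icc t₀ t₁) t)) (Icc t₀ t₁) :=
  continuousOn_wedge hγ.continuousOn
    (hδ.continuousOn_derivWithin (uniqueDiffOn_Icc h) le_rfl)

/-- The signed area is a quadratic function on each line of curves; its linear part is computed
by an integration by parts when the ends of the curve are fixed. -/
theorem signedArea_add_smul {γ η : ℝ → Plane} {t₀ t₁ : ℝ} (h : t₀ < t₁)
    (hγ : ContDiffOn ℝ 1 γ (Icc t₀ t₁)) (hη : ContDiffOn ℝ 1 η (Icc t₀ t₁))
    (h0 : η t₀ = 0) (h1 : η t₁ = 0) (a : ℝ) :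
    signedArea (fun t => γ t + a • η t) t₀ t₁ = signedArea γ t₀ t₁ +
      a * (∫ t in t₀..t₁, wedge (η t) (derivWithin γ (Icc t₀ t₁) t)) +
      a ^ 2 * signedArea η t₀ t₁ := by
  have ii : ∀ {γ δ : ℝ → Plane}, ContDiffOn ℝ 1 γ (Icc t₀ t₁) → ContDiffOn ℝ 1 δ (Icc t₀ t₁) →
      IntervalIntegrable (fun t => wedge (γ t) (derivWithin δ (Icc t₀ t₁) t)) volume t₀ t₁ := by
    intro γ δ hγ hδ
    apply ContinuousOn.intervalIntegrable
    rw [uIcc_of_le h.le]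
    exact continuousOn_wedge_derivWithin h hγ hδ
  -- The integrand is the derivative of `γ ∧ η`, and `η` vanishes at both ends; hence the two cross
  -- terms of the expansion have equal integrals.
  have hparts : ∫ t in t₀..t₁, (wedge (γ t) (derivWithin η (Icc t₀ t₁) t) -
      wedge (η t) (derivWithin γ (Icc t₀ t₁) t)) = 0 := by
    rw [intervalIntegral.integral_eq_sub_of_hasDerivAt_of_le h.le
      (f := fun t => wedge (γ t) (η t)) (continuousOn_wedge hγ.continuousOn hη.continuousOn)
      ?_ ((ii hγ hη).sub (ii hη hγ)), h0, h1]
    · simp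
    · intro t ht
      refine (hasDerivAt_wedge (hasDerivAt_derivWithin hγ ht)
        (hasDerivAt_derivWithin hη ht)).congr_deriv ?_
      rw [wedge_swap (derivWithin γ _ t)]; ring
  rw [intervalIntegral.integral_sub (ii hγ hη) (ii hη hγ), sub_eq_zero] at hparts
  rw [signedArea_eq_derivWithin _ h.le, signedArea_eq_derivWithin _ h.le,
    signedArea_eq_derivWithin _ h.le]
  have hexp : ∫ t in t₀..t₁, wedge (γ t + a • η t)
      (derivWithin (fun t => γ t + a • η t) (Icc t₀ t₁) t) =
      ∫ t in t₀..t₁, (wedge (γ t) (derivWithin γ (Icc t₀ t₁) t) +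
        (a * wedge (γ t) (derivWithin η (Icc t₀ t₁) t) +
        (a * wedge (η t) (derivWithin γ (Icc t₀ t₁) t) +
        a ^ 2 * wedge (η t) (derivWithin η (Icc t₀ t₁) t)))) := by
    refine intervalIntegral.integral_congr fun t ht => ?_
    rw [uIcc_of_le h.le] at ht
    have d1 := (hγ.differentiableOn one_ne_zero t ht).hasDerivWithinAt
    have d2 := (hη.differentiableOn one_ne_zero t ht).hasDerivWithinAt
    simp only [wedge_add_left, wedge_smul_left]
    have : derivWithin (fun t => γ t + a • η t) (Icc t₀ t₁) t =
        derivWithin γ (Icc t₀ t₁) t + a • derivWithin η (Icc t₀ t₁) t :=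
      (d1.add (d2.const_smul a)).derivWithin (uniqueDiffOn_Icc h t ht)
    rw [this]
    simp only [wedge_add_right, wedge_smul_right]
    ring
  rw [hexp, intervalIntegral.integral_add (ii hγ hγ) (((ii hγ hη).const_mul a).add
      (((ii hη hγ).const_mul a).add ((ii hη hη).const_mul _))),
    intervalIntegral.integral_add ((ii hγ hη).const_mul a)
      (((ii hη hγ).const_mul a).add ((ii hη hη).const_mul _)),
    intervalIntegral.integral_add ((ii hη hγ).const_mul a) ((ii hη hη).const_mul _),
    intervalIntegral.integral_const_mul, intervalIntegral.integral_const_mul,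
    intervalIntegral.integral_const_mul, hparts]
  ring

theorem hasDerivAt_signedArea_add_smul {γ η : ℝ → Plane} {t₀ t₁ : ℝ} (h : t₀ < t₁)
    (hγ : ContDiffOn ℝ 1 γ (Icc t₀ t₁)) (hη : ContDiffOn ℝ 1 η (Icc t₀ t₁))
    (h0 : η t₀ = 0) (h1 : η t₁ = 0) :
    HasDerivAt (fun a : ℝ => signedArea (fun t => γ t + a • η t) t₀ t₁)
      (∫ t in t₀..t₁, wedge (η t) (derivWithin γ (Icc t₀ t₁) t)) 0 := by
  have h2 : HasDerivAt (fun a : ℝ => a ^ 2) 0 0 := by simpa using hasDerivAt_pow (𝕜 := ℝ) 2 0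
  refine (((((hasDerivAt_id (0 : ℝ)).mul_const _).const_add _).add
    (h2.mul_const _)).congr_deriv ?_).congr_of_eventuallyEq
    (Eventually.of_forall fun a => signedArea_add_smul h hγ hη h0 h1 a)
  simp

/-! ### The sliding variation -/

/-- The coefficients of the variation that slides the chord from `σ (k + 1)` to `σ (k + 2)`
along the direction of `σ k`. -/
def slideCoeff : ZMod 6 → ℝ := ![0, 1, 1, 0, -1, -1]

/-- The variation that slides the chord from `σ (k + 1)` to `σ (k + 2)` along the direction of
`σ k`, by the amount `ε * m t`. -/
def slide (σ : ZMod 6 → ℝ → Plane) (k : ZMod 6) (m : ℝ → ℝ) (ε : ℝ) (j : ZMod 6) (t : ℝ) :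
    Plane :=
  σ j t + ε • slideCoeff (j - k) • m t • σ k t

section slide

variable {σ : ZMod 6 → ℝ → Plane} {k : ZMod 6} {m : ℝ → ℝ} {ε t : ℝ}

theorem slide_self : slide σ k m ε k t = σ k t := by
  have : slideCoeff 0 = 0 := rfl
  simp [slide, this]

theorem slide_one : slide σ k m ε (k + 1) t = σ (k + 1) t + ε • m t • σ k t := by
  have : slideCoeff 1 = 1 := rfl
  simp [slide, this]

theorem slide_two : slide σ k m ε (k + 2) t = σ (k + 2) t + ε • m t • σ k t := by
  have : slideCoeff 2 = 1 := rfl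
  simp [slide, this]

/-- A multiple of `σ k` added to `σ (k + 2)` does not change `σ k ∧ σ (k + 2)`, and the difference
of `σ (k + 1)` and `σ (k + 2)` is kept because both move alike. -/
theorem isMultiPoint_slide (h : IsMultiPoint (fun j => σ j t)) :
    IsMultiPoint (fun j => slide σ k m ε j t) := by
  have c3 : slideCoeff 3 = 0 := rfl
  have c4 : slideCoeff 4 = -1 := rfl
  have c5 : slideCoeff 5 = -1 := rfl
  have h1 := h.add_one k
  have h3 := h.add_three k
  have h4 := h.add_four k
  have h5 := h.add_five k
  refine isMultiPoint_of k ?_ ?_ ?_ ?_ ?_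
  · rw [slide_one, slide_two, slide_self, h1]; abel
  · rw [slide_self]; simp [slide, c3, h3]
  · rw [slide_two, slide_self]; simp [slide, c4, h4]; abel
  · rw [slide_two]; simp [slide, c5, h5]; abel
  · rw [slide_two, slide_self, wedge_add_right, wedge_smul_right, wedge_smul_right, wedge_self,
      (h k).2.2]
    ring

end slide

/-- The chord joining the two curves that follow a line segment does not keep a position dual to
this line segment. -/
theorem HasRank.exists_wedge_ne_zero {σ : ZMod 6 → ℝ → Plane} {t₀ t₁ : ℝ} {k : ZMod 6}
    (hσ : HasRank σ t₀ t₁ 2) (hk : ∀ j, IsLineSegment (σ j) t₀ t₁ ↔ j = k ∨ j = k + 3) :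
    ∃ t ∈ Ioo t₀ t₁, wedge (σ k t) (deriv (σ (k + 1)) t + deriv (σ (k + 2)) t) ≠ 0 := by
  by_contra! hF
  have hmc := hσ.1.isMultiCurve
  have hseg := (hk k).mpr (Or.inl rfl)
  obtain ⟨v, hv, hvd⟩ := hseg.exists_wedge_deriv
  obtain ⟨t, ht, hdt⟩ := hseg.exists_deriv_ne_zero (hmc.contDiffOn k) hmc.lt
  have hd : ∀ j, ∀ t ∈ Ioo t₀ t₁, HasDerivAt (σ j) (deriv (σ j) t) t := fun j t ht =>
    (((hmc.contDiffOn j).contDiffAt (Icc_mem_nhds ht.1 ht.2)).differentiableAt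
      one_ne_zero).hasDerivAt
  have hcd : ContinuousAt (deriv (σ k)) t :=
    (((hmc.contDiffOn k).mono Ioo_subset_Icc_self).continuousOn_deriv_of_isOpen isOpen_Ioo
      le_rfl).continuousAt (Ioo_mem_nhds ht.1 ht.2)
  -- A segment may be traversed with zero speed at some times; near `t` its velocity does determine
  -- its direction `v`.
  have hev : ∀ᶠ τ in 𝓝 t, τ ∈ Ioo t₀ t₁ ∧ deriv (σ k) τ ≠ 0 :=
    Filter.Eventually.and (Ioo_mem_nhds ht.1 ht.2) (hcd.eventually_ne hdt)
  -- The constant `σ k ∧ (σ (k + 1) + σ (k + 2)) = √3` is differentiated; one of the two terms is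
  -- zero by `hF`, so the other one is zero.
  have hdir : ∀ᶠ τ in 𝓝 t, wedge v (σ (k + 1) τ + σ (k + 2) τ) = 0 := by
    filter_upwards [hev] with τ hτ
    refine wedge_eq_zero_of_wedge_eq_zero hτ.2
      (by rw [wedge_swap, hvd τ hτ.1, neg_zero]) ?_
    have h1 := hasDerivAt_wedge (hd k τ hτ.1) ((hd (k + 1) τ hτ.1).add (hd (k + 2) τ hτ.1))
    have h2 : HasDerivAt (fun τ => wedge (σ k τ) (σ (k + 1) τ + σ (k + 2) τ)) 0 τ := by
      refine (hasDerivAt_const τ (√3)).congr_of_eventuallyEq ?_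
      filter_upwards [Icc_mem_nhds hτ.1.1 hτ.1.2] with s hs
      have hm := hmc.multiPoint s hs
      have h1 := hm.add_one k
      rw [h1, wedge_add_right, wedge_add_right, wedge_self, (hm k).2.2]
      ring
    have h3 := h1.unique h2
    rw [hF τ hτ.1, add_zero] at h3
    exact h3
  have hc2 : ∀ᶠ τ in 𝓝 t, wedge v (deriv (σ (k + 2)) τ) = 0 := by
    filter_upwards [hev, hdir.eventually_nhds] with τ hτ hdτ
    have h1 : wedge v (deriv (fun τ => σ (k + 1) τ + σ (k + 2) τ) τ) = 0 :=
      deriv_apply_eq_zero hdτ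
    -- The sum equals `σ k + 2 σ (k + 2)`, and `σ k` already moves along `v`.
    have h2 : HasDerivAt (fun τ => σ (k + 1) τ + σ (k + 2) τ)
        (deriv (σ k) τ + (2 : ℝ) • deriv (σ (k + 2)) τ) τ := by
      refine ((hd k τ hτ.1).add ((hd (k + 2) τ hτ.1).const_smul (2 : ℝ))).congr_of_eventuallyEq ?_
      filter_upwards [Icc_mem_nhds hτ.1.1 hτ.1.2] with s hs
      have h1 := (hmc.multiPoint s hs).add_one k
      simp only [h1, Pi.add_apply, two_smul]
      abel
    rw [h2.deriv, wedge_add_right, wedge_smul_right, hvd τ hτ.1] at h1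
    linarith
  refine curvature_ne_zero_iff.mpr (hσ.curvature_ne_zero hk (j := k + 2) ?_ ht)
    (curvature_eq_zero hv hc2)
  clear hk hσ hF hmc hseg hvd hdt hd hcd hev hdir hc2 ht
  revert k; decide

/-- The segment `σ k` is not moved at all. For the other curves, nonzero curvature is an open
condition on the compact set `Icc a b`, and outside it nothing changes; this matters because
curvature may degenerate towards `t₀` and `t₁`. -/
theorem isRankPreservingVariation_slide {σ : ZMod 6 → ℝ → Plane} {t₀ t₁ a b : ℝ} {k : ZMod 6}
    {m : ℝ → ℝ} (hσ : HasRank σ t₀ t₁ 2)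
    (hk : ∀ j, IsLineSegment (σ j) t₀ t₁ ↔ j = k ∨ j = k + 3) (hm : ContDiff ℝ 2 m)
    (ha : t₀ < a) (hab : a ≤ b) (hb : b < t₁) (hsupp : ∀ t, t ∉ Icc a b → m t = 0) :
    IsRankPreservingVariation σ t₀ t₁ 2 (slide σ k m) := by
  have hmc := hσ.1.isMultiCurve
  have hc2 : ∀ j, ContDiffOn ℝ 2 (σ j) (Icc t₀ t₁) := hσ.1.contDiffOn
  have hη : ∀ j, ContDiffOn ℝ 2 (fun t => slideCoeff (j - k) • m t • σ k t) (Icc t₀ t₁) :=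
    fun j => (hm.contDiffOn.smul (hc2 k)).const_smul _
  have hcd : ∀ ε j, ContDiffOn ℝ 2 (slide σ k m ε j) (Icc t₀ t₁) :=
    fun ε j => (hc2 j).add ((hη j).const_smul ε)
  have hmp : ∀ ε, IsMultiCurve (slide σ k m ε) t₀ t₁ := fun ε =>
    ⟨hmc.lt, fun j => (hcd ε j).of_le (by norm_num),
      fun t ht => isMultiPoint_slide (hmc.multiPoint t ht)⟩
  refine ⟨fun j => ?_, fun j t _ => by simp [slide], ⟨a, b, ha, hab, hb, fun ε j t _ ht => ?_⟩, ?_⟩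
  · have hsnd : ContDiffOn ℝ 2 (fun p : ℝ × ℝ => p.2) (univ ×ˢ Icc t₀ t₁) :=
      contDiff_snd.contDiffOn
    have hmaps : MapsTo (fun p : ℝ × ℝ => p.2) (univ ×ˢ Icc t₀ t₁) (Icc t₀ t₁) := fun p hp => hp.2
    exact ((hc2 j).comp hsnd hmaps).add (contDiff_fst.contDiffOn.smul ((hη j).comp hsnd hmaps))
  · simp [slide, hsupp t ht]
  have hcurv : ∀ j, j ≠ k ∧ j ≠ k + 3 → ∀ᶠ ε in 𝓝 (0 : ℝ), ∀ t ∈ Ioo t₀ t₁,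
      wedge (deriv (slide σ k m ε j) t) (deriv (deriv (slide σ k m ε j)) t) ≠ 0 := by
    intro j hj
    set η : ℝ → Plane := fun t => slideCoeff (j - k) • m t • σ k t with hηdef
    have hop : IsOpen (Ioo t₀ t₁) := isOpen_Ioo
    have d1 : ∀ ε, ∀ t ∈ Ioo t₀ t₁,
        deriv (slide σ k m ε j) t = deriv (σ j) t + ε • deriv η t := fun ε t ht =>
      ((hasDerivAt_of_contDiffOn_two (hc2 j) ht).1.add
        ((hasDerivAt_of_contDiffOn_two (hη j) ht).1.const_smul ε)).deriv
    have d2 : ∀ ε, ∀ t ∈ Ioo t₀ t₁,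
        deriv (deriv (slide σ k m ε j)) t = deriv (deriv (σ j)) t + ε • deriv (deriv η) t := by
      intro ε t ht
      refine HasDerivAt.deriv (((hasDerivAt_of_contDiffOn_two (hc2 j) ht).2.1.add
        ((hasDerivAt_of_contDiffOn_two (hη j) ht).2.1.const_smul ε)).congr_of_eventuallyEq ?_)
      filter_upwards [hop.mem_nhds ht] with τ hτ using d1 ε τ hτ
    have hcpt : ∀ᶠ ε in 𝓝 (0 : ℝ), ∀ t ∈ Icc a b,
        wedge (deriv (σ j) t + ε • deriv η t)
          (deriv (deriv (σ j)) t + ε • deriv (deriv η) t) ≠ 0 := by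
      refine isCompact_Icc.eventually_forall_of_forall_eventually fun t ht => ?_
      have ht' : t ∈ Ioo t₀ t₁ := ⟨ha.trans_le ht.1, ht.2.trans_lt hb⟩
      have hs : ∀ {f : ℝ → Plane}, ContinuousAt f t →
          ContinuousAt (fun z : ℝ × ℝ => f z.2) ((0 : ℝ), t) := fun hf =>
        ContinuousAt.comp (f := Prod.snd) (x := ((0 : ℝ), t)) hf continuousAt_snd
      have k1 := hasDerivAt_of_contDiffOn_two (hc2 j) ht'
      have k2 := hasDerivAt_of_contDiffOn_two (hη j) ht'
      refine ContinuousAt.eventually_ne (continuousAt_wedge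
        ((hs k1.2.1.continuousAt).add (continuousAt_fst.smul (hs k2.2.1.continuousAt)))
        ((hs k1.2.2).add (continuousAt_fst.smul (hs k2.2.2)))) ?_
      simpa using hσ.curvature_ne_zero hk hj ht'
    filter_upwards [hcpt] with ε hε t ht
    by_cases htab : t ∈ Icc a b
    · rw [d1 ε t ht, d2 ε t ht]
      exact hε t htab
    · have he : slide σ k m ε j =ᶠ[𝓝 t] σ j := by
        filter_upwards [isClosed_Icc.isOpen_compl.mem_nhds htab] with τ hτ
        simp [slide, hsupp τ hτ]
      rw [he.deriv_eq, he.deriv.deriv_eq]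
      exact hσ.curvature_ne_zero hk hj ht
  have hcurv' : ∀ᶠ ε in 𝓝 (0 : ℝ), ∀ j, j ≠ k ∧ j ≠ k + 3 → ∀ t ∈ Ioo t₀ t₁,
      curvature (slide σ k m ε j) t ≠ 0 := by
    rw [eventually_all]
    intro j
    by_cases hj : j ≠ k ∧ j ≠ k + 3
    · filter_upwards [hcurv j hj] with ε hε _ t ht using curvature_ne_zero_iff.mpr (hε t ht)
    · exact Eventually.of_forall fun ε h => absurd h hj
  filter_upwards [hcurv'] with ε hε
  have hsegk : IsLineSegment (slide σ k m ε k) t₀ t₁ := by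
    have : slide σ k m ε k = σ k := funext fun t => slide_self
    rw [this]
    exact (hk k).mpr (Or.inl rfl)
  have hseg : ∀ j, IsLineSegment (slide σ k m ε j) t₀ t₁ ↔ j = k ∨ j = k + 3 := by
    intro j
    constructor
    · intro hj
      by_contra! hne
      obtain ⟨t, ht⟩ := nonempty_Ioo.mpr hmc.lt
      exact hε j hne t ht (hj.curvature_eq_zero ht)
    · rintro (rfl | rfl)
      · exact hsegk
      · exact ((hmp ε).isLineSegment_add_three k).mpr hsegk
  refine ⟨⟨hmp ε, hcd ε, fun j => ?_⟩, rank_eq_two hseg⟩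
  by_cases hj : j = k ∨ j = k + 3
  · exact Or.inl ((hseg j).mpr hj)
  · exact Or.inr (hε j (not_or.mp hj))

theorem HasRank.exists_variation {σ : ZMod 6 → ℝ → Plane} {t₀ t₁ : ℝ}
    (hσ : HasRank σ t₀ t₁ 2) :
    ∃ (Φ : ℝ → ZMod 6 → ℝ → Plane) (d : ℝ), IsRankPreservingVariation σ t₀ t₁ 2 Φ ∧ d ≠ 0 ∧
      HasDerivAt (fun ε => ∑ j, signedArea (Φ ε j) t₀ t₁) (2 * d) 0 ∧
      ∀ k, IsLineSegment (σ k) t₀ t₁ →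
        HasDerivAt (fun ε => signedArea (Φ ε (k + 1)) t₀ t₁ + signedArea (Φ ε (k + 2)) t₀ t₁)
          d 0 := by
  obtain ⟨k, hk⟩ := hσ.exists_index
  obtain ⟨t, ht, hF⟩ := hσ.exists_wedge_ne_zero hk
  have hmc := hσ.1.isMultiCurve
  have hlt := hmc.lt
  have hc1 := hmc.contDiffOn
  -- `F` is the density of the first variation with respect to `m`.
  set F : ℝ → ℝ := fun τ => wedge (σ k τ) (derivWithin (σ (k + 1)) (Icc t₀ t₁) τ) +
    wedge (σ k τ) (derivWithin (σ (k + 2)) (Icc t₀ t₁) τ) with hFdef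
  have hFt : F t ≠ 0 := by
    have hn := Icc_mem_nhds ht.1 ht.2
    simpa only [hFdef, derivWithin_of_mem_nhds hn, ← wedge_add_right] using hF
  have hFc : ContinuousOn F (Icc t₀ t₁) :=
    (continuousOn_wedge_derivWithin hlt (hc1 k) (hc1 (k + 1))).add
      (continuousOn_wedge_derivWithin hlt (hc1 k) (hc1 (k + 2)))
  have hev : ∀ᶠ τ in 𝓝 t, τ ∈ Ioo t₀ t₁ ∧ 0 < F t * F τ := by
    refine Filter.Eventually.and (Ioo_mem_nhds ht.1 ht.2) ?_
    have hca : ContinuousAt (fun τ => F t * F τ) t :=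
      continuousAt_const.mul (hFc.continuousAt (Icc_mem_nhds ht.1 ht.2))
    exact hca.eventually_const_lt (mul_self_pos.mpr hFt)
  obtain ⟨r, hr, hball⟩ := Metric.eventually_nhds_iff_ball.mp hev
  -- The support lies in the ball on which `F` keeps the sign of `F t`.
  let m : ContDiffBump t := ⟨r / 4, r / 2, by positivity, by linarith⟩
  have hsupp : ∀ τ, τ ∉ Icc (t - r / 2) (t + r / 2) → m τ = 0 := by
    intro τ hτ
    refine m.zero_of_le_dist ?_
    rw [Real.dist_eq]
    by_contra! hlt
    rw [abs_lt] at hlt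
    exact hτ ⟨by change _ at hlt; have := hlt.1; change -(r / 2) < _ at this; linarith,
      by have := hlt.2; change _ < r / 2 at this; linarith⟩
  have hin : ∀ s, |s| < r → t + s ∈ Ioo t₀ t₁ := fun s hs =>
    (hball (t + s) (by rw [Metric.mem_ball, Real.dist_eq]; simpa using hs)).1
  have ha : t₀ < t - r / 2 := by
    have := (hin (-(r / 2)) (by rw [abs_neg, abs_of_pos (by positivity)]; linarith)).1
    linarith
  have hb : t + r / 2 < t₁ := (hin (r / 2) (by rw [abs_of_pos (by positivity)]; linarith)).2
  have hΦ := isRankPreservingVariation_slide hσ hk (m := m) m.contDiff ha (by linarith) hb hsupp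
  have hη : ContDiffOn ℝ 1 (fun τ => m τ • σ k τ) (Icc t₀ t₁) :=
    (m.contDiff (n := 1)).contDiffOn.smul (hc1 k)
  have hη0 : m t₀ • σ k t₀ = 0 := by
    rw [hsupp t₀ (fun h => by linarith [h.1]), zero_smul]
  have hη1 : m t₁ • σ k t₁ = 0 := by
    rw [hsupp t₁ (fun h => by linarith [h.2]), zero_smul]
  have D1 := hasDerivAt_signedArea_add_smul hlt (hc1 (k + 1)) hη hη0 hη1
  have D2 := hasDerivAt_signedArea_add_smul hlt (hc1 (k + 2)) hη hη0 hη1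
  have D := D1.add D2
  set d : ℝ := (∫ τ in t₀..t₁, wedge (m τ • σ k τ) (derivWithin (σ (k + 1)) (Icc t₀ t₁) τ)) +
    ∫ τ in t₀..t₁, wedge (m τ • σ k τ) (derivWithin (σ (k + 2)) (Icc t₀ t₁) τ) with hd
  have hdF : d = ∫ τ in t₀..t₁, m τ * F τ := by
    have ii : ∀ j, IntervalIntegrable
        (fun τ => wedge (m τ • σ k τ) (derivWithin (σ j) (Icc t₀ t₁) τ)) volume t₀ t₁ := by
      intro j
      apply ContinuousOn.intervalIntegrable
      rw [uIcc_of_le hlt.le]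
      exact continuousOn_wedge_derivWithin hlt hη (hc1 j)
    rw [hd, ← intervalIntegral.integral_add (ii _) (ii _)]
    refine intervalIntegral.integral_congr fun τ _ => ?_
    simp only [hFdef, wedge_smul_left]; ring
  have hd0 : d ≠ 0 := by
    have hpos : 0 < ∫ τ in t₀..t₁, F t * (m τ * F τ) := by
      refine intervalIntegral.integral_pos hlt
        (continuousOn_const.mul (m.continuous.continuousOn.mul hFc)) (fun τ hτ => ?_)
        ⟨t, ⟨ht.1.le, ht.2.le⟩, ?_⟩
      · by_cases hτb : τ ∈ Metric.ball t r
        · have := (hball τ hτb).2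
          have hm := m.nonneg (x := τ)
          nlinarith
        · rw [m.zero_of_le_dist, zero_mul, mul_zero]
          rw [Metric.mem_ball, not_lt] at hτb
          exact le_trans (by change r / 2 ≤ r; linarith) hτb
      · have : m t = 1 := m.one_of_mem_closedBall (Metric.mem_closedBall_self (by positivity))
        rw [this, one_mul]
        exact mul_self_pos.mpr hFt
    rw [intervalIntegral.integral_const_mul, ← hdF] at hpos
    exact fun h => by simp [h] at hpos
  have e3 : ∀ ε j, signedArea (slide σ k m ε (j + 3)) t₀ t₁ =
      signedArea (slide σ k m ε j) t₀ t₁ := by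
    intro ε j
    rw [← signedArea_neg (slide σ k m ε j)]
    exact signedArea_congr hlt.le fun τ hτ =>
      (isMultiPoint_slide (hmc.multiPoint τ hτ)).add_three j
  have hD : HasDerivAt (fun ε => signedArea (slide σ k m ε (k + 1)) t₀ t₁ +
      signedArea (slide σ k m ε (k + 2)) t₀ t₁) d 0 := by
    refine D.congr_of_eventuallyEq (Eventually.of_forall fun ε => ?_)
    have s1 : slide σ k m ε (k + 1) = fun τ => σ (k + 1) τ + ε • m τ • σ k τ :=
      funext fun τ => slide_one
    have s2 : slide σ k m ε (k + 2) = fun τ => σ (k + 2) τ + ε • m τ • σ k τ :=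
      funext fun τ => slide_two
    simp only [s1, s2, Pi.add_apply]
  refine ⟨slide σ k m, d, hΦ, hd0, ?_, fun k' hk' => ?_⟩
  -- Opposite curves enclose equal signed areas and the pair of segments contributes a constant;
  -- this is the factor 2 in the derivative of the total area.
  · have hsum : ∀ ε, ∑ j, signedArea (slide σ k m ε j) t₀ t₁ = 2 * signedArea (σ k) t₀ t₁ +
        2 * (signedArea (slide σ k m ε (k + 1)) t₀ t₁ +
          signedArea (slide σ k m ε (k + 2)) t₀ t₁) := by
      intro ε
      have hs0 : slide σ k m ε k = σ k := funext fun τ => slide_self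
      rw [← Equiv.sum_comp (Equiv.addLeft k)]
      have hsix : ∀ f : ZMod 6 → ℝ, ∑ j, f j = f 0 + f 1 + f 2 + f 3 + f 4 + f 5 :=
        fun f => Fin.sum_univ_six f
      have h4 := e3 ε (k + 1)
      have h5 := e3 ε (k + 2)
      rw [show k + 1 + 3 = k + 4 by ring] at h4
      rw [show k + 2 + 3 = k + 5 by ring] at h5
      simp only [hsix, Equiv.coe_addLeft, add_zero, e3, h4, h5, hs0]
      ring
    simp only [hsum]
    exact (hD.const_mul 2).const_add _
  · rcases (hk k').mp hk' with rfl | rfl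
    · exact hD
    · have h4 : ∀ ε, signedArea (slide σ k m ε (k + 3 + 1)) t₀ t₁ =
          signedArea (slide σ k m ε (k + 1)) t₀ t₁ := fun ε => by
        rw [show k + 3 + 1 = k + 1 + 3 by ring, e3]
      have h5 : ∀ ε, signedArea (slide σ k m ε (k + 3 + 2)) t₀ t₁ =
          signedArea (slide σ k m ε (k + 2)) t₀ t₁ := fun ε => by
        rw [show k + 3 + 2 = k + 2 + 3 by ring, e3]
      simp only [h4, h5]
      exact hD

/-! ### Areas of sectors -/

/-- The coordinates of the plane, as a measurable equivalence. -/
def planeProd : Plane ≃ᵐ ℝ × ℝ :=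
  (MeasurableEquiv.toLp 2 (Fin 2 → ℝ)).symm.trans MeasurableEquiv.finTwoArrow

theorem measurePreserving_planeProd : MeasurePreserving planeProd :=
  (EuclideanSpace.volume_preserving_symm_measurableEquiv_toLp (Fin 2)).trans
    (volume_preserving_finTwoArrow ℝ)

theorem volume_image_planeProd (S : Set Plane) : volume (planeProd '' S) = volume S := by
  rw [← measurePreserving_planeProd.measure_preimage_equiv, preimage_image_eq _ planeProd.injective]

theorem volume_segment_eq_zero (p : Plane) : volume (segment ℝ 0 p) = 0 := by
  refine measure_mono_null (t := (Submodule.span ℝ {p} : Submodule ℝ Plane)) ?_ ?_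
  · rintro q ⟨a, b, -, -, -, rfl⟩
    rw [smul_zero, zero_add]
    exact Submodule.smul_mem _ _ (Submodule.mem_span_singleton_self p)
  · refine Measure.addHaar_submodule _ _ fun h => ?_
    have h1 := finrank_span_le_card (R := ℝ) ({p} : Set Plane)
    rw [h, finrank_top, finrank_euclideanSpace_fin] at h1
    simp at h1

/-- This is the numerator in the derivative of a quotient of two linear forms along a curve; it
reduces to a multiple of `γ ∧ γ'`. -/
theorem wedge_mul_wedge_sub (a w b b' : Plane) :
    wedge a b' * wedge w b - wedge a b * wedge w b' = wedge w a * wedge b b' := by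
  simp only [wedge]; ring

/-- A curve that moves counterclockwise inside an open half plane. -/
structure IsSweeping (γ : ℝ → Plane) (t₀ t₁ : ℝ) : Prop where
  wedge_pos : ∀ t ∈ Ioo t₀ t₁, 0 < wedge (γ t) (deriv γ t)
  half_plane : ∃ w : Plane, ∀ t ∈ Ioo t₀ t₁, 0 < wedge w (γ t)

/-- The quotient `(γ t ∧ γ τ) / (w ∧ γ τ)` replaces the angle: it is defined on the half plane,
vanishes at `τ = t`, and increases strictly. -/
theorem IsSweeping.wedge_pos_of_lt {γ : ℝ → Plane} {t₀ t₁ : ℝ} (h : IsSweeping γ t₀ t₁)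
    (hd : ∀ t ∈ Ioo t₀ t₁, HasDerivAt γ (deriv γ t) t) {t t' : ℝ} (ht : t ∈ Ioo t₀ t₁)
    (ht' : t' ∈ Ioo t₀ t₁) (hlt : t < t') : 0 < wedge (γ t) (γ t') := by
  obtain ⟨w, hw⟩ := h.half_plane
  have hder : ∀ τ ∈ Ioo t₀ t₁, HasDerivAt (fun τ => wedge (γ t) (γ τ) / wedge w (γ τ))
      (wedge w (γ t) * wedge (γ τ) (deriv γ τ) / wedge w (γ τ) ^ 2) τ := by
    intro τ hτ
    refine ((hasDerivAt_wedge (hasDerivAt_const τ (γ t)) (hd τ hτ)).div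
      (hasDerivAt_wedge (hasDerivAt_const τ w) (hd τ hτ)) (hw τ hτ).ne').congr_deriv ?_
    simp only [wedge_zero_left, zero_add, wedge_mul_wedge_sub]
  have hmono : StrictMonoOn (fun τ => wedge (γ t) (γ τ) / wedge w (γ τ)) (Ioo t₀ t₁) := by
    refine strictMonoOn_of_deriv_pos (convex_Ioo _ _)
      (fun τ hτ => (hder τ hτ).continuousAt.continuousWithinAt) fun τ hτ => ?_
    rw [interior_Ioo] at hτ
    rw [(hder τ hτ).deriv]
    have := hw τ hτ
    have := h.wedge_pos τ hτ
    have := hw t ht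
    positivity
  have h1 := hmono ht ht' hlt
  simp only [wedge_self, zero_div] at h1
  exact (div_pos_iff_of_pos_right (hw t' ht')).mp h1

/-- The derivative of `(r, t) ↦ r • γ t`, in coordinates. -/
def sectorDeriv (γ : ℝ → Plane) (p : ℝ × ℝ) : ℝ × ℝ →L[ℝ] ℝ × ℝ :=
  (Matrix.toLin (.finTwoProd ℝ) (.finTwoProd ℝ)
    !![γ p.2 0, p.1 * deriv γ p.2 0; γ p.2 1, p.1 * deriv γ p.2 1]).toContinuousLinearMap

theorem det_sectorDeriv (γ : ℝ → Plane) (p : ℝ × ℝ) :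
    (sectorDeriv γ p).det = p.1 * wedge (γ p.2) (deriv γ p.2) := by
  unfold sectorDeriv
  simp only [LinearMap.det_toContinuousLinearMap, LinearMap.det_toLin, Matrix.det_fin_two_of, wedge]
  ring

theorem hasFDerivAt_sector {γ : ℝ → Plane} {p : ℝ × ℝ} (h : HasDerivAt γ (deriv γ p.2) p.2) :
    HasFDerivAt (fun q : ℝ × ℝ => planeProd (q.1 • γ q.2)) (sectorDeriv γ p) p := by
  unfold sectorDeriv
  rw [Matrix.toLin_finTwoProd_toContinuousLinearMap]
  have hs : HasFDerivAt (fun q : ℝ × ℝ => q.2) (ContinuousLinearMap.snd ℝ ℝ ℝ) p := hasFDerivAt_snd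
  have h0 := HasDerivAt.comp_hasFDerivAt p (hasDerivAt_apply h 0) hs
  have h1 := HasDerivAt.comp_hasFDerivAt p (hasDerivAt_apply h 1) hs
  convert! HasFDerivAt.prodMk (𝕜 := ℝ) (hasFDerivAt_fst.mul h0) (hasFDerivAt_fst.mul h1) using 2 <;>
    simp [smul_smul, add_comm]

/-- Polar integration: `(r, t) ↦ r • γ t` is injective on `(0, 1] × (t₀, t₁)`, has Jacobian `r * (γ
∧ γ')`, and covers the sector up to the two end segments, which are null sets. -/
theorem IsSweeping.sectorArea_eq {γ : ℝ → Plane} {t₀ t₁ : ℝ} (h : IsSweeping γ t₀ t₁)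
    (hlt : t₀ < t₁) (hγ : ContDiffOn ℝ 1 γ (Icc t₀ t₁)) :
    sectorArea γ t₀ t₁ = signedArea γ t₀ t₁ := by
  have hd : ∀ t ∈ Ioo t₀ t₁, HasDerivAt γ (deriv γ t) t := fun t ht =>
    ((hγ.contDiffAt (Icc_mem_nhds ht.1 ht.2)).differentiableAt one_ne_zero).hasDerivAt
  set S : Set (ℝ × ℝ) := Ioc 0 1 ×ˢ Ioo t₀ t₁ with hS
  set F : ℝ × ℝ → Plane := fun q => q.1 • γ q.2 with hF
  have hsub : F '' S ⊆ {p : Plane | ∃ t ∈ Icc t₀ t₁, p ∈ segment ℝ 0 (γ t)} := by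
    rintro _ ⟨⟨r, t⟩, ⟨hr, ht⟩, rfl⟩
    exact ⟨t, Ioo_subset_Icc_self ht, 1 - r, r, sub_nonneg.mpr hr.2, hr.1.le, by ring, by simp [hF]⟩
  have hsup : {p : Plane | ∃ t ∈ Icc t₀ t₁, p ∈ segment ℝ 0 (γ t)} ⊆
      F '' S ∪ (segment ℝ 0 (γ t₀) ∪ segment ℝ 0 (γ t₁)) := by
    rintro p ⟨t, ht, hp⟩
    obtain ⟨a, r, ha, hr, har, rfl⟩ := hp
    rw [smul_zero, zero_add]
    rcases hr.eq_or_lt with rfl | hr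
    · rw [zero_smul]; exact Or.inr (Or.inl (left_mem_segment ℝ _ _))
    rcases ht.1.eq_or_lt with rfl | h0
    · exact Or.inr (Or.inl ⟨a, r, ha, hr.le, har, by simp⟩)
    rcases ht.2.eq_or_lt with rfl | h1
    · exact Or.inr (Or.inr ⟨a, r, ha, hr.le, har, by simp⟩)
    · exact Or.inl ⟨(r, t), ⟨⟨hr, by linarith⟩, h0, h1⟩, rfl⟩
  have hvol : volume {p : Plane | ∃ t ∈ Icc t₀ t₁, p ∈ segment ℝ 0 (γ t)} = volume (F '' S) := by
    refine le_antisymm ((measure_mono hsup).trans ((measure_union_le _ _).trans ?_))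
      (measure_mono hsub)
    rw [measure_union_null (volume_segment_eq_zero _) (volume_segment_eq_zero _), add_zero]
  have hinj : InjOn (fun q => planeProd (F q)) S := by
    have key : ∀ r t r' t', (r, t) ∈ S → (r', t') ∈ S → r • γ t = r' • γ t' → ¬ t < t' := by
      intro r t r' t' hq hq' he hlt'
      have h1 := h.wedge_pos_of_lt hd hq.2 hq'.2 hlt'
      have h2 : wedge (r • γ t) (γ t') = 0 := by
        rw [he, wedge_smul_left, wedge_self, mul_zero]
      rw [wedge_smul_left] at h2
      exact (mul_pos hq.1.1 h1).ne' h2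
    rintro ⟨r, t⟩ hq ⟨r', t'⟩ hq' he
    have he' : r • γ t = r' • γ t' := planeProd.injective he
    have htt : t = t' := le_antisymm (not_lt.mp (key r' t' r t hq' hq he'.symm))
      (not_lt.mp (key r t r' t' hq hq' he'))
    subst htt
    have hne : γ t ≠ 0 := by
      intro h0
      have := h.wedge_pos t hq.2
      simp [h0] at this
    rw [smul_left_injective ℝ hne he']
  have hcov := integral_image_eq_integral_abs_det_fderiv_smul volume
    (measurableSet_Ioc.prod measurableSet_Ioo : MeasurableSet S)
    (fun p hp => (hasFDerivAt_sector (hd p.2 hp.2)).hasFDerivWithinAt) hinj (fun _ => (1 : ℝ))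
  have himg : (fun q => planeProd (F q)) '' S = planeProd '' (F '' S) := (image_image _ _ _).symm
  rw [himg] at hcov
  have hreal : ∫ _ in planeProd '' (F '' S), (1 : ℝ) = sectorArea γ t₀ t₁ := by
    rw [setIntegral_const, smul_eq_mul, mul_one, Measure.real, volume_image_planeProd, ← hvol,
      sectorArea]
  rw [← hreal, hcov]
  have hcongr : ∫ q in S, |(sectorDeriv γ q).det| • (1 : ℝ) =
      ∫ q in S, q.1 * wedge (γ q.2) (deriv γ q.2) := by
    refine setIntegral_congr_fun (measurableSet_Ioc.prod measurableSet_Ioo) fun q hq => ?_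
    have h1 := h.wedge_pos q.2 hq.2
    have h2 : 0 < q.1 := hq.1.1
    simp only [det_sectorDeriv, smul_eq_mul, mul_one]
    rw [abs_of_pos (by positivity)]
  rw [hcongr, hS, Measure.volume_eq_prod,
    setIntegral_prod_mul (fun r : ℝ => r) (fun t => wedge (γ t) (deriv γ t)),
    ← intervalIntegral.integral_of_le zero_le_one, integral_id, signedArea,
    intervalIntegral.integral_of_le hlt.le, integral_Ioc_eq_integral_Ioo]
  norm_num

/-- Sweeping is stable under perturbations with compact support. -/
theorem IsSweeping.eventually {γ : ℝ → Plane} {Ψ : ℝ → ℝ → Plane} {t₀ t₁ a b : ℝ}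
    (h : IsSweeping γ t₀ t₁)
    (hΨ : ContDiffOn ℝ 1 (fun p : ℝ × ℝ => Ψ p.1 p.2) (univ ×ˢ Icc t₀ t₁))
    (h0 : ∀ t ∈ Icc t₀ t₁, Ψ 0 t = γ t) (ha : t₀ < a) (hb : b < t₁)
    (hsupp : ∀ ε, ∀ t ∈ Icc t₀ t₁, t ∉ Icc a b → Ψ ε t = γ t) :
    ∀ᶠ ε in 𝓝 (0 : ℝ), IsSweeping (Ψ ε) t₀ t₁ := by
  obtain ⟨w, hw⟩ := h.half_plane
  have hop : IsOpen (univ ×ˢ Ioo t₀ t₁ : Set (ℝ × ℝ)) := isOpen_univ.prod isOpen_Ioo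
  have hΨ' : ContDiffOn ℝ 1 (fun p : ℝ × ℝ => Ψ p.1 p.2) (univ ×ˢ Ioo t₀ t₁) :=
    hΨ.mono (prod_mono_right Ioo_subset_Icc_self)
  -- Expressed through the derivative in both variables, the velocity is jointly continuous in `(ε,
  -- t)`.
  have hderiv : ∀ ε, ∀ t ∈ Ioo t₀ t₁,
      deriv (Ψ ε) t = fderiv ℝ (fun p : ℝ × ℝ => Ψ p.1 p.2) (ε, t) (0, 1) := by
    intro ε t ht
    have h1 := ((hΨ'.contDiffAt (x := (ε, t)) (hop.mem_nhds ⟨mem_univ ε, ht⟩)).differentiableAt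
      one_ne_zero).hasFDerivAt
    have h2 : HasDerivAt (fun τ : ℝ => (ε, τ)) (0, 1) t :=
      (hasDerivAt_const t ε).prodMk (hasDerivAt_id t)
    exact (h1.comp_hasDerivAt t h2).deriv
  have hab : ∀ t ∈ Icc a b, t ∈ Ioo t₀ t₁ := fun t ht => ⟨ha.trans_le ht.1, ht.2.trans_lt hb⟩
  -- Positivity may be lost at `t₀` and `t₁`, so uniformity in `t` is only available on the compact
  -- support.
  have hcpt : ∀ᶠ ε in 𝓝 (0 : ℝ), ∀ t ∈ Icc a b,
      0 < wedge (Ψ ε t) (fderiv ℝ (fun p : ℝ × ℝ => Ψ p.1 p.2) (ε, t) (0, 1)) ∧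
        0 < wedge w (Ψ ε t) := by
    refine isCompact_Icc.eventually_forall_of_forall_eventually fun t ht => ?_
    have hn := hop.mem_nhds (⟨mem_univ 0, hab t ht⟩ : ((0 : ℝ), t) ∈ univ ×ˢ Ioo t₀ t₁)
    have c0 : ContinuousAt (fun p : ℝ × ℝ => Ψ p.1 p.2) (0, t) := hΨ'.continuousOn.continuousAt hn
    have c1 : ContinuousAt (fun p => fderiv ℝ (fun p : ℝ × ℝ => Ψ p.1 p.2) p (0, 1)) (0, t) :=
      ((hΨ'.continuousOn_fderiv_of_isOpen hop le_rfl).continuousAt hn).clm_apply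
        continuousAt_const
    have hn2 := Ioo_mem_nhds (hab t ht).1 (hab t ht).2
    have he : Ψ 0 =ᶠ[𝓝 t] γ := by
      filter_upwards [hn2] with τ hτ using h0 τ (Ioo_subset_Icc_self hτ)
    refine ((continuousAt_wedge c0 c1).eventually_const_lt ?_).and
      ((continuousAt_wedge continuousAt_const c0).eventually_const_lt ?_)
    · simp only [← hderiv 0 t (hab t ht), he.deriv_eq, h0 t (Ioo_subset_Icc_self (hab t ht))]
      exact h.wedge_pos t (hab t ht)
    · simp only [h0 t (Ioo_subset_Icc_self (hab t ht))]
      exact hw t (hab t ht)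
  filter_upwards [hcpt] with ε hε
  have hout : ∀ t ∈ Ioo t₀ t₁, t ∉ Icc a b → Ψ ε =ᶠ[𝓝 t] γ := by
    intro t ht htab
    filter_upwards [Ioo_mem_nhds ht.1 ht.2, isClosed_Icc.isOpen_compl.mem_nhds htab] with τ hτ hτ'
    exact hsupp ε τ (Ioo_subset_Icc_self hτ) hτ'
  refine ⟨fun t ht => ?_, w, fun t ht => ?_⟩
  · by_cases htab : t ∈ Icc a b
    · rw [hderiv ε t ht]; exact (hε t htab).1
    · rw [(hout t ht htab).deriv_eq, (hout t ht htab).self_of_nhds]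
      exact h.wedge_pos t ht
  · by_cases htab : t ∈ Icc a b
    · exact (hε t htab).2
    · rw [(hout t ht htab).self_of_nhds]; exact hw t ht

/-! ### The action of `SL₂(ℝ)` -/

theorem det_eq (g : Matrix.SpecialLinearGroup (Fin 2) ℝ) :
    g 0 0 * g 1 1 - g 0 1 * g 1 0 = 1 := by
  have := g.det_coe
  rwa [Matrix.det_fin_two] at this

theorem act_apply_zero (g : Matrix.SpecialLinearGroup (Fin 2) ℝ) (p : Plane) :
    act g p 0 = g 0 0 * p 0 + g 0 1 * p 1 := rfl

theorem act_apply_one (g : Matrix.SpecialLinearGroup (Fin 2) ℝ) (p : Plane) :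
    act g p 1 = g 1 0 * p 0 + g 1 1 * p 1 := rfl

theorem plane_ext {p q : Plane} (h0 : p 0 = q 0) (h1 : p 1 = q 1) : p = q := by
  ext i; fin_cases i
  exacts [h0, h1]

/-- The action of an element of `SL₂(ℝ)` as a continuous linear equivalence. -/
def actEquiv (g : Matrix.SpecialLinearGroup (Fin 2) ℝ) : Plane ≃L[ℝ] Plane :=
  LinearEquiv.toContinuousLinearEquiv
    { toFun := act g
      map_add' := fun p q => by
        apply plane_ext <;> simp only [act_apply_zero, act_apply_one, PiLp.add_apply] <;> ring
      map_smul' := fun a p => by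
        apply plane_ext <;>
          simp only [act_apply_zero, act_apply_one, PiLp.smul_apply, smul_eq_mul,
            RingHom.id_apply] <;> ring
      invFun := fun p => !₂[g 1 1 * p 0 - g 0 1 * p 1, g 0 0 * p 1 - g 1 0 * p 0]
      left_inv := fun p => by
        have := det_eq g
        apply plane_ext
        · change g 1 1 * (g 0 0 * p 0 + g 0 1 * p 1) - g 0 1 * (g 1 0 * p 0 + g 1 1 * p 1) = p 0
          linear_combination p 0 * this
        · change g 0 0 * (g 1 0 * p 0 + g 1 1 * p 1) - g 1 0 * (g 0 0 * p 0 + g 0 1 * p 1) = p 1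
          linear_combination p 1 * this
      right_inv := fun p => by
        have := det_eq g
        apply plane_ext
        · change g 0 0 * (g 1 1 * p 0 - g 0 1 * p 1) + g 0 1 * (g 0 0 * p 1 - g 1 0 * p 0) = p 0
          linear_combination p 0 * this
        · change g 1 0 * (g 1 1 * p 0 - g 0 1 * p 1) + g 1 1 * (g 0 0 * p 1 - g 1 0 * p 0) = p 1
          linear_combination p 1 * this }

theorem actEquiv_apply (g : Matrix.SpecialLinearGroup (Fin 2) ℝ) (p : Plane) :
    actEquiv g p = act g p := rfl

theorem wedge_act (g : Matrix.SpecialLinearGroup (Fin 2) ℝ) (p q : Plane) :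
    wedge (act g p) (act g q) = wedge p q := by
  simp only [wedge, act_apply_zero, act_apply_one]
  linear_combination (p 0 * q 1 - p 1 * q 0) * det_eq g

theorem hasDerivAt_act {γ : ℝ → Plane} {γ' : Plane} {t : ℝ}
    (g : Matrix.SpecialLinearGroup (Fin 2) ℝ) (h : HasDerivAt γ γ' t) :
    HasDerivAt (fun τ => act g (γ τ)) (act g γ') t :=
  (actEquiv g).toContinuousLinearMap.hasFDerivAt.comp_hasDerivAt t h

/-! ### Symmetric convex bodies and support lines -/

/-- A convex body that is symmetric about the origin. -/
structure IsSymmBody (B : Set Plane) : Prop where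
  isCompact : IsCompact B
  convex : Convex ℝ B
  zero_mem : (0 : Plane) ∈ interior B
  neg_mem : ∀ p ∈ B, -p ∈ B

/-- With `p` also `-p` is an interior point, and the origin is their midpoint. -/
theorem isSymmBody_of_nonempty {B : Set Plane} (h1 : IsCompact B) (h2 : Convex ℝ B)
    (h3 : (interior B).Nonempty) (h4 : ∀ p ∈ B, -p ∈ B) : IsSymmBody B := by
  refine ⟨h1, h2, ?_, h4⟩
  obtain ⟨p, hp⟩ := h3
  have hq : -p ∈ interior B := by
    have : B = Homeomorph.neg Plane ⁻¹' B := by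
      ext q; exact ⟨fun h => h4 q h, fun h => by simpa using h4 _ h⟩
    rw [this, ← (Homeomorph.neg Plane).preimage_interior]
    simpa using hp
  have := h2.interior hp hq (show (0 : ℝ) ≤ 1 / 2 by norm_num) (show (0 : ℝ) ≤ 1 / 2 by norm_num)
    (by norm_num)
  simpa using this

theorem exists_eq_wedge (f : Plane →L[ℝ] ℝ) : ∃ w : Plane, ∀ p, f p = wedge w p := by
  refine ⟨!₂[f (EuclideanSpace.single 1 1), -f (EuclideanSpace.single 0 1)], fun p => ?_⟩
  have hp : p = p 0 • EuclideanSpace.single 0 (1 : ℝ) + p 1 • EuclideanSpace.single 1 (1 : ℝ) := by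
    apply plane_ext <;> simp
  conv_lhs => rw [hp, map_add, map_smul, map_smul]
  simp [wedge]; ring

/-- A support line at a boundary point. -/
theorem IsSymmBody.exists_support {B : Set Plane} (hB : IsSymmBody B) {p : Plane}
    (hp : p ∈ frontier B) :
    ∃ w : Plane, 0 < wedge w p ∧ (∀ q ∈ B, wedge w q ≤ wedge w p) ∧
      ∀ q ∈ interior B, wedge w q < wedge w p := by
  obtain ⟨f, hf⟩ := geometric_hahn_banach_open_point hB.convex.interior isOpen_interior hp.2
  obtain ⟨w, hw⟩ := exists_eq_wedge f
  simp only [hw] at hf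
  refine ⟨w, by simpa using hf 0 hB.zero_mem, fun q hq => ?_, hf⟩
  have hcl : q ∈ closure (interior B) := by
    rw [hB.convex.closure_interior_eq_closure_of_nonempty_interior ⟨0, hB.zero_mem⟩]
    exact subset_closure hq
  have hclosed : IsClosed {q : Plane | wedge w q ≤ wedge w p} :=
    isClosed_le ((continuous_iff_continuousAt.mpr fun _ =>
      continuousAt_wedge continuousAt_const continuousAt_id)) continuous_const
  exact closure_minimal (fun q hq => (hf q hq).le) hclosed hcl

/-- A line segment on the boundary lies on a support line. -/
theorem IsSymmBody.exists_support_segment {B : Set Plane} (hB : IsSymmBody B) {γ : ℝ → Plane}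
    {t₀ t₁ : ℝ} (hγ : IsLineSegment γ t₀ t₁) (hfr : ∀ t ∈ Icc t₀ t₁, γ t ∈ frontier B) :
    ∃ w : Plane, (∀ t ∈ Icc t₀ t₁, wedge w (γ t) = 1) ∧ ∀ q ∈ B, |wedge w q| ≤ 1 := by
  obtain ⟨a, b, -, him⟩ := hγ
  have hseg : ∀ p ∈ segment ℝ a b, p ∈ frontier B := by
    rw [← him]; rintro _ ⟨t, ht, rfl⟩; exact hfr t ht
  have hcl : ∀ p ∈ frontier B, p ∈ B := fun p hp => hB.isCompact.isClosed.frontier_subset hp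
  -- A linear form that attains its maximum over a segment at the midpoint is constant on the
  -- segment; dividing by this maximum normalizes it to 1.
  obtain ⟨w, hw0, hw, -⟩ := hB.exists_support (hseg _ (midpoint_mem_segment a b))
  have hm : wedge w (midpoint ℝ a b) = (wedge w a + wedge w b) / 2 := by
    rw [midpoint_eq_smul_add, wedge_smul_right, wedge_add_right]
    norm_num; ring
  have ha := hw a (hcl _ (hseg _ (left_mem_segment ℝ a b)))
  have hb := hw b (hcl _ (hseg _ (right_mem_segment ℝ a b)))
  have hsm : ∀ q, wedge ((wedge w (midpoint ℝ a b))⁻¹ • w) q =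
      wedge w q / wedge w (midpoint ℝ a b) := fun q => by
    rw [wedge_smul_left]; ring
  refine ⟨(wedge w (midpoint ℝ a b))⁻¹ • w, fun t ht => ?_, fun q hq => ?_⟩
  · obtain ⟨x, y, -, -, hxy, he⟩ : γ t ∈ segment ℝ a b := him ▸ mem_image_of_mem γ ht
    rw [hsm, div_eq_one_iff_eq hw0.ne', ← he, wedge_add_right, wedge_smul_right, wedge_smul_right]
    have h1 : wedge w a = wedge w (midpoint ℝ a b) := by linarith
    have h2 : wedge w b = wedge w (midpoint ℝ a b) := by linarith
    rw [h1, h2, ← add_mul, hxy, one_mul]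
  · rw [hsm, abs_div, abs_of_pos hw0, div_le_one hw0, abs_le]
    have := hw (-q) (hB.neg_mem q hq)
    rw [wedge_neg_right] at this
    exact ⟨by linarith, hw q hq⟩

/-! ### Skew coordinates -/

/-- A point of one of the two curves that face a line segment, in skew coordinates. -/
def skewPoint (x s e : ℝ) : Plane := (1 / 2 : ℝ) • !₂[√3 + x * (s + e), s + e]

theorem skewPoint_zero (x s e : ℝ) : skewPoint x s e 0 = (√3 + x * (s + e)) / 2 := by
  simp [skewPoint]; ring

theorem skewPoint_one (x s e : ℝ) : skewPoint x s e 1 = (s + e) / 2 := by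
  simp [skewPoint]; ring

/-- A convex body together with arcs of its boundary in skew coordinates. -/
structure IsSkewBody (B : Set Plane) (x s : ℝ → ℝ) (t₀ t₁ : ℝ) : Prop where
  isSymmBody : IsSymmBody B
  lt : t₀ < t₁
  contDiffOn_x : ContDiffOn ℝ 2 x (Icc t₀ t₁)
  contDiffOn_s : ContDiffOn ℝ 2 s (Icc t₀ t₁)
  flat_mem : ∀ t ∈ Icc t₀ t₁, !₂[x t, 1] ∈ frontier B
  skewPoint_mem : ∀ e : ℝ, e = 1 ∨ e = -1 → ∀ t ∈ Icc t₀ t₁, skewPoint (x t) (s t) e ∈ frontier B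
  abs_le : ∀ p ∈ B, |p 1| ≤ 1
  curved : ∀ e : ℝ, e = 1 ∨ e = -1 → ∀ t ∈ Ioo t₀ t₁,
    (s t + e) * (deriv x t * deriv (deriv s) t - deriv (deriv x) t * deriv s t) -
      2 * deriv x t * deriv s t ^ 2 ≠ 0

theorem hasDerivAt_skewPoint {x s : ℝ → ℝ} {x' s' t : ℝ} (hx : HasDerivAt x x' t)
    (hs : HasDerivAt s s' t) (e : ℝ) :
    HasDerivAt (fun τ => skewPoint (x τ) (s τ) e 0) ((x' * (s t + e) + x t * s') / 2) t ∧
      HasDerivAt (fun τ => skewPoint (x τ) (s τ) e 1) (s' / 2) t := by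
  simp only [skewPoint_zero, skewPoint_one]
  exact ⟨((hx.mul (hs.add_const e)).const_add (√3)).div_const 2, (hs.add_const e).div_const 2⟩

section skew

variable {γ : ℝ → Plane} {g : Matrix.SpecialLinearGroup (Fin 2) ℝ} {x s : ℝ → ℝ} {t₀ t₁ t e : ℝ}

theorem act_deriv_eq (hγ : ContDiffOn ℝ 2 γ (Icc t₀ t₁)) (hx : ContDiffOn ℝ 2 x (Icc t₀ t₁))
    (hs : ContDiffOn ℝ 2 s (Icc t₀ t₁))
    (h : ∀ τ ∈ Icc t₀ t₁, act g (γ τ) = skewPoint (x τ) (s τ) e) (ht : t ∈ Ioo t₀ t₁) :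
    act g (deriv γ t) 0 = (deriv x t * (s t + e) + x t * deriv s t) / 2 ∧
      act g (deriv γ t) 1 = deriv s t / 2 := by
  have h1 := hasDerivAt_act g (hasDerivAt_of_contDiffOn_two hγ ht).1
  have h2 := hasDerivAt_skewPoint (hasDerivAt_of_contDiffOn_two hx ht).1
    (hasDerivAt_of_contDiffOn_two hs ht).1 e
  have he : ∀ i, (fun τ => act g (γ τ) i) =ᶠ[𝓝 t] fun τ => skewPoint (x τ) (s τ) e i := by
    intro i
    filter_upwards [Icc_mem_nhds ht.1 ht.2] with τ hτ
    rw [h τ hτ]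
  exact ⟨((hasDerivAt_apply h1 0).congr_of_eventuallyEq (he 0).symm).unique h2.1,
    ((hasDerivAt_apply h1 1).congr_of_eventuallyEq (he 1).symm).unique h2.2⟩

theorem wedge_deriv_eq (hγ : ContDiffOn ℝ 2 γ (Icc t₀ t₁)) (hx : ContDiffOn ℝ 2 x (Icc t₀ t₁))
    (hs : ContDiffOn ℝ 2 s (Icc t₀ t₁))
    (h : ∀ τ ∈ Icc t₀ t₁, act g (γ τ) = skewPoint (x τ) (s τ) e) (ht : t ∈ Ioo t₀ t₁) :
    wedge (γ t) (deriv γ t) = (√3 * deriv s t - (s t + e) ^ 2 * deriv x t) / 4 := by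
  obtain ⟨h0, h1⟩ := act_deriv_eq hγ hx hs h ht
  rw [← wedge_act g, wedge, h0, h1, h t (Ioo_subset_Icc_self ht), skewPoint_zero, skewPoint_one]
  ring

/-- Source of the expression in `IsSkewBody.curved`; `x` itself drops out, because a shear preserves
determinants. -/
theorem wedge_deriv_deriv_eq (hγ : ContDiffOn ℝ 2 γ (Icc t₀ t₁))
    (hx : ContDiffOn ℝ 2 x (Icc t₀ t₁)) (hs : ContDiffOn ℝ 2 s (Icc t₀ t₁))
    (h : ∀ τ ∈ Icc t₀ t₁, act g (γ τ) = skewPoint (x τ) (s τ) e) (ht : t ∈ Ioo t₀ t₁) :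
    wedge (deriv γ t) (deriv (deriv γ) t) =
      ((s t + e) * (deriv x t * deriv (deriv s) t - deriv (deriv x) t * deriv s t) -
        2 * deriv x t * deriv s t ^ 2) / 4 := by
  obtain ⟨h0, h1⟩ := act_deriv_eq hγ hx hs h ht
  have dγ := hasDerivAt_act g (hasDerivAt_of_contDiffOn_two hγ ht).2.1
  obtain ⟨x1, x2, -⟩ := hasDerivAt_of_contDiffOn_two hx ht
  obtain ⟨s1, s2, -⟩ := hasDerivAt_of_contDiffOn_two hs ht
  have e0 : (fun τ => act g (deriv γ τ) 0) =ᶠ[𝓝 t]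
      fun τ => (deriv x τ * (s τ + e) + x τ * deriv s τ) / 2 := by
    filter_upwards [Ioo_mem_nhds ht.1 ht.2] with τ hτ using (act_deriv_eq hγ hx hs h hτ).1
  have e1 : (fun τ => act g (deriv γ τ) 1) =ᶠ[𝓝 t] fun τ => deriv s τ / 2 := by
    filter_upwards [Ioo_mem_nhds ht.1 ht.2] with τ hτ using (act_deriv_eq hγ hx hs h hτ).2
  have u0 := ((hasDerivAt_apply dγ 0).congr_of_eventuallyEq e0.symm).unique
    (((x2.mul (s1.add_const e)).add (x1.mul s2)).div_const 2)
  have u1 := ((hasDerivAt_apply dγ 1).congr_of_eventuallyEq e1.symm).unique (s2.div_const 2)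
  rw [← wedge_act g, wedge, h0, h1, u0, u1]
  ring

end skew

/-- The second row is forced by the equation, and the first row is chosen to make the determinant 1.
-/
theorem exists_specialLinear (w : Plane) (hw : w ≠ 0) :
    ∃ g : Matrix.SpecialLinearGroup (Fin 2) ℝ, ∀ p, act g p 1 = -wedge w p := by
  have hN : w 0 ^ 2 + w 1 ^ 2 ≠ 0 := by
    intro h
    have h0 : w 0 = 0 := by nlinarith [sq_nonneg (w 0), sq_nonneg (w 1)]
    have h1 : w 1 = 0 := by nlinarith [sq_nonneg (w 0), sq_nonneg (w 1)]
    exact hw (plane_ext h0 h1)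
  refine ⟨⟨!![-w 0 / (w 0 ^ 2 + w 1 ^ 2), -w 1 / (w 0 ^ 2 + w 1 ^ 2); w 1, -w 0], ?_⟩, fun p => ?_⟩
  · rw [Matrix.det_fin_two_of]; field_simp; ring
  · change w 1 * p 0 + -w 0 * p 1 = -wedge w p
    rw [wedge]; ring

/-- The homeomorphism that recenters and rescales the plane. -/
def normalize (c : Plane) {r : ℝ} (hr : r ≠ 0) (g : Matrix.SpecialLinearGroup (Fin 2) ℝ) :
    Plane ≃ₜ Plane :=
  (actEquiv g).symm.toHomeomorph.trans ((Homeomorph.smulOfNeZero r hr).trans (Homeomorph.addLeft c))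

theorem normalize_apply (c : Plane) {r : ℝ} (hr : r ≠ 0)
    (g : Matrix.SpecialLinearGroup (Fin 2) ℝ) (p : Plane) :
    normalize c hr g p = c + r • (actEquiv g).symm p := rfl

theorem normalize_act (c : Plane) {r : ℝ} (hr : r ≠ 0)
    (g : Matrix.SpecialLinearGroup (Fin 2) ℝ) (p : Plane) :
    normalize c hr g (act g p) = c + r • p := by
  rw [normalize_apply, ← actEquiv_apply, ContinuousLinearEquiv.symm_apply_apply]

theorem IsSymmetricConvexDomain.isSymmBody {K : Set Plane} (hK : IsSymmetricConvexDomain K)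
    {c : Plane} (hc : IsCenter K c) {r : ℝ} (hr : r ≠ 0)
    (g : Matrix.SpecialLinearGroup (Fin 2) ℝ) : IsSymmBody (normalize c hr g ⁻¹' K) := by
  refine isSymmBody_of_nonempty ((normalize c hr g).isCompact_preimage.mpr hK.isCompact) ?_ ?_ ?_
  · intro p hp q hq a b ha hb hab
    have := hK.convex hp hq ha hb hab
    rw [mem_preimage]
    convert this using 1
    simp only [normalize_apply, map_add, map_smul]
    have : c = (a + b) • c := by rw [hab, one_smul]
    conv_lhs => rw [this]
    module
  · rw [← (normalize c hr g).preimage_interior]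
    exact hK.interior_nonempty.preimage (normalize c hr g).surjective
  · intro p hp
    have := hc _ hp
    rw [mem_preimage]
    convert this using 1
    simp only [normalize_apply, map_neg]
    module

/-- Once the support line along `σ k` is at height `-1`, the height of `σ (k + 2)` defines `s`. The
determinant condition with `σ k` then fixes the abscissa of `σ (k + 2)`, and `σ (k + 1)` is a sum.
-/
theorem HasRank.exists_skewCoordinates {K : Set Plane} {σ : ZMod 6 → ℝ → Plane} {t₀ t₁ : ℝ}
    (hK : IsSymmetricConvexDomain K) (hσ : HasRank σ t₀ t₁ 2)
    (hp : ParametrizesBoundary K σ t₀ t₁) :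
    ∃ (k : ZMod 6) (c : Plane) (r : ℝ) (hr : r ≠ 0) (g : Matrix.SpecialLinearGroup (Fin 2) ℝ)
      (x s : ℝ → ℝ), IsCenter K c ∧ (∀ j, IsLineSegment (σ j) t₀ t₁ ↔ j = k ∨ j = k + 3) ∧
      (∀ t ∈ Icc t₀ t₁, act g (σ k t) = !₂[-x t, -1]) ∧
      (∀ t ∈ Icc t₀ t₁, act g (σ (k + 1) t) = skewPoint (x t) (s t) (-1)) ∧
      (∀ t ∈ Icc t₀ t₁, act g (σ (k + 2) t) = skewPoint (x t) (s t) 1) ∧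
      IsSkewBody (normalize c hr g ⁻¹' K) x s t₀ t₁ := by
  obtain ⟨k, hk⟩ := hσ.exists_index
  obtain ⟨c, r, hc, hr, hfr⟩ := hp
  have hr := hr.ne'
  have hmc := hσ.1.isMultiCurve
  have hB0 := hK.isSymmBody hc hr 1
  have hact1 : ∀ p, act 1 p = p := fun p => by apply plane_ext <;> simp [act]
  have hfr0 : ∀ j, ∀ t ∈ Icc t₀ t₁, σ j t ∈ frontier (normalize c hr 1 ⁻¹' K) := by
    intro j t ht
    rw [← (normalize c hr 1).preimage_frontier, mem_preimage, ← hact1 (σ j t), normalize_act]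
    exact hfr j t ht
  obtain ⟨w, hw1, hw⟩ := hB0.exists_support_segment ((hk k).mpr (Or.inl rfl)) (hfr0 k)
  have hw0 : w ≠ 0 := by
    rintro rfl
    have := hw1 t₀ (left_mem_Icc.mpr hmc.lt.le)
    simp at this
  obtain ⟨g, hg⟩ := exists_specialLinear w hw0
  set x : ℝ → ℝ := fun t => -act g (σ k t) 0 with hx
  set s : ℝ → ℝ := fun t => 2 * act g (σ (k + 2) t) 1 - 1 with hs
  have hcd : ∀ j i, ContDiffOn ℝ 2 (fun t => act g (σ j t) i) (Icc t₀ t₁) := fun j i =>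
    contDiffOn_apply ((actEquiv g).contDiff.comp_contDiffOn (hσ.1.contDiffOn j)) i
  have hxc : ContDiffOn ℝ 2 x (Icc t₀ t₁) := (hcd k 0).neg
  have hsc : ContDiffOn ℝ 2 s (Icc t₀ t₁) := (contDiffOn_const.mul (hcd (k + 2) 1)).sub
    contDiffOn_const
  have e0 : ∀ t ∈ Icc t₀ t₁, act g (σ k t) = !₂[-x t, -1] := by
    intro t ht
    apply plane_ext
    · simp [hx]
    · rw [hg, hw1 t ht]; rfl
  have e2 : ∀ t ∈ Icc t₀ t₁, act g (σ (k + 2) t) = skewPoint (x t) (s t) 1 := by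
    intro t ht
    have h1 := (hmc.multiPoint t ht k).2.2
    simp only at h1
    rw [← wedge_act g, e0 t ht, wedge] at h1
    simp only [Matrix.cons_val_zero, Matrix.cons_val_one] at h1
    apply plane_ext
    · rw [skewPoint_zero]
      simp only [hs]
      linarith
    · rw [skewPoint_one]
      simp only [hs]
      ring
  have e1 : ∀ t ∈ Icc t₀ t₁, act g (σ (k + 1) t) = skewPoint (x t) (s t) (-1) := by
    intro t ht
    have h1 := (hmc.multiPoint t ht).add_one k
    rw [h1, ← actEquiv_apply, map_add, actEquiv_apply, actEquiv_apply, e0 t ht, e2 t ht]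
    apply plane_ext
    · simp only [PiLp.add_apply, skewPoint_zero, Matrix.cons_val_zero]; ring
    · simp only [PiLp.add_apply, skewPoint_one, Matrix.cons_val_one]
      simp; ring
  have hfr' : ∀ j, ∀ t ∈ Icc t₀ t₁, act g (σ j t) ∈ frontier (normalize c hr g ⁻¹' K) := by
    intro j t ht
    rw [← (normalize c hr g).preimage_frontier, mem_preimage, normalize_act]
    exact hfr j t ht
  have hne : ∀ k : ZMod 6, (k + 1 ≠ k ∧ k + 1 ≠ k + 3) ∧ (k + 2 ≠ k ∧ k + 2 ≠ k + 3) := by decide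
  refine ⟨k, c, r, hr, g, x, s, hc, hk, e0, e1, e2, hK.isSymmBody hc hr g, hmc.lt, hxc, hsc,
    fun t ht => ?_, ?_, fun p hp => ?_, ?_⟩
  · have h3 := hfr' (k + 3) t ht
    have h4 := (hmc.multiPoint t ht).add_three k
    rw [h4, ← actEquiv_apply, map_neg, actEquiv_apply, e0 t ht] at h3
    convert h3 using 1
    apply plane_ext <;> simp
  · rintro e (rfl | rfl) t ht
    · rw [← e2 t ht]; exact hfr' _ t ht
    · rw [← e1 t ht]; exact hfr' _ t ht
  · have h1 : act g ((actEquiv g).symm p) = p := (actEquiv g).apply_symm_apply p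
    rw [← h1, hg, abs_neg]
    refine hw _ ?_
    rw [mem_preimage, ← hact1 ((actEquiv g).symm p), normalize_act]
    exact hp
  · rintro e (rfl | rfl) t ht h0
    · have := hσ.curvature_ne_zero hk (hne k).2 ht
      rw [wedge_deriv_deriv_eq (hσ.1.contDiffOn _) hxc hsc e2 ht, h0, zero_div] at this
      exact this rfl
    · have := hσ.curvature_ne_zero hk (hne k).1 ht
      rw [wedge_deriv_deriv_eq (hσ.1.contDiffOn _) hxc hsc e1 ht, h0, zero_div] at this
      exact this rfl

/-! ### Monotonicity of skew coordinates -/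

/-- The heights `(s + 1) / 2` and `(s - 1) / 2` lie in `[-1, 1]`; the first gives the upper bound,
the second the lower one. -/
theorem IsSkewBody.abs_s_le {B : Set Plane} {x s : ℝ → ℝ} {t₀ t₁ t : ℝ}
    (h : IsSkewBody B x s t₀ t₁) (ht : t ∈ Icc t₀ t₁) : -1 ≤ s t ∧ s t ≤ 1 := by
  have hcl := h.isSymmBody.isCompact.isClosed.frontier_subset
  have h1 := h.abs_le _ (hcl (h.skewPoint_mem 1 (Or.inl rfl) t ht))
  have h2 := h.abs_le _ (hcl (h.skewPoint_mem (-1) (Or.inr rfl) t ht))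
  rw [skewPoint_one, _root_.abs_le] at h1 h2
  exact ⟨by linarith, by linarith⟩

/-- At an interior extreme value, `s'` and one of `s + 1`, `s - 1` vanish together, and so does the
curvature of the corresponding arc. -/
theorem IsSkewBody.abs_s_lt {B : Set Plane} {x s : ℝ → ℝ} {t₀ t₁ t : ℝ}
    (h : IsSkewBody B x s t₀ t₁) (ht : t ∈ Ioo t₀ t₁) : -1 < s t ∧ s t < 1 := by
  obtain ⟨h1, h2⟩ := h.abs_s_le (Ioo_subset_Icc_self ht)
  have hn := Icc_mem_nhds ht.1 ht.2
  constructor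
  · refine lt_of_le_of_ne h1 fun he => h.curved 1 (Or.inl rfl) t ht ?_
    have hmin : IsLocalMin s t := by
      filter_upwards [hn] with τ hτ
      rw [← he]; exact (h.abs_s_le hτ).1
    rw [← he, hmin.deriv_eq_zero]; ring
  · refine lt_of_le_of_ne h2 fun he => h.curved (-1) (Or.inr rfl) t ht ?_
    have hmax : IsLocalMax s t := by
      filter_upwards [hn] with τ hτ
      rw [he]; exact (h.abs_s_le hτ).2
    rw [he, hmax.deriv_eq_zero]; ring

/-- A zero of `x'` would be a local maximum of `x'`, so `x''` would vanish as well, and with it the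
curvature. -/
theorem IsSkewBody.deriv_x_neg {B : Set Plane} {x s : ℝ → ℝ} {t₀ t₁ t : ℝ}
    (h : IsSkewBody B x s t₀ t₁) (hx : ∀ t ∈ Ioo t₀ t₁, deriv x t ≤ 0) (ht : t ∈ Ioo t₀ t₁) :
    deriv x t < 0 := by
  refine lt_of_le_of_ne (hx t ht) fun he => h.curved 1 (Or.inl rfl) t ht ?_
  have hmax : IsLocalMax (deriv x) t := by
    filter_upwards [Ioo_mem_nhds ht.1 ht.2] with τ hτ
    rw [he]; exact hx τ hτ
  rw [he, hmax.deriv_eq_zero]; ring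

/-- Let `α` and `β` be the values on `(1, 0)` and `(x, 1)` of a support form at the arc point with
`e = -1`. Tangency reads `x' (s - 1) α + s' β = 0`. Under `s' ≤ 0`, the case `β < 0` contradicts
tangency, and `β ≥ 0` contradicts the counterclockwise condition `hs`. -/
theorem IsSkewBody.deriv_s_pos {B : Set Plane} {x s : ℝ → ℝ} {t₀ t₁ t : ℝ}
    (h : IsSkewBody B x s t₀ t₁) (hx : ∀ t ∈ Ioo t₀ t₁, deriv x t ≤ 0) (ht : t ∈ Ioo t₀ t₁)
    (hs : 0 ≤ √3 * deriv s t - (s t - 1) ^ 2 * deriv x t) : 0 < deriv s t := by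
  have htc := Ioo_subset_Icc_self ht
  have hx' := h.deriv_x_neg hx ht
  obtain ⟨hs1, hs2⟩ := h.abs_s_lt ht
  have hcl := h.isSymmBody.isCompact.isClosed.frontier_subset
  obtain ⟨w, hw0, hw, -⟩ := h.isSymmBody.exists_support (h.skewPoint_mem (-1) (Or.inr rfl) t htc)
  have hder := hasDerivAt_skewPoint (hasDerivAt_of_contDiffOn_two h.contDiffOn_x ht).1
    (hasDerivAt_of_contDiffOn_two h.contDiffOn_s ht).1 (-1)
  have hmax : IsLocalMax (fun τ => wedge w (skewPoint (x τ) (s τ) (-1))) t := by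
    filter_upwards [Icc_mem_nhds ht.1 ht.2] with τ hτ
    exact hw _ (hcl (h.skewPoint_mem (-1) (Or.inr rfl) τ hτ))
  have hd0 := hmax.hasDerivAt_eq_zero ((hder.2.const_mul (w 0)).sub (hder.1.const_mul (w 1)))
  -- The flat points `±(x, 1)` lie on the inner side of the support line, which bounds `|β|` by the
  -- value of the form at the arc point.
  have hf1 := hw _ (hcl (h.flat_mem t htc))
  have hf2 := hw _ (h.isSymmBody.neg_mem _ (hcl (h.flat_mem t htc)))
  have hfl : wedge w !₂[x t, 1] = w 0 - w 1 * x t := by simp [wedge]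
  have hwQ : wedge w (skewPoint (x t) (s t) (-1)) =
      (√3 * -w 1 + (s t - 1) * (w 0 - w 1 * x t)) / 2 := by
    rw [wedge, skewPoint_zero, skewPoint_one]; ring
  rw [wedge_neg_right, hfl] at hf2
  rw [hfl] at hf1
  rw [hwQ] at hf1 hf2 hw0
  have hd : deriv x t * (s t - 1) * -w 1 + deriv s t * (w 0 - w 1 * x t) = 0 := by linarith
  generalize w 0 - w 1 * x t = β at *
  generalize -w 1 = α at *
  generalize deriv x t = x' at *
  generalize deriv s t = s' at *
  generalize s t = S at *
  have h3 : 0 < √3 := by positivity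
  by_contra! hneg
  have hβ : β < 0 → False := by
    intro hβ
    have hα : 0 < √3 * α := by nlinarith
    have hα' : 0 < α := by
      by_contra! h0
      nlinarith
    have h1 : 0 < x' * (S - 1) * α := mul_pos (mul_pos_of_neg_of_neg hx' (by linarith)) hα'
    have h2 : 0 ≤ s' * β := mul_nonneg_of_nonpos_of_nonpos hneg hβ.le
    linarith
  have hβ0 : 0 ≤ β := not_lt.mp hβ
  have hα : (3 - S) * β ≤ √3 * α := by linarith
  have hα0 : 0 < √3 * α := by nlinarith
  have h4 : 0 ≤ (√3 * s' - (S - 1) ^ 2 * x') * β := mul_nonneg hs hβ0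
  have h5 : √3 * (s' * β) = x' * ((1 - S) * (√3 * α)) := by linear_combination √3 * hd
  -- Tangency eliminates `s'` after multiplication by `β`. The last factor on the right is positive
  -- and `x' < 0`, so the right side is negative.
  have h6 : (√3 * s' - (S - 1) ^ 2 * x') * β = x' * (1 - S) * (√3 * α - (1 - S) * β) := by
    linear_combination h5
  have h7 : 0 < √3 * α - (1 - S) * β := by
    rcases hβ0.eq_or_lt with h0 | h0
    · rw [← h0]; linarith
    · linarith
  have h8 : x' * (1 - S) < 0 := mul_neg_of_neg_of_pos hx' (by linarith)
  have := mul_neg_of_neg_of_pos h8 h7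
  linarith

/-! ### Counterclockwise multi-curves -/

theorem isSweeping_neg {γ δ : ℝ → Plane} {t₀ t₁ : ℝ} (h : IsSweeping γ t₀ t₁)
    (hδ : ∀ t ∈ Icc t₀ t₁, δ t = -γ t) : IsSweeping δ t₀ t₁ := by
  obtain ⟨w, hw⟩ := h.half_plane
  refine ⟨fun t ht => ?_, -w, fun t ht => ?_⟩
  · have : δ =ᶠ[𝓝 t] fun τ => -γ τ := by
      filter_upwards [Icc_mem_nhds ht.1 ht.2] with τ hτ using hδ τ hτ
    rw [this.deriv_eq, this.self_of_nhds, deriv.fun_neg, wedge_neg_left, wedge_neg_right, neg_neg]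
    exact h.wedge_pos t ht
  · rw [hδ t (Ioo_subset_Icc_self ht), wedge_neg_left, wedge_neg_right, neg_neg]
    exact hw t ht

/-- The transformed height, up to the sign `e`, is the linear form that defines the half plane. -/
theorem isSweeping_of_act {γ : ℝ → Plane} {t₀ t₁ : ℝ}
    (g : Matrix.SpecialLinearGroup (Fin 2) ℝ) (h : ∀ t ∈ Ioo t₀ t₁, 0 < wedge (γ t) (deriv γ t))
    (e : ℝ) (he : ∀ t ∈ Ioo t₀ t₁, 0 < e * act g (γ t) 1) : IsSweeping γ t₀ t₁ := by
  refine ⟨h, e • !₂[g 1 1, -g 1 0], fun t ht => ?_⟩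
  have : wedge (e • !₂[g 1 1, -g 1 0]) (γ t) = e * act g (γ t) 1 := by
    rw [wedge_smul_left, act_apply_one]
    congr 1
    simp only [wedge, Matrix.cons_val_zero, Matrix.cons_val_one]; ring
  rw [this]; exact he t ht

theorem integral_congr_Ioo {f g : ℝ → ℝ} {t₀ t₁ : ℝ} (h : t₀ ≤ t₁) (hfg : EqOn f g (Ioo t₀ t₁)) :
    ∫ t in t₀..t₁, f t = ∫ t in t₀..t₁, g t := by
  rw [intervalIntegral.integral_of_le h, intervalIntegral.integral_of_le h,
    integral_Ioc_eq_integral_Ioo, integral_Ioc_eq_integral_Ioo]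
  exact setIntegral_congr_fun measurableSet_Ioo hfg

/-- Since `σ k ∧ σ k' = -x'`, counterclockwise motion of `σ k` gives the sign of `x'`, and that of
`σ (k + 1)` gives the input of `IsSkewBody.deriv_s_pos`. The integrand of the area comes from `(s -
1) ^ 2 + (s + 1) ^ 2 = 2 * (1 + s ^ 2)`. -/
theorem HasRank.exists_skewCoordinates_of_counterclockwise {K : Set Plane}
    {σ : ZMod 6 → ℝ → Plane} {t₀ t₁ : ℝ} (hK : IsSymmetricConvexDomain K)
    (hσ : HasRank σ t₀ t₁ 2) (hp : ParametrizesBoundary K σ t₀ t₁)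
    (hccw : IsCounterclockwise σ t₀ t₁) :
    (∀ j, IsSweeping (σ j) t₀ t₁) ∧
    ∃ (k : ZMod 6) (g : Matrix.SpecialLinearGroup (Fin 2) ℝ) (x s : ℝ → ℝ),
      SkewCoordinates σ t₀ t₁ k g x s ∧
      sectorArea (σ (k + 1)) t₀ t₁ + sectorArea (σ (k + 2)) t₀ t₁ =
        ∫ t in t₀..t₁, (1 / 4) * (√3 * deriv s t - (1 + s t ^ 2) * deriv x t) := by
  obtain ⟨k, c, r, hr, g, x, s, -, hk, e0, e1, e2, hB⟩ := hσ.exists_skewCoordinates hK hp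
  have hmc := hσ.1.isMultiCurve
  have hw0 : ∀ t ∈ Ioo t₀ t₁, wedge (σ k t) (deriv (σ k) t) = -deriv x t := by
    intro t ht
    have h1 := hasDerivAt_act g (hasDerivAt_of_contDiffOn_two (hσ.1.contDiffOn k) ht).1
    have hx := (hasDerivAt_of_contDiffOn_two hB.contDiffOn_x ht).1
    have hev : ∀ᶠ τ in 𝓝 t, act g (σ k τ) = !₂[-x τ, -1] := by
      filter_upwards [Icc_mem_nhds ht.1 ht.2] with τ hτ using e0 τ hτ
    have u0 := ((hasDerivAt_apply h1 0).congr_of_eventuallyEq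
      (hev.mono fun τ h => by simp [h])).unique hx.neg
    have u1 := (hasDerivAt_apply h1 1).unique ((hasDerivAt_const t (-1 : ℝ)).congr_of_eventuallyEq
      (hev.mono fun τ h => by simp [h]))
    rw [← wedge_act g, wedge, u0, u1, hev.self_of_nhds]
    simp
  have hw1 := fun t (ht : t ∈ Ioo t₀ t₁) =>
    wedge_deriv_eq (hσ.1.contDiffOn _) hB.contDiffOn_x hB.contDiffOn_s e1 ht
  have hw2 := fun t (ht : t ∈ Ioo t₀ t₁) =>
    wedge_deriv_eq (hσ.1.contDiffOn _) hB.contDiffOn_x hB.contDiffOn_s e2 ht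
  have hxle : ∀ t ∈ Ioo t₀ t₁, deriv x t ≤ 0 := fun t ht => by
    have := hccw k t ht
    rw [hw0 t ht] at this; linarith
  have hx := fun t (ht : t ∈ Ioo t₀ t₁) => hB.deriv_x_neg hxle ht
  have hs : ∀ t ∈ Ioo t₀ t₁, 0 < deriv s t := fun t ht => by
    have := hccw (k + 1) t ht
    rw [hw1 t ht] at this
    refine hB.deriv_s_pos hxle ht ?_
    rw [sub_eq_add_neg (s t) 1]; linarith
  have hpos : ∀ e : ℝ, ∀ t ∈ Ioo t₀ t₁,
      0 < (√3 * deriv s t - (s t + e) ^ 2 * deriv x t) / 4 := by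
    intro e t ht
    have h1 := hs t ht
    have h2 := mul_nonpos_of_nonneg_of_nonpos (sq_nonneg (s t + e)) (hx t ht).le
    have h3 : 0 < √3 * deriv s t := by positivity
    linarith
  have hsm := fun t (ht : t ∈ Ioo t₀ t₁) => hB.abs_s_lt ht
  have hS0 : IsSweeping (σ k) t₀ t₁ := by
    refine isSweeping_of_act g (fun t ht => ?_) (-1) fun t ht => ?_
    · rw [hw0 t ht]; linarith [hx t ht]
    · rw [e0 t (Ioo_subset_Icc_self ht)]; simp
  have hS1 : IsSweeping (σ (k + 1)) t₀ t₁ := by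
    refine isSweeping_of_act g (fun t ht => ?_) (-1) fun t ht => ?_
    · rw [hw1 t ht]; exact hpos _ t ht
    · rw [e1 t (Ioo_subset_Icc_self ht), skewPoint_one]; linarith [hsm t ht]
  have hS2 : IsSweeping (σ (k + 2)) t₀ t₁ := by
    refine isSweeping_of_act g (fun t ht => ?_) 1 fun t ht => ?_
    · rw [hw2 t ht]; exact hpos _ t ht
    · rw [e2 t (Ioo_subset_Icc_self ht), skewPoint_one]; linarith [hsm t ht]
  have hneg : ∀ j, IsSweeping (σ j) t₀ t₁ → IsSweeping (σ (j + 3)) t₀ t₁ := fun j hj =>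
    isSweeping_neg hj fun t ht => (hmc.multiPoint t ht).add_three j
  refine ⟨fun j => ?_, k, g, x, s, ⟨(hk k).mpr (Or.inl rfl), hB.contDiffOn_x, hB.contDiffOn_s, e0,
    fun t ht => ?_, fun t ht => ?_, hsm, hs, hx⟩, ?_⟩
  · rcases index_cases k j with rfl | rfl | rfl | rfl | rfl | rfl
    · exact hS0
    · exact hS1
    · exact hS2
    · exact hneg k hS0
    · rw [show k + 4 = k + 1 + 3 by ring]; exact hneg _ hS1
    · rw [show k + 5 = k + 2 + 3 by ring]; exact hneg _ hS2
  · rw [e1 t ht, skewPoint, sub_eq_add_neg]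
  · rw [e2 t ht, skewPoint]
  · rw [hS1.sectorArea_eq hmc.lt (hmc.contDiffOn _), hS2.sectorArea_eq hmc.lt (hmc.contDiffOn _),
      signedArea_eq_derivWithin _ hmc.lt.le, signedArea_eq_derivWithin _ hmc.lt.le, ← mul_add]
    have ii : ∀ j, IntervalIntegrable
        (fun t => wedge (σ j t) (derivWithin (σ j) (Icc t₀ t₁) t)) volume t₀ t₁ := by
      intro j
      apply ContinuousOn.intervalIntegrable
      rw [uIcc_of_le hmc.lt.le]
      exact continuousOn_wedge_derivWithin hmc.lt (hmc.contDiffOn j) (hmc.contDiffOn j)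
    rw [← intervalIntegral.integral_add (ii _) (ii _), ← intervalIntegral.integral_const_mul]
    refine integral_congr_Ioo hmc.lt.le fun t ht => ?_
    simp only [derivWithin_of_mem_nhds (Icc_mem_nhds ht.1 ht.2), hw1 t ht, hw2 t ht]
    ring

theorem IsRankPreservingVariation.eventually_sectorArea_eq {σ : ZMod 6 → ℝ → Plane} {t₀ t₁ : ℝ}
    {n : ℕ} {Φ : ℝ → ZMod 6 → ℝ → Plane} (h : IsRankPreservingVariation σ t₀ t₁ n Φ)
    (hσ : ∀ j, IsSweeping (σ j) t₀ t₁) :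
    ∀ᶠ ε in 𝓝 (0 : ℝ), ∀ j, sectorArea (Φ ε j) t₀ t₁ = signedArea (Φ ε j) t₀ t₁ := by
  obtain ⟨a, b, ha, -, hb, hsupp⟩ := h.support
  have hsw : ∀ᶠ ε in 𝓝 (0 : ℝ), ∀ j, IsSweeping (Φ ε j) t₀ t₁ := by
    rw [eventually_all]
    intro j
    exact (hσ j).eventually (Ψ := fun ε => Φ ε j) ((h.contDiffOn j).of_le (by norm_num))
      (h.zero j) ha hb fun ε => hsupp ε j
  filter_upwards [hsw, h.hasRank] with ε hε hr j
  have hmc := hr.1.isMultiCurve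
  exact (hε j).sectorArea_eq hmc.lt (hmc.contDiffOn j)

/-! ### Lattice packings -/

theorem IsCenter.interior {K : Set Plane} {c : Plane} (hc : IsCenter K c) {p : Plane}
    (hp : p ∈ interior K) : (2 : ℝ) • c - p ∈ interior K := by
  have : K = (Homeomorph.subLeft ((2 : ℝ) • c)) ⁻¹' K := by
    ext q
    refine ⟨fun h => hc q h, fun h => ?_⟩
    simpa using hc _ h
  rw [this, ← (Homeomorph.subLeft ((2 : ℝ) • c)).preimage_interior]
  simpa using hp

theorem mem_interior_translate {K : Set Plane} {v p : Plane} :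
    p ∈ interior ((fun q => v + q) '' K) ↔ p - v ∈ interior K := by
  have h := (Homeomorph.addLeft v).image_interior K
  change (fun q => v + q) '' interior K = interior ((fun q => v + q) '' K) at h
  rw [← h, image_add_left, mem_preimage, neg_add_eq_sub]

/-- A lattice is a packing lattice if and only if no half of a nonzero lattice vector lies in the
interior of the body, seen from its center. -/
theorem isLatticePacking_iff {K : Set Plane} (hK : IsSymmetricConvexDomain K) {c : Plane}
    (hc : IsCenter K c) {N : Plane ≃ₜ Plane} {E : Plane ≃L[ℝ] Plane} (hN : ∀ p, N p = c + E p)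
    (L : Submodule ℤ Plane) :
    IsLatticePacking K L ↔ ∀ p, p ≠ 0 → (2 : ℝ) • E p ∈ L → p ∉ interior (N ⁻¹' K) := by
  have hint : ∀ p, p ∈ interior (N ⁻¹' K) ↔ c + E p ∈ interior K := fun p => by
    rw [← N.preimage_interior, mem_preimage, hN]
  constructor
  · intro h p hp hpL hpi
    rw [hint] at hpi
    have hne : (0 : Plane) ≠ (2 : ℝ) • E p := by
      intro h0
      rcases smul_eq_zero.mp h0.symm with h1 | h1
      · norm_num at h1
      · exact hp (by simpa using h1)
    -- The point `c + E p` of the interior is also the translate by `2 • E p` of its reflection `c -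
    -- E p`.
    refine Set.disjoint_left.mp (h 0 (zero_mem L) _ hpL hne) (show c + E p ∈ _ from ?_) ?_
    · rw [mem_interior_translate, sub_zero]; exact hpi
    · rw [mem_interior_translate]
      convert hc.interior hpi using 1
      module
  · intro h v hv w hw hvw
    rw [Set.disjoint_left]
    intro z hz hz'
    rw [mem_interior_translate] at hz hz'
    -- For a common point `z` of the translates, the midpoint of `z - w` and the reflection of `z -
    -- v` is `c + (v - w) / 2`.
    have hmid := hK.convex.interior (hc.interior hz) hz' (show (0 : ℝ) ≤ 1 / 2 by norm_num)
      (show (0 : ℝ) ≤ 1 / 2 by norm_num) (by norm_num)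
    have he : E (E.symm ((1 / 2 : ℝ) • (v - w))) = (1 / 2 : ℝ) • (v - w) := E.apply_symm_apply _
    refine h (E.symm ((1 / 2 : ℝ) • (v - w))) ?_ ?_ ?_
    · intro h0
      rw [h0, map_zero] at he
      rcases smul_eq_zero.mp he.symm with h1 | h1
      · norm_num at h1
      · exact hvw (sub_eq_zero.mp h1)
    · rw [he, smul_smul]
      norm_num
      exact sub_mem hv hw
    · rw [hint, he]
      convert hmid using 1
      module

open scoped Pointwise in
/-- The density of a lattice packing is at most one. -/
theorem volume_le_covolume {K : Set Plane} (hK : IsSymmetricConvexDomain K)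
    (L : Submodule ℤ Plane) [DiscreteTopology L] [IsZLattice ℝ L] (h : IsLatticePacking K L) :
    (volume K).toReal ≤ ZLattice.covolume L := by
  have : Countable L := inferInstance
  let b := Module.Free.chooseBasis ℤ L
  have hfund := ZLattice.isAddFundamentalDomain b (volume : Measure Plane)
  have hfr : volume (interior K) = volume K :=
    measure_congr (interior_ae_eq_of_null_frontier (hK.convex.addHaar_frontier volume))
  rw [ZLattice.covolume_eq_measure_fundamentalDomain L volume hfund, Measure.real]
  refine ENNReal.toReal_mono
    (Bornology.IsBounded.measure_lt_top (ZSpan.fundamentalDomain_isBounded _)).ne ?_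
  rw [← hfr]
  by_contra! hlt
  have : MeasurableVAdd L Plane := (inferInstance : MeasurableVAdd L.toAddSubgroup Plane)
  have : VAddInvariantMeasure L Plane volume :=
    (inferInstance : VAddInvariantMeasure L.toAddSubgroup Plane volume)
  -- Pigeonhole: a set larger than a fundamental domain has two overlapping lattice translates.
  obtain ⟨v, w, hvw, hnd⟩ := exists_pair_mem_lattice_not_disjoint_vadd (L := L.toAddSubgroup) hfund
    isOpen_interior.measurableSet.nullMeasurableSet hlt
  refine hnd ?_
  have := h v v.2 w w.2 (fun h => hvw (Subtype.ext h))
  have e : ∀ v : L, (v +ᵥ interior K : Set Plane) = interior ((fun q => (v : Plane) + q) '' K) := by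
    intro v
    exact (Homeomorph.addLeft (v : Plane)).image_interior K
  exact (e v).symm ▸ (e w).symm ▸ this

theorem covolume_eq_abs_wedge (L : Submodule ℤ Plane) [DiscreteTopology L] [IsZLattice ℝ L]
    (b : Module.Basis (Fin 2) ℤ L) : ZLattice.covolume L = |wedge (b 0) (b 1)| := by
  let o := EuclideanSpace.basisFun (Fin 2) ℝ
  have h1 : (volume : Measure Plane).real (ZSpan.fundamentalDomain o.toBasis) = 1 := by
    rw [measureReal_congr (ZSpan.fundamentalDomain_ae_parallelepiped o.toBasis volume),
      Measure.real, OrthonormalBasis.coe_toBasis, OrthonormalBasis.volume_parallelepiped]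
    simp
  rw [ZLattice.covolume_eq_det_mul_measureReal L volume b o.toBasis, h1, mul_one,
    Module.Basis.det_apply, Matrix.det_fin_two]
  congr 1
  simp [Module.Basis.toMatrix_apply, wedge, o]
  ring

theorem exists_lattice {u v : Plane} (h : wedge u v ≠ 0) :
    ∃ (L : Submodule ℤ Plane) (_ : DiscreteTopology L) (_ : IsZLattice ℝ L),
      ZLattice.covolume L = |wedge u v| ∧ ∀ p ∈ L, ∃ m n : ℤ, p = (m : ℝ) • u + (n : ℝ) • v := by
  have hli : LinearIndependent ℝ ![u, v] := by
    rw [LinearIndependent.pair_iff]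
    intro a b hab
    have h1 : wedge u (a • u + b • v) = 0 := by rw [hab, wedge_zero_right]
    have h2 : wedge (a • u + b • v) v = 0 := by rw [hab, wedge_zero_left]
    rw [wedge_add_right, wedge_smul_right, wedge_smul_right, wedge_self] at h1
    rw [wedge_add_left, wedge_smul_left, wedge_smul_left, wedge_self] at h2
    have h1 : b * wedge u v = 0 := by linarith
    have h2 : a * wedge u v = 0 := by linarith
    exact ⟨(mul_eq_zero.mp h2).resolve_right h, (mul_eq_zero.mp h1).resolve_right h⟩
  let b := basisOfLinearIndependentOfCardEqFinrank hli (by simp)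
  have hb : ⇑b = ![u, v] := coe_basisOfLinearIndependentOfCardEqFinrank hli _
  refine ⟨Submodule.span ℤ (range b), inferInstance, inferInstance, ?_, fun p hp => ?_⟩
  · rw [covolume_eq_abs_wedge _ (b.restrictScalars ℤ)]
    simp [hb]
  · rw [hb, Matrix.range_cons, Matrix.range_cons, Matrix.range_empty, union_empty,
      singleton_union, Submodule.mem_span_pair] at hp
    obtain ⟨m, n, rfl⟩ := hp
    exact ⟨m, n, by simp only [Int.cast_smul_eq_zsmul]⟩

/-- The lattice generated by an inscribed affine regular hexagon does not meet the interior. -/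
theorem IsSymmBody.hexagon_notMem_interior {B : Set Plane} (hB : IsSymmBody B) {u v : Plane}
    (hu : u ∈ frontier B) (hv : v ∈ frontier B) (huv : v - u ∈ frontier B) {m n : ℤ}
    (hmn : m ≠ 0 ∨ n ≠ 0) : (m : ℝ) • u + (n : ℝ) • v ∉ interior B := by
  intro hp
  have hcl := hB.isCompact.isClosed.frontier_subset
  have key : ∀ w a : Plane, (∀ q ∈ B, wedge w q ≤ wedge w a) → 0 < wedge w a →
      ∀ q ∈ B, |wedge w q| ≤ wedge w a := by
    intro w a hw _ q hq
    have := hw _ (hB.neg_mem q hq)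
    rw [wedge_neg_right] at this
    exact abs_le.mpr ⟨by linarith, hw q hq⟩
  have key2 : ∀ w a : Plane, (∀ q ∈ interior B, wedge w q < wedge w a) →
      ∀ q ∈ interior B, |wedge w q| < wedge w a := by
    intro w a hw q hq
    have hq' : -q ∈ interior B := by
      have : B = Homeomorph.neg Plane ⁻¹' B := by
        ext q; exact ⟨fun h => hB.neg_mem q h, fun h => by simpa using hB.neg_mem _ h⟩
      rw [this, ← (Homeomorph.neg Plane).preimage_interior]
      simpa using hq
    have := hw _ hq'
    rw [wedge_neg_right] at this
    exact abs_lt.mpr ⟨by linarith, hw q hq⟩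
  -- One support line at each of the vertices `u`, `v`, `v - u` suffices. The signs of `m` and `n`
  -- decide which one excludes the point.
  obtain ⟨w0, a0, b0, c0⟩ := hB.exists_support hu
  obtain ⟨w1, a1, b1, c1⟩ := hB.exists_support hv
  obtain ⟨w2, a2, b2, c2⟩ := hB.exists_support huv
  have p0 := key2 w0 u c0 _ hp
  have p1 := key2 w1 v c1 _ hp
  have p2 := key2 w2 _ c2 _ hp
  have d0 := key w0 u b0 a0 _ (hcl hv)
  have d0' := key w0 u b0 a0 _ (hcl huv)
  have d1 := key w1 v b1 a1 _ (hcl hu)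
  have d1' := key w1 v b1 a1 _ (hcl huv)
  have d2 := key w2 _ b2 a2 _ (hcl hu)
  have d2' := key w2 _ b2 a2 _ (hcl hv)
  simp only [wedge_add_right, wedge_smul_right, wedge_sub_right, abs_le, abs_lt] at *
  obtain ⟨p0, p0'⟩ := p0
  obtain ⟨p1, p1'⟩ := p1
  obtain ⟨p2, p2'⟩ := p2
  have cast_pos : ∀ k : ℤ, 0 < k → (1 : ℝ) ≤ k := fun k hk => by exact_mod_cast hk
  have cast_neg : ∀ k : ℤ, k < 0 → (k : ℝ) ≤ -1 := fun k hk => by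
    have : k ≤ -1 := by omega
    exact_mod_cast this
  -- As the hexagon lies in each strip, every form has a definite sign on `u` and `v`; in each case
  -- below the two terms of the chosen form reinforce each other.
  have e0 : 0 ≤ wedge w0 v := by linarith
  have e1 : 0 ≤ wedge w1 u := by linarith
  have e2 : 0 ≤ wedge w2 v := by linarith
  have e2' : wedge w2 u ≤ 0 := by linarith
  rcases lt_trichotomy m 0 with hm | rfl | hm <;> rcases lt_trichotomy n 0 with hn | rfl | hn
  · have := cast_neg m hm; have := cast_neg n hn
    nlinarith
  · have := cast_neg m hm
    simp only [Int.cast_zero, zero_mul, add_zero] at *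
    nlinarith
  · have := cast_neg m hm; have := cast_pos n hn
    nlinarith
  · have := cast_neg n hn
    simp only [Int.cast_zero, zero_mul, zero_add] at *
    nlinarith
  · simp at hmn
  · have := cast_pos n hn
    simp only [Int.cast_zero, zero_mul, zero_add] at *
    nlinarith
  · have := cast_pos m hm; have := cast_neg n hn
    nlinarith
  · have := cast_pos m hm
    simp only [Int.cast_zero, zero_mul, add_zero] at *
    nlinarith
  · have := cast_pos m hm; have := cast_pos n hn
    nlinarith

/-- If half of a nonzero lattice vector is a side of a parallelogram inscribed in the body, then
the covolume is at least the area of this parallelogram. -/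
theorem IsSymmBody.le_covolume {B : Set Plane} (hB : IsSymmBody B) {D : Plane ≃L[ℝ] Plane}
    (L : Submodule ℤ Plane) [DiscreteTopology L] [IsZLattice ℝ L]
    (hL : ∀ p, p ≠ 0 → D p ∈ L → p ∉ interior B) {p q : Plane} (hp0 : p ≠ 0) (hp : D p ∈ L)
    (hp2 : (1 / 2 : ℝ) • p ∈ interior B) (hq : q ∈ B) (hpq : p + q ∈ B) :
    |wedge (D p) (D q)| ≤ ZLattice.covolume L := by
  have hfin : Module.finrank ℤ L = 2 := by
    rw [ZLattice.rank ℝ L, finrank_euclideanSpace_fin]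
  let b : Module.Basis (Fin 2) ℤ L := Module.finBasisOfFinrankEq ℤ L hfin
  have hcov := covolume_eq_abs_wedge L b
  have hcpos := ZLattice.covolume_pos L
  obtain ⟨m, n, hmn⟩ : ∃ m n : ℤ, D p = (m : ℝ) • (b 0 : Plane) + (n : ℝ) • (b 1 : Plane) := by
    refine ⟨b.repr ⟨D p, hp⟩ 0, b.repr ⟨D p, hp⟩ 1, ?_⟩
    have := congrArg (Subtype.val) (b.sum_repr ⟨D p, hp⟩)
    rw [Fin.sum_univ_two] at this
    simpa [Int.cast_smul_eq_zsmul] using this.symm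
  have hmem : ∀ i j : ℤ, (i : ℝ) • (b 0 : Plane) + (j : ℝ) • (b 1 : Plane) ∈ L := by
    intro i j
    have := (i • b 0 + j • b 1).2
    simpa [Int.cast_smul_eq_zsmul] using this
  have hDp0 : D p ≠ 0 := fun h => hp0 (by simpa using h)
  -- the lattice vector is primitive
  have hgcd : Int.gcd m n = 1 := by
    by_contra hne
    have hg0 : Int.gcd m n ≠ 0 := by
      intro h0
      rw [Int.gcd_eq_zero_iff] at h0
      rw [h0.1, h0.2] at hmn
      simp at hmn
      exact hp0 hmn
    have hg2 : (2 : ℝ) ≤ Int.gcd m n := by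
      have : 2 ≤ Int.gcd m n := by omega
      exact_mod_cast this
    set G : ℝ := ((Int.gcd m n : ℕ) : ℝ) with hG
    have hG0 : G ≠ 0 := by positivity
    obtain ⟨m', hm'⟩ := Int.gcd_dvd_left (a := m) (b := n)
    obtain ⟨n', hn'⟩ := Int.gcd_dvd_right (a := m) (b := n)
    have hmR : (m : ℝ) = G * m' := by rw [hG]; exact_mod_cast hm'
    have hnR : (n : ℝ) = G * n' := by rw [hG]; exact_mod_cast hn'
    refine hL (G⁻¹ • p) (smul_ne_zero (inv_ne_zero hG0) hp0) ?_ ?_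
    · rw [map_smul, hmn, hmR, hnR]
      convert hmem m' n' using 1
      rw [smul_add, smul_smul, smul_smul, ← mul_assoc, ← mul_assoc, inv_mul_cancel₀ hG0, one_mul,
        one_mul]
    · have hle : G⁻¹ * 2 ≤ 1 := by
        rw [inv_mul_le_iff₀ (by linarith)]; linarith
      have := hB.convex.interior hp2 hB.zero_mem (a := G⁻¹ * 2) (b := 1 - G⁻¹ * 2)
        (by positivity) (by linarith) (by ring)
      convert this using 1
      rw [smul_zero, add_zero, smul_smul]
      congr 1; ring
  by_contra! hlt
  set W := wedge (b 0 : Plane) (b 1) with hW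
  -- a lattice vector that completes it to a basis, on the side of `q`
  obtain ⟨w, hwL, hw⟩ : ∃ w ∈ L, wedge (D p) w = W := by
    refine ⟨_, hmem (-(Int.gcdB m n)) (Int.gcdA m n), ?_⟩
    have hbez := Int.gcd_eq_gcd_ab m n
    rw [hgcd] at hbez
    have hbezR : (1 : ℝ) = m * Int.gcdA m n + n * Int.gcdB m n := by exact_mod_cast hbez
    rw [hmn]
    simp only [wedge_add_left, wedge_add_right, wedge_smul_left, wedge_smul_right, wedge_self]
    rw [wedge_swap (b 1 : Plane) (b 0), ← hW]
    push_cast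
    linear_combination (-W) * hbezR
  have hA0 : wedge (D p) (D q) ≠ 0 := by
    intro h0; rw [h0, abs_zero] at hlt; linarith
  -- If the covolume is too small, the lattice line next to the line through `D p` lies strictly
  -- between that line and its parallel through `D q`; `β` is its relative distance.
  obtain ⟨w, hwL, hw0, β, hβ0, hβ1, hwβ⟩ : ∃ w ∈ L, wedge (D p) w ≠ 0 ∧ ∃ β : ℝ, 0 < β ∧ β < 1 ∧
      wedge (D p) w = β * wedge (D p) (D q) := by
    have hW0 : W ≠ 0 := by
      intro h0; rw [h0, abs_zero] at hcov; linarith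
    have hratio : |W / wedge (D p) (D q)| < 1 := by
      rw [abs_div, div_lt_one (abs_pos.mpr hA0), ← hcov]; exact hlt
    have hne : W / wedge (D p) (D q) ≠ 0 := div_ne_zero hW0 hA0
    rcases lt_or_gt_of_ne hne with h | h
    · refine ⟨-w, L.neg_mem hwL, by rw [wedge_neg_right, hw]; exact neg_ne_zero.mpr hW0,
        -(W / wedge (D p) (D q)), by linarith, by rw [abs_lt] at hratio; linarith, ?_⟩
      rw [wedge_neg_right, hw]; field_simp
    · refine ⟨w, hwL, by rw [hw]; exact hW0, W / wedge (D p) (D q), h,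
        by rw [abs_lt] at hratio; linarith, ?_⟩
      rw [hw]; field_simp
  obtain ⟨α, hα⟩ : ∃ α : ℝ, w = β • D q + α • D p := by
    refine ⟨wedge w (D q) / wedge (D p) (D q), ?_⟩
    rw [← sub_eq_zero]
    refine eq_zero_of_wedge_eq_zero hA0 ?_ ?_
    · rw [wedge_sub_right, wedge_add_right, wedge_smul_right, wedge_smul_right, wedge_self, hwβ]
      ring
    · rw [wedge_sub_right, wedge_add_right, wedge_smul_right, wedge_smul_right, wedge_self,
        wedge_swap (D q) w, wedge_swap (D q) (D p)]
      field_simp; ring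
  -- At level `β`, the hull of the interior segment from `-p / 2` to `p / 2` and the side from `q`
  -- to `p + q` contains the points `β • q + (l - (1 - β) / 2) • p` with `0 ≤ l ≤ 1`. They fill a
  -- translate of `p`, so some integer shift of `w` along `D p` lands there; the ceiling selects it.
  set j : ℤ := ⌈-(1 - β) / 2 - α⌉ with hj
  have hj1 := Int.le_ceil (-(1 - β) / 2 - α)
  have hj2 := Int.ceil_lt_add_one (-(1 - β) / 2 - α)
  rw [← hj] at hj1 hj2
  set l : ℝ := α + j + (1 - β) / 2 with hl
  have hl0 : 0 ≤ l := by rw [hl]; linarith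
  have hl1 : l ≤ 1 := by rw [hl]; linarith
  have hneg : (-(1 / 2 : ℝ)) • p ∈ interior B := by
    have : B = Homeomorph.neg Plane ⁻¹' B := by
      ext q; exact ⟨fun h => hB.neg_mem q h, fun h => by simpa using hB.neg_mem _ h⟩
    rw [this, ← (Homeomorph.neg Plane).preimage_interior]
    simpa using hp2
  have hin : (l - 1 / 2) • p ∈ interior B := by
    have := hB.convex.interior hp2 hneg hl0 (sub_nonneg.mpr hl1) (by ring)
    convert this using 1
    module
  have hqin : q + l • p ∈ B := by
    have := hB.convex hpq hq hl0 (sub_nonneg.mpr hl1) (by ring)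
    convert this using 1
    module
  have hz := hB.convex.combo_self_interior_mem_interior hqin hin hβ0.le (sub_pos.mpr hβ1) (by ring)
  have hz' : β • (q + l • p) + (1 - β) • (l - 1 / 2) • p = β • q + (α + j) • p := by
    rw [hl]; module
  rw [hz'] at hz
  have hDz : D (β • q + (α + j) • p) = w + (j : ℝ) • D p := by
    rw [map_add, map_smul, map_smul, hα]; module
  refine hL _ ?_ ?_ hz
  · intro h0
    rw [h0, map_zero] at hDz
    have : wedge (D p) (w + (j : ℝ) • D p) = 0 := by rw [← hDz, wedge_zero_right]
    rw [wedge_add_right, wedge_smul_right, wedge_self, mul_zero, add_zero] at this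
    exact hw0 this
  · rw [hDz]
    refine add_mem hwL ?_
    rw [Int.cast_smul_eq_zsmul]
    exact zsmul_mem hp j

/-! ### Comparison of packing densities -/

theorem deltaLat_nonneg (K : Set Plane) : 0 ≤ deltaLat K := by
  refine Real.sSup_nonneg ?_
  rintro d ⟨L, _, _, -, rfl⟩
  exact div_nonneg ENNReal.toReal_nonneg (ZLattice.covolume_pos L).le

theorem deltaMin_le {K : Set Plane} (hK : IsSymmetricConvexDomain K) : deltaMin ≤ deltaLat K := by
  refine csInf_le ⟨0, ?_⟩ ⟨K, hK, rfl⟩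
  rintro d ⟨K', -, rfl⟩
  exact deltaLat_nonneg K'

theorem density_le_deltaLat {K : Set Plane} (hK : IsSymmetricConvexDomain K)
    (L : Submodule ℤ Plane) [DiscreteTopology L] [IsZLattice ℝ L] (h : IsLatticePacking K L) :
    (volume K).toReal / ZLattice.covolume L ≤ deltaLat K := by
  refine le_csSup ⟨1, ?_⟩ ⟨L, inferInstance, inferInstance, h, rfl⟩
  rintro d ⟨L', _, _, hL', rfl⟩
  exact (div_le_one (ZLattice.covolume_pos L')).mpr (volume_le_covolume hK L' hL')

theorem IsSymmetricConvexDomain.volume_pos {K : Set Plane} (hK : IsSymmetricConvexDomain K) :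
    0 < (volume K).toReal :=
  ENNReal.toReal_pos ((isOpen_interior.measure_pos volume hK.interior_nonempty).trans_le
    (measure_mono interior_subset)).ne'
    hK.isCompact.measure_lt_top.ne

/-- A comparison of critical determinants gives a comparison of densities. -/
theorem deltaLat_lt {K K' : Set Plane} (hK : IsSymmetricConvexDomain K)
    (hvol : (volume K').toReal < (volume K).toReal)
    (L₀ : Submodule ℤ Plane) [DiscreteTopology L₀] [IsZLattice ℝ L₀]
    (hL₀ : IsLatticePacking K L₀)
    (h : ∀ (L : Submodule ℤ Plane) [DiscreteTopology L] [IsZLattice ℝ L],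
      IsLatticePacking K' L → IsLatticePacking K L ∨ ZLattice.covolume L₀ ≤ ZLattice.covolume L) :
    deltaLat K' < deltaLat K := by
  have hpos := hK.volume_pos
  have hδ : 0 < deltaLat K :=
    (div_pos hpos (ZLattice.covolume_pos L₀)).trans_le (density_le_deltaLat hK L₀ hL₀)
  -- A packing lattice of `K'` either packs `K` or is no denser than `L₀`; both ways its density for
  -- `K'` is at most the ratio of areas times `deltaLat K`.
  have hle : deltaLat K' ≤ (volume K').toReal / (volume K).toReal * deltaLat K := by
    refine Real.sSup_le ?_ (by positivity)
    rintro d ⟨L, _, _, hL, rfl⟩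
    have hc := ZLattice.covolume_pos L
    have hd : (volume K).toReal / ZLattice.covolume L ≤ deltaLat K := by
      rcases h L hL with h1 | h1
      · exact density_le_deltaLat hK L h1
      · exact (div_le_div_of_nonneg_left hpos.le (ZLattice.covolume_pos L₀) h1).trans
          (density_le_deltaLat hK L₀ hL₀)
    calc (volume K').toReal / ZLattice.covolume L
        = (volume K').toReal / (volume K).toReal *
            ((volume K).toReal / ZLattice.covolume L) := by field_simp
      _ ≤ (volume K').toReal / (volume K).toReal * deltaLat K :=
        mul_le_mul_of_nonneg_left hd (by positivity)
  refine hle.trans_lt ?_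
  have : (volume K').toReal / (volume K).toReal < 1 := (div_lt_one hpos).mpr hvol
  nlinarith

theorem IsSymmBody.isSymmetricConvexDomain {B : Set Plane} (hB : IsSymmBody B) {c : Plane}
    {N : Plane ≃ₜ Plane} {E : Plane ≃L[ℝ] Plane} (hN : ∀ p, N p = c + E p) :
    IsSymmetricConvexDomain (N '' B) ∧ IsCenter (N '' B) c := by
  have hc : IsCenter (N '' B) c := by
    rintro _ ⟨p, hp, rfl⟩
    refine ⟨-p, hB.neg_mem p hp, ?_⟩
    rw [hN, hN, map_neg]
    module
  refine ⟨⟨hB.isCompact.image N.continuous, ?_, ?_, c, hc⟩, hc⟩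
  · rintro _ ⟨p, hp, rfl⟩ _ ⟨q, hq, rfl⟩ a b ha hb hab
    refine ⟨_, hB.convex hp hq ha hb hab, ?_⟩
    simp only [hN, map_add, map_smul]
    have : c = (a + b) • c := by rw [hab, one_smul]
    conv_lhs => rw [this]
    module
  · rw [← N.image_interior]
    exact ⟨_, mem_image_of_mem N hB.zero_mem⟩

theorem volume_image_affine {N : Plane ≃ₜ Plane} {E : Plane ≃L[ℝ] Plane} {c : Plane}
    (hN : ∀ p, N p = c + E p) (S : Set Plane) :
    volume (N '' S) = ENNReal.ofReal |LinearMap.det (E : Plane →ₗ[ℝ] Plane)| * volume S := by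
  rw [← Measure.addHaar_image_continuousLinearEquiv volume E S]
  have : N '' S = (fun p => c + p) '' (E '' S) := by
    rw [image_image]; exact image_congr fun p _ => hN p
  rw [this, image_add_left, measure_preimage_add]

/-- A convex body with an inscribed hexagon is not optimal if another body has smaller area while
its lattice packings are not more dense. -/
theorem deltaLat_image_lt {K B' : Set Plane} (hK : IsSymmetricConvexDomain K) {c : Plane}
    (hc : IsCenter K c) {N : Plane ≃ₜ Plane} {E : Plane ≃L[ℝ] Plane} (hN : ∀ p, N p = c + E p)
    {ρ : ℝ} (hρ : 0 < ρ) (hE : ∀ p q, wedge (E p) (E q) = ρ * wedge p q)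
    (hB : IsSymmBody (N ⁻¹' K)) (hB' : IsSymmBody B') {u v : Plane}
    (hu : u ∈ frontier (N ⁻¹' K)) (hv : v ∈ frontier (N ⁻¹' K))
    (huv : v - u ∈ frontier (N ⁻¹' K)) (huv0 : wedge u v ≠ 0)
    (h : ∀ p ∈ interior (N ⁻¹' K), p ∉ interior B' → (1 / 2 : ℝ) • p ∈ interior B' ∧
      ∃ q ∈ B', p + q ∈ B' ∧ |wedge u v| ≤ |wedge p q|)
    (hvol : volume B' < volume (N ⁻¹' K)) : deltaLat (N '' B') < deltaLat K := by
  obtain ⟨hK', hc'⟩ := hB'.isSymmetricConvexDomain hN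
  have hpre : N ⁻¹' (N '' B') = B' := preimage_image_eq _ N.injective
  have hKim : N '' (N ⁻¹' K) = K := image_preimage_eq _ N.surjective
  -- The factor 2 is there because `isLatticePacking_iff` tests halves of lattice vectors.
  let D : Plane ≃L[ℝ] Plane :=
    E.trans (ContinuousLinearEquiv.smulLeft (Units.mk0 (2 : ℝ) two_ne_zero))
  have hD : ∀ p, D p = (2 : ℝ) • E p := fun p => rfl
  have hDw : ∀ p q, wedge (D p) (D q) = 4 * ρ * wedge p q := fun p q => by
    rw [hD, hD, wedge_smul_left, wedge_smul_right, hE]; ring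
  obtain ⟨L₀, _, _, hcov, hmem⟩ := exists_lattice (u := D u) (v := D v) (by
    rw [hDw]; exact mul_ne_zero (by positivity) huv0)
  have hL₀ : IsLatticePacking K L₀ := by
    rw [isLatticePacking_iff hK hc hN]
    intro p hp hpL
    obtain ⟨m, n, hmn⟩ := hmem _ hpL
    have hpe : p = (m : ℝ) • u + (n : ℝ) • v := by
      apply D.injective
      rw [map_add, map_smul, map_smul, ← hmn, hD]
    rw [hpe]
    refine hB.hexagon_notMem_interior hu hv huv ?_
    by_contra! h0
    rw [h0.1, h0.2] at hpe
    simp at hpe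
    exact hp hpe
  refine deltaLat_lt hK ?_ L₀ hL₀ fun L _ _ hL => ?_
  · refine ENNReal.toReal_strict_mono hK.isCompact.measure_lt_top.ne ?_
    conv_rhs => rw [← hKim]
    rw [volume_image_affine hN, volume_image_affine hN]
    have hdet : LinearMap.det (E : Plane →ₗ[ℝ] Plane) ≠ 0 := by
      have := LinearEquiv.isUnit_det' E.toLinearEquiv
      exact this.ne_zero
    exact (ENNReal.mul_lt_mul_iff_right (by simpa using hdet) ENNReal.ofReal_ne_top).mpr hvol
  · rw [isLatticePacking_iff hK' hc' hN, hpre] at hL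
    rw [isLatticePacking_iff hK hc hN]
    by_contra! hcon
    obtain ⟨⟨p, hp0, hpL, hpi⟩, hlt⟩ := hcon
    obtain ⟨h2, q, hq, hpq, hw⟩ := h p hpi (hL p hp0 hpL)
    have := hB'.le_covolume (D := D) L hL hp0 hpL h2 hq hpq
    rw [hcov, hDw, abs_mul] at hlt
    rw [hDw, abs_mul] at this
    have h4 : 0 < |4 * ρ| := abs_pos.mpr (by positivity)
    have := mul_le_mul_of_nonneg_left hw h4.le
    linarith

/-! ### Skew coordinates as functions of the height -/

theorem exists_contDiffOn_Icc {f : ℝ → ℝ} {a : ℝ} (hf : ContDiffAt ℝ 2 f a) :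
    ∃ r > 0, ContDiffOn ℝ 2 f (Icc (a - r) (a + r)) := by
  obtain ⟨r, hr, h⟩ := Metric.eventually_nhds_iff_ball.mp (hf.eventually (by simp))
  refine ⟨r / 2, by positivity, fun y hy => (h y ?_).contDiffWithinAt⟩
  rw [Metric.mem_ball, Real.dist_eq, abs_lt]
  exact ⟨by linarith [hy.1], by linarith [hy.2]⟩

/-- Near some time, the skew coordinates are in general position. -/
theorem IsSkewBody.exists_generic {B : Set Plane} {x s : ℝ → ℝ} {t₀ t₁ : ℝ}
    (h : IsSkewBody B x s t₀ t₁) :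
    ∃ t ∈ Ioo t₀ t₁, deriv x t ≠ 0 ∧ deriv s t ≠ 0 ∧ s t ≠ 0 := by
  -- In the sequel `s' ≠ 0` serves to invert `s`, `x' ≠ 0` makes the flat points cover a
  -- neighbourhood, and `s ≠ 0` decides the sign of the change of area.
  by_contra! hcon
  obtain ⟨t, ht⟩ := nonempty_Ioo.mpr h.lt
  have hx : ∀ t ∈ Ioo t₀ t₁, deriv x t = 0 → deriv (deriv x) t ≠ 0 := by
    intro t ht h0 h1
    refine h.curved 1 (Or.inl rfl) t ht ?_
    rw [h0, h1]; ring
  have hs : ∀ t ∈ Ioo t₀ t₁, deriv s t = 0 → deriv (deriv s) t ≠ 0 := by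
    intro t ht h0 h1
    refine h.curved 1 (Or.inl rfl) t ht ?_
    rw [h0, h1]; ring
  have dx := fun t (ht : t ∈ Ioo t₀ t₁) => (hasDerivAt_of_contDiffOn_two h.contDiffOn_x ht).2.1
  have ds := fun t (ht : t ∈ Ioo t₀ t₁) => (hasDerivAt_of_contDiffOn_two h.contDiffOn_s ht).2.1
  -- a continuous function with nonzero derivative at its zeros does not vanish identically
  have key : ∀ f : ℝ → ℝ, (∀ t ∈ Ioo t₀ t₁, HasDerivAt f (deriv f t) t) →
      (∀ t ∈ Ioo t₀ t₁, f t = 0 → deriv f t ≠ 0) → ∀ U : Set ℝ, IsOpen U → U ⊆ Ioo t₀ t₁ →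
      U.Nonempty → ∃ V, IsOpen V ∧ V ⊆ U ∧ V.Nonempty ∧ ∀ t ∈ V, f t ≠ 0 := by
    intro f hd hf U hU hsub hne
    obtain ⟨t, htU, hft⟩ : ∃ t ∈ U, f t ≠ 0 := by
      by_contra! hz
      obtain ⟨t, ht⟩ := hne
      have : HasDerivAt f 0 t := (hasDerivAt_const t (0 : ℝ)).congr_of_eventuallyEq
        (by filter_upwards [hU.mem_nhds ht] with τ hτ using hz τ hτ)
      exact hf t (hsub ht) (hz t ht) this.deriv
    have hcont : ContinuousOn f U := fun t ht => (hd t (hsub ht)).continuousAt.continuousWithinAt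
    exact ⟨U ∩ f ⁻¹' {0}ᶜ, hcont.isOpen_inter_preimage hU isOpen_compl_singleton,
      inter_subset_left, ⟨t, htU, hft⟩, fun t ht => ht.2⟩
  obtain ⟨U, hU, hUs, hUn, hU'⟩ := key (deriv x) dx hx _ isOpen_Ioo subset_rfl ⟨t, ht⟩
  obtain ⟨V, hV, hVs, ⟨t, htV⟩, hV'⟩ := key (deriv s) ds hs U hU hUs hUn
  have hzero : ∀ t ∈ V, s t = 0 := fun t ht =>
    hcon t (hUs (hVs ht)) (hU' t (hVs ht)) (hV' t ht)
  have : HasDerivAt s 0 t := (hasDerivAt_const t (0 : ℝ)).congr_of_eventuallyEq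
    (by filter_upwards [hV.mem_nhds htV] with τ hτ using hzero τ hτ)
  exact hV' t htV this.deriv

/-- A convex body together with two arcs of its boundary, as graphs over the height. -/
structure IsSkewGraph (B : Set Plane) (X : ℝ → ℝ) (a r : ℝ) : Prop where
  isSymmBody : IsSymmBody B
  abs_le : ∀ p ∈ B, |p 1| ≤ 1
  r_pos : 0 < r
  left_mem : -1 < a - r
  right_mem : a + r < 1
  r_lt : r < |a|
  contDiffOn : ContDiffOn ℝ 2 X (Icc (a - r) (a + r))
  flat_mem : ∀ᶠ ξ in 𝓝 (X a), !₂[ξ, 1] ∈ frontier B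
  skewPoint_mem : ∀ e : ℝ, e = 1 ∨ e = -1 → ∀ τ ∈ Ioo (a - r) (a + r),
    skewPoint (X τ) τ e ∈ frontier B
  curved : ∀ e : ℝ, e = 1 ∨ e = -1 → (a + e) * deriv (deriv X) a + 2 * deriv X a ≠ 0

/-- With `s` as parameter, `X = x ∘ s⁻¹`. By the chain rule the old curvature expression is `-s' ^
3` times `(a + e) * X'' + 2 * X'`. -/
theorem IsSkewBody.exists_isSkewGraph {B : Set Plane} {x s : ℝ → ℝ} {t₀ t₁ : ℝ}
    (h : IsSkewBody B x s t₀ t₁) : ∃ (X : ℝ → ℝ) (a r : ℝ), IsSkewGraph B X a r := by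
  obtain ⟨t, ht, hx', hs', hs0⟩ := h.exists_generic
  have hn := Icc_mem_nhds ht.1 ht.2
  have hcs : ContDiffAt ℝ 2 s t := h.contDiffOn_s.contDiffAt hn
  have hcx : ContDiffAt ℝ 2 x t := h.contDiffOn_x.contDiffAt hn
  have hsd : HasStrictDerivAt s (deriv s t) t := hcs.hasStrictDerivAt (by norm_num)
  have hfd : HasFDerivAt s ((ContinuousLinearEquiv.unitsEquivAut ℝ (Units.mk0 (deriv s t) hs') :
      ℝ ≃L[ℝ] ℝ) : ℝ →L[ℝ] ℝ) t := (hsd.hasStrictFDerivAt_equiv hs').hasFDerivAt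
  have hstr := hcs.hasStrictFDerivAt' hfd two_ne_zero
  set T : ℝ → ℝ := hcs.localInverse hfd two_ne_zero with hT
  have hTs : T (s t) = t := hcs.localInverse_apply_image hfd two_ne_zero
  have hTc : ContDiffAt ℝ 2 T (s t) := hcs.to_localInverse hfd two_ne_zero
  have hleft : ∀ᶠ τ in 𝓝 t, T (s τ) = τ := hstr.eventually_left_inverse
  have hright : ∀ᶠ τ in 𝓝 (s t), s (T τ) = τ := hstr.eventually_right_inverse
  set X : ℝ → ℝ := fun τ => x (T τ) with hX
  have hXc : ContDiffAt ℝ 2 X (s t) := by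
    refine ContDiffAt.comp (s t) ?_ hTc
    rw [hTs]; exact hcx
  obtain ⟨r₁, hr₁, hXr⟩ := exists_contDiffOn_Icc hXc
  have hTcont : Tendsto T (𝓝 (s t)) (𝓝 t) := by
    have := hTc.continuousAt
    rwa [ContinuousAt, hTs] at this
  have hTmem : ∀ᶠ τ in 𝓝 (s t), T τ ∈ Icc t₀ t₁ := hTcont.eventually hn
  obtain ⟨r₂, hr₂, hball⟩ := Metric.eventually_nhds_iff_ball.mp (hright.and hTmem)
  obtain ⟨hs1, hs2⟩ := h.abs_s_lt ht
  have habs : 0 < |s t| := abs_pos.mpr hs0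
  obtain ⟨r, hr, hrr₁, hrr₂, hr1, hr2, hr3⟩ : ∃ r > 0, r ≤ r₁ ∧ r ≤ r₂ ∧ r < s t + 1 ∧
      r < 1 - s t ∧ r < |s t| := by
    have hev : ∀ b : ℝ, 0 < b → ∀ᶠ r in 𝓝[>] (0 : ℝ), r < b := fun b hb =>
      nhdsWithin_le_nhds (Iio_mem_nhds hb)
    obtain ⟨r, h0, h1, h2, h3, h4, h5⟩ := (Filter.Eventually.and (p := fun r : ℝ => 0 < r)
      (self_mem_nhdsWithin : Ioi (0 : ℝ) ∈ 𝓝[>] 0)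
      ((hev r₁ hr₁).and ((hev r₂ hr₂).and ((hev (s t + 1) (by linarith)).and
      ((hev (1 - s t) (by linarith)).and (hev _ habs)))))).exists
    exact ⟨r, h0, h1.le, h2.le, h3, h4, h5⟩
  have hxX : ∀ᶠ τ in 𝓝 t, x τ = X (s τ) := by
    filter_upwards [hleft] with τ hτ
    rw [hX]; simp only [hτ]
  have dX := fun {τ : ℝ} (hτ : τ ∈ Ioo (s t - r₁) (s t + r₁)) => hasDerivAt_of_contDiffOn_two hXr hτ
  have hmem : s t ∈ Ioo (s t - r₁) (s t + r₁) := ⟨by linarith, by linarith⟩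
  have hd1 : ∀ᶠ τ in 𝓝 t, deriv x τ = deriv X (s τ) * deriv s τ := by
    have hsn : ∀ᶠ τ in 𝓝 t, s τ ∈ Ioo (s t - r₁) (s t + r₁) :=
      hcs.continuousAt.eventually (Ioo_mem_nhds hmem.1 hmem.2)
    filter_upwards [hxX.eventually_nhds, hsn, Ioo_mem_nhds ht.1 ht.2] with τ h1 h2 h3
    have h4 : x =ᶠ[𝓝 τ] fun τ => X (s τ) := h1
    rw [h4.deriv_eq]
    exact ((dX h2).1.comp τ (hasDerivAt_of_contDiffOn_two h.contDiffOn_s h3).1).deriv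
  have hd2 : deriv (deriv x) t = deriv (deriv X) (s t) * deriv s t * deriv s t +
      deriv X (s t) * deriv (deriv s) t := by
    have h4 : deriv x =ᶠ[𝓝 t] fun τ => deriv X (s τ) * deriv s τ := hd1
    rw [h4.deriv_eq]
    obtain ⟨s1, s2, -⟩ := hasDerivAt_of_contDiffOn_two h.contDiffOn_s ht
    exact (((dX hmem).2.1.comp t s1).mul s2).deriv
  have hflat : ∀ᶠ ξ in 𝓝 (X (s t)), !₂[ξ, 1] ∈ frontier B := by
    have hXs : X (s t) = x t := by rw [hX]; simp only [hTs]
    -- Since `x' ≠ 0`, the values of `x` near `t` fill a neighbourhood of `x t`.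
    rw [hXs, ← (hcx.hasStrictDerivAt (by norm_num)).map_nhds_eq hx', eventually_map]
    filter_upwards [hn] with τ hτ using h.flat_mem τ hτ
  refine ⟨X, s t, r, h.isSymmBody, h.abs_le, hr, by linarith, by linarith, hr3,
    hXr.mono (Icc_subset_Icc (by linarith) (by linarith)), hflat, fun e he τ hτ => ?_,
    fun e he h0 => h.curved e he t ht ?_⟩
  · have hb := hball τ (by
      rw [Metric.mem_ball, Real.dist_eq, abs_lt]
      exact ⟨by linarith [hτ.1], by linarith [hτ.2]⟩)
    have := h.skewPoint_mem e he (T τ) hb.2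
    rwa [hb.1] at this
  · rw [hd2, hd1.self_of_nhds]
    linear_combination (-(deriv s t) ^ 3) * h0

/-! ### Profiles of symmetric bodies -/

/-- The symmetric body `B` lies between the lines of height `-1` and `1`, and `R` is the abscissa
of its right boundary as a function of the height. -/
structure IsProfile (R : ℝ → ℝ) (B : Set Plane) : Prop where
  concaveOn : ConcaveOn ℝ (Icc (-1) 1) R
  mem_iff : ∀ p : Plane, p ∈ B ↔ |p 1| ≤ 1 ∧ p 0 ≤ R (p 1) ∧ -p 0 ≤ R (-p 1)

namespace IsProfile

variable {R : ℝ → ℝ} {B : Set Plane}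

theorem neg_mem (h : IsProfile R B) {p : Plane} (hp : p ∈ B) : -p ∈ B := by
  rw [h.mem_iff] at hp ⊢
  simpa [and_comm, and_assoc, and_left_comm] using hp

theorem convex (h : IsProfile R B) : Convex ℝ B := by
  intro p hp q hq a b ha hb hab
  rw [h.mem_iff] at hp hq ⊢
  simp only [PiLp.add_apply, PiLp.smul_apply, smul_eq_mul]
  obtain ⟨p1, p2, p3⟩ := hp
  obtain ⟨q1, q2, q3⟩ := hq
  have mp : p 1 ∈ Icc (-1 : ℝ) 1 := abs_le.mp p1
  have mq : q 1 ∈ Icc (-1 : ℝ) 1 := abs_le.mp q1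
  have mp' : -p 1 ∈ Icc (-1 : ℝ) 1 := ⟨by linarith [mp.2], by linarith [mp.1]⟩
  have mq' : -q 1 ∈ Icc (-1 : ℝ) 1 := ⟨by linarith [mq.2], by linarith [mq.1]⟩
  have h1 := h.concaveOn.2 mp mq ha hb hab
  have h2 := h.concaveOn.2 mp' mq' ha hb hab
  simp only [smul_eq_mul] at h1 h2
  refine ⟨abs_le.mpr (convex_Icc (-1 : ℝ) 1 mp mq ha hb hab), ?_, ?_⟩
  · have := mul_le_mul_of_nonneg_left p2 ha
    have := mul_le_mul_of_nonneg_left q2 hb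
    linarith
  · have := mul_le_mul_of_nonneg_left p3 ha
    have := mul_le_mul_of_nonneg_left q3 hb
    rw [show -(a * p 1 + b * q 1) = a * -p 1 + b * -q 1 by ring]
    linarith

theorem continuousOn (h : IsProfile R B) : ContinuousOn R (Ioo (-1) 1) := by
  have := h.concaveOn.continuousOn_interior
  rwa [interior_Icc] at this

theorem mem_interior_iff (h : IsProfile R B) {p : Plane} :
    p ∈ interior B ↔ |p 1| < 1 ∧ p 0 < R (p 1) ∧ -p 0 < R (-p 1) := by
  have hc : ∀ i, Continuous fun q : Plane => q i := fun i =>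
    (EuclideanSpace.proj i : Plane →L[ℝ] ℝ).continuous
  constructor
  · intro hp
    have hev : ∀ v : Plane, ∃ δ : ℝ, 0 < δ ∧ p + δ • v ∈ B := by
      intro v
      have hcont : ContinuousAt (fun δ : ℝ => p + δ • v) 0 := by fun_prop
      have : ∀ᶠ δ in 𝓝 (0 : ℝ), p + δ • v ∈ interior B :=
        hcont.eventually (isOpen_interior.mem_nhds (by simpa using hp))
      obtain ⟨δ, h1, h2⟩ := ((this.filter_mono (nhdsWithin_le_nhds (s := Ioi 0))).and
        (self_mem_nhdsWithin)).exists
      exact ⟨δ, h2, interior_subset h1⟩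
    obtain ⟨d1, hd1, h1⟩ := hev !₂[0, 1]
    obtain ⟨d2, hd2, h2⟩ := hev !₂[0, -1]
    obtain ⟨d3, hd3, h3⟩ := hev !₂[1, 0]
    obtain ⟨d4, hd4, h4⟩ := hev !₂[-1, 0]
    rw [h.mem_iff, abs_le] at h1 h2 h3 h4
    simp at h1 h2 h3 h4
    exact ⟨abs_lt.mpr ⟨by linarith, by linarith⟩, by linarith, by linarith⟩
  · intro hp
    have hU : IsOpen {q : Plane | q 1 ∈ Ioo (-1 : ℝ) 1} := isOpen_Ioo.preimage (hc 1)
    have hm : ∀ q : Plane, q 1 ∈ Ioo (-1 : ℝ) 1 → -q 1 ∈ Ioo (-1 : ℝ) 1 := fun q hq =>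
      ⟨by linarith [hq.2], by linarith [hq.1]⟩
    have c1 : ContinuousOn (fun q : Plane => R (q 1) - q 0) {q : Plane | q 1 ∈ Ioo (-1 : ℝ) 1} :=
      (h.continuousOn.comp (hc 1).continuousOn fun q hq => hq).sub (hc 0).continuousOn
    have c2 : ContinuousOn (fun q : Plane => R (-q 1) + q 0) {q : Plane | q 1 ∈ Ioo (-1 : ℝ) 1} :=
      (h.continuousOn.comp (hc 1).neg.continuousOn fun q hq => hm q hq).add (hc 0).continuousOn
    have o1 := c1.isOpen_inter_preimage hU (isOpen_Ioi (a := (0 : ℝ)))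
    have o2 := c2.isOpen_inter_preimage hU (isOpen_Ioi (a := (0 : ℝ)))
    refine mem_interior.mpr ⟨_, ?_, o1.inter o2, ?_⟩
    · rintro q ⟨⟨hq, q1⟩, -, q2⟩
      simp only [mem_preimage, mem_Ioi] at q1 q2
      exact (h.mem_iff q).mpr ⟨abs_le.mpr ⟨hq.1.le, hq.2.le⟩, by linarith, by linarith⟩
    · have hp1 := abs_lt.mp hp.1
      exact ⟨⟨hp1, show 0 < R (p 1) - p 0 by linarith⟩, hp1, show 0 < R (-p 1) + p 0 by linarith⟩

theorem volume_eq (h : IsProfile R B) (hR : IntegrableOn R (Ioo (-1) 1))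
    (h0 : ∀ y ∈ Ioo (-1 : ℝ) 1, 0 ≤ R y + R (-y)) :
    volume B = ENNReal.ofReal (2 * ∫ y in Ioo (-1 : ℝ) 1, R y) := by
  have hneg : MeasurePreserving (fun y : ℝ => -y) volume volume := Measure.measurePreserving_neg _
  have hpre : (fun y : ℝ => -y) ⁻¹' Ioo (-1) 1 = Ioo (-1) 1 := by
    ext y; simp [and_comm, neg_lt]
  have hR' : IntegrableOn (fun y => R (-y)) (Ioo (-1) 1) := by
    have := (hneg.integrableOn_comp_preimage (Homeomorph.neg ℝ).measurableEmbedding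
      (f := R) (s := Ioo (-1) 1)).mpr hR
    rwa [hpre] at this
  have hint : ∫ y in Ioo (-1 : ℝ) 1, R (-y) = ∫ y in Ioo (-1 : ℝ) 1, R y := by
    have := hneg.setIntegral_preimage_emb (Homeomorph.neg ℝ).measurableEmbedding R (Ioo (-1) 1)
    rwa [hpre] at this
  have hmp : MeasurePreserving (planeProd.trans MeasurableEquiv.prodComm) volume
      (volume.prod volume) :=
    measurePreserving_planeProd.trans Measure.measurePreserving_swap
  have hreg : planeProd.trans MeasurableEquiv.prodComm ⁻¹'
      regionBetween (fun y => -R (-y)) R (Ioo (-1) 1) = interior B := by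
    ext p
    rw [h.mem_interior_iff, abs_lt]
    change (p 1 ∈ Ioo (-1 : ℝ) 1 ∧ p 0 ∈ Ioo (-R (-p 1)) (R (p 1))) ↔ _
    rw [mem_Ioo, mem_Ioo, neg_lt (a := p 0), and_comm (a := -R (-p 1) < p 0), neg_lt]
  rw [← measure_congr (interior_ae_eq_of_null_frontier (h.convex.addHaar_frontier volume)), ← hreg,
    hmp.measure_preimage_equiv, volume_regionBetween_eq_integral (by simpa using hR'.neg) hR
      measurableSet_Ioo (fun y hy => by linarith [h0 y hy])]
  congr 1
  have : ∫ y in Ioo (-1 : ℝ) 1, (R - fun y => -R (-y)) y = ∫ y in Ioo (-1 : ℝ) 1, (R y + R (-y)) :=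
    integral_congr_ae (Eventually.of_forall fun y => by simp)
  rw [this, integral_add hR hR', hint]; ring

end IsProfile

/-- The profile of a symmetric body that touches the line of height `1`. -/
theorem IsSymmBody.exists_isProfile {B : Set Plane} (hB : IsSymmBody B)
    (habs : ∀ p ∈ B, |p 1| ≤ 1) {ξ : ℝ} (hξ : !₂[ξ, 1] ∈ B) :
    ∃ R : ℝ → ℝ, IsProfile R B ∧ ∀ y ∈ Icc (-1 : ℝ) 1, !₂[R y, y] ∈ B := by
  have hc : ∀ i, Continuous fun q : Plane => q i := fun i =>
    (EuclideanSpace.proj i : Plane →L[ℝ] ℝ).continuous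
  have hmax : ∀ y ∈ Icc (-1 : ℝ) 1, ∃ u, !₂[u, y] ∈ B ∧ ∀ p ∈ B, p 1 = y → p 0 ≤ u := by
    intro y hy
    have hcpt : IsCompact (B ∩ {p : Plane | p 1 = y}) :=
      hB.isCompact.inter_right (isClosed_eq (hc 1) continuous_const)
    have hne : (B ∩ {p : Plane | p 1 = y}).Nonempty := by
      have := hB.convex hξ (hB.neg_mem _ hξ) (a := (1 + y) / 2) (b := (1 - y) / 2)
        (by linarith [hy.1]) (by linarith [hy.2]) (by ring)
      exact ⟨_, this, by simp; ring⟩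
    obtain ⟨p, ⟨hp, hpy⟩, hpm⟩ := hcpt.exists_isMaxOn hne (hc 0).continuousOn
    refine ⟨p 0, ?_, fun q hq hqy => hpm ⟨hq, hqy⟩⟩
    have : !₂[p 0, y] = p := plane_ext rfl hpy.symm
    rwa [this]
  choose! R hR hRm using hmax
  refine ⟨R, ⟨⟨convex_Icc _ _, fun y hy z hz a b ha hb hab => ?_⟩, fun p => ⟨fun hp => ?_, ?_⟩⟩, hR⟩
  · have := hB.convex (hR y hy) (hR z hz) ha hb hab
    have := hRm _ (convex_Icc (-1 : ℝ) 1 hy hz ha hb hab) _ this (by simp)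
    simpa using this
  · have h1 := abs_le.mp (habs p hp)
    refine ⟨habs p hp, hRm _ h1 p hp rfl, ?_⟩
    have := hRm (-p 1) ⟨by linarith, by linarith⟩ (-p) (hB.neg_mem p hp) rfl
    simpa using this
  · rintro ⟨h1, h2, h3⟩
    have h1 := abs_le.mp h1
    have m1 := hR (p 1) h1
    have m2 := hB.neg_mem _ (hR (-p 1) ⟨by linarith, by linarith⟩)
    rcases (show -R (-p 1) ≤ R (p 1) by linarith).eq_or_lt with he | hlt
    · have : p = !₂[R (p 1), p 1] := plane_ext (le_antisymm h2 (by linarith : R (p 1) ≤ p 0)) rfl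
      rw [this]; exact m1
    · have hpos : 0 < R (p 1) + R (-p 1) := by linarith
      have := hB.convex m1 m2 (a := (p 0 + R (-p 1)) / (R (p 1) + R (-p 1)))
        (b := (R (p 1) - p 0) / (R (p 1) + R (-p 1))) (div_nonneg (by linarith) hpos.le)
        (div_nonneg (by linarith) hpos.le) (by field_simp; ring)
      convert this using 1
      apply plane_ext
      · simp; field_simp; ring
      · simp; field_simp; ring

/-- The profile is bounded and continuous inside, hence integrable. -/
theorem IsProfile.integrableOn {R : ℝ → ℝ} {B : Set Plane} (h : IsProfile R B)
    (hB : IsSymmBody B) (hR : ∀ y ∈ Icc (-1 : ℝ) 1, !₂[R y, y] ∈ B) :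
    ∃ M, (∀ y ∈ Icc (-1 : ℝ) 1, R y ≤ M) ∧ IntegrableOn R (Ioo (-1) 1) := by
  obtain ⟨M, hM⟩ := hB.isCompact.isBounded.exists_norm_le
  have hb : ∀ y ∈ Icc (-1 : ℝ) 1, ‖R y‖ ≤ M := fun y hy =>
    (PiLp.norm_apply_le (!₂[R y, y] : Plane) 0).trans (hM _ (hR y hy))
  refine ⟨M, fun y hy => (le_abs_self _).trans (hb y hy), ?_⟩
  refine Integrable.of_bound (h.continuousOn.aestronglyMeasurable measurableSet_Ioo) M ?_
  exact (ae_restrict_iff' measurableSet_Ioo).mpr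
    (Eventually.of_forall fun y hy => hb y (Ioo_subset_Icc_self hy))

open scoped Pointwise in
/-- A continuous perturbation of the profile of a symmetric body is the profile of a symmetric
body, if it is concave. -/
theorem IsProfile.isSymmBody_add {R ψ : ℝ → ℝ} {B B' : Set Plane} (h : IsProfile R B)
    (hB : IsSymmBody B) (hR : ∀ y ∈ Icc (-1 : ℝ) 1, !₂[R y, y] ∈ B) (hψ : Continuous ψ)
    (h' : IsProfile (fun y => R y + ψ y) B') (h0 : 0 < R 0 + ψ 0) : IsSymmBody B' := by
  have hc : ∀ i, Continuous fun q : Plane => q i := fun i =>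
    (EuclideanSpace.proj i : Plane →L[ℝ] ℝ).continuous
  -- the left saturation of the body is closed
  set A : Set Plane := {p | |p 1| ≤ 1 ∧ p 0 ≤ R (p 1)} with hA
  have hAcl : IsClosed A := by
    have hC : IsClosed {p : Plane | p 1 = 0 ∧ p 0 ≤ 0} :=
      (isClosed_eq (hc 1) continuous_const).inter (isClosed_le (hc 0) continuous_const)
    -- A compact set plus a closed ray is closed. This bypasses the continuity of `R` at `±1`, which
    -- concavity alone does not give.
    have hAeq : A = B + {p : Plane | p 1 = 0 ∧ p 0 ≤ 0} := by
      ext p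
      rw [Set.mem_add]
      constructor
      · rintro ⟨h1, h2⟩
        refine ⟨!₂[R (p 1), p 1], hR _ (abs_le.mp h1), p - !₂[R (p 1), p 1], ?_, by abel⟩
        simpa using h2
      · rintro ⟨b, hb, q, ⟨q1, q2⟩, rfl⟩
        rw [h.mem_iff] at hb
        simp only [hA, mem_ofPred_eq, PiLp.add_apply, q1, add_zero]
        exact ⟨hb.1, by linarith⟩
    rw [hAeq]
    exact hC.add_left_of_isCompact hB.isCompact
  have hshear : Continuous fun p : Plane => p - !₂[ψ (p 1), 0] := by
    refine continuous_id.sub ?_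
    have : Continuous fun p : Plane => (![ψ (p 1), 0] : Fin 2 → ℝ) := by
      refine continuous_pi fun i => ?_
      fin_cases i
      · exact hψ.comp (hc 1)
      · exact continuous_const
    exact (PiLp.continuous_toLp 2 _).comp this
  have hBeq : B' = (fun p : Plane => p - !₂[ψ (p 1), 0]) ⁻¹' A ∩
      (fun p : Plane => -p) ⁻¹' ((fun p : Plane => p - !₂[ψ (p 1), 0]) ⁻¹' A) := by
    ext p
    rw [h'.mem_iff]
    simp only [hA, mem_inter_iff, mem_preimage, mem_ofPred_eq, PiLp.sub_apply, PiLp.neg_apply,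
      Matrix.cons_val_zero, Matrix.cons_val_one, sub_zero, abs_neg, sub_le_iff_le_add]
    tauto
  have hcl : IsClosed B' := by
    rw [hBeq]
    exact (hAcl.preimage hshear).inter ((hAcl.preimage hshear).preimage continuous_neg)
  obtain ⟨M, hM, -⟩ := h.integrableOn hB hR
  obtain ⟨M', hM'⟩ := (isCompact_Icc (a := (-1 : ℝ)) (b := 1)).exists_bound_of_continuousOn
    hψ.continuousOn
  have hbd : Bornology.IsBounded B' := by
    refine (Metric.isBounded_closedBall (x := (0 : Plane)) (r := (M + M') + 1)).subset fun p hp => ?_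
    rw [h'.mem_iff] at hp
    obtain ⟨h1, h2, h3⟩ := hp
    have hy := abs_le.mp h1
    have hy' : -p 1 ∈ Icc (-1 : ℝ) 1 := ⟨by linarith, by linarith⟩
    have a1 := (le_abs_self _).trans (hM' _ hy)
    have a2 := (le_abs_self _).trans (hM' _ hy')
    have hp0 : |p 0| ≤ M + M' := abs_le.mpr
      ⟨by linarith [hM _ hy'], by linarith [hM _ hy]⟩
    rw [mem_closedBall_zero_iff, EuclideanSpace.norm_eq, Fin.sum_univ_two, Real.norm_eq_abs,
      Real.norm_eq_abs]
    refine Real.sqrt_le_iff.mpr ⟨by linarith [abs_nonneg (p 0)], ?_⟩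
    nlinarith [abs_nonneg (p 0), abs_nonneg (p 1)]
  refine ⟨Metric.isCompact_of_isClosed_isBounded hcl hbd, h'.convex, ?_, fun p => h'.neg_mem⟩
  rw [h'.mem_interior_iff]
  simpa using h0

/-! ### Perturbations of concave functions -/

/-- The slope over the union is a weighted mean of the two adjacent slopes. -/
theorem slope_le_of_adjacent {f : ℝ → ℝ} {x y z : ℝ} (hxy : x < y) (hyz : y < z)
    (h : (f z - f y) / (z - y) ≤ (f y - f x) / (y - x)) :
    (f z - f x) / (z - x) ≤ (f y - f x) / (y - x) ∧
      (f z - f y) / (z - y) ≤ (f z - f x) / (z - x) := by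
  have h1 : 0 < y - x := by linarith
  have h2 : 0 < z - y := by linarith
  have h3 : 0 < z - x := by linarith
  rw [div_le_div_iff₀ h2 h1] at h
  rw [div_le_div_iff₀ h3 h1, div_le_div_iff₀ h2 h3]
  exact ⟨by linarith, by linarith⟩

/-- Concave functions on overlapping intervals are concave on the union. -/
theorem concaveOn_Icc_of_overlap {f : ℝ → ℝ} {a a' b' c : ℝ} (h₁ : ConcaveOn ℝ (Icc a b') f)
    (h₂ : ConcaveOn ℝ (Icc a' c) f) (hab : a ≤ a') (hlt : a' < b') (hbc : b' ≤ c) :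
    ConcaveOn ℝ (Icc a c) f := by
  -- When the three points do not lie in one of the intervals, adjacent slopes are compared through
  -- intermediate slopes ending at `a'` or `b'`.
  refine concaveOn_of_slope_anti_adjacent (convex_Icc a c) fun {x y z} hx hz hxy hyz => ?_
  rcases lt_or_ge y b' with hy | hy
  · rcases le_or_gt z b' with hzb | hzb
    · exact h₁.slope_anti_adjacent ⟨hx.1, by linarith⟩ ⟨by linarith [hx.1], hzb⟩ hxy hyz
    · refine le_trans ?_ (h₁.slope_anti_adjacent (z := b') ⟨hx.1, by linarith⟩
        ⟨by linarith, le_rfl⟩ hxy hy)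
      refine (slope_le_of_adjacent hy hzb ?_).1
      rcases lt_or_ge y a' with hya | hya
      · refine (h₂.slope_anti_adjacent ⟨le_rfl, by linarith⟩ ⟨by linarith, hz.2⟩ hlt hzb).trans ?_
        exact (slope_le_of_adjacent hya hlt (h₁.slope_anti_adjacent ⟨by linarith [hx.1], by linarith⟩
          ⟨by linarith, le_rfl⟩ hya hlt)).2
      · exact h₂.slope_anti_adjacent ⟨hya, by linarith⟩ ⟨by linarith, hz.2⟩ hy hzb
  · rcases le_or_gt a' x with hxa | hxa
    · exact h₂.slope_anti_adjacent ⟨hxa, by linarith [hz.2]⟩ ⟨by linarith, hz.2⟩ hxy hyz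
    · have hay : a' < y := by linarith
      refine (h₂.slope_anti_adjacent (x := a') ⟨le_rfl, by linarith [hz.2]⟩
        ⟨by linarith, hz.2⟩ hay hyz).trans ?_
      refine (slope_le_of_adjacent hxa hay ?_).2
      refine le_trans ?_ (h₁.slope_anti_adjacent ⟨hx.1, by linarith⟩ ⟨by linarith, le_rfl⟩ hxa hlt)
      rcases hy.eq_or_lt with rfl | hy
      · exact le_rfl
      · exact (slope_le_of_adjacent hlt hy (h₂.slope_anti_adjacent ⟨le_rfl, by linarith⟩
          ⟨by linarith, by linarith [hz.2]⟩ hlt hy)).1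

/-- A concave function remains concave under small perturbations supported where its second
derivative is negative. -/
theorem exists_concaveOn_perturbation {R : ℝ → ℝ} (hR : ConcaveOn ℝ (Icc (-1) 1) R) {y₀ : ℝ}
    (hy₀ : y₀ ∈ Ioo (-1 : ℝ) 1) (hd : ContDiffAt ℝ 2 R y₀) (hneg : deriv (deriv R) y₀ < 0) :
    ∃ ρ > 0, ∀ χ : ℝ → ℝ, ContDiff ℝ 2 χ → (∀ y, ρ ≤ |y - y₀| → χ y = 0) →
      ∀ᶠ ε in 𝓝 (0 : ℝ), ConcaveOn ℝ (Icc (-1) 1) fun y => R y + ε * χ y := by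
  obtain ⟨r, hr, hcd⟩ := exists_contDiffOn_Icc hd
  have hmem : y₀ ∈ Ioo (y₀ - r) (y₀ + r) := ⟨by linarith, by linarith⟩
  have hcont := (hasDerivAt_of_contDiffOn_two hcd hmem).2.2
  have hev : ∀ᶠ y in 𝓝 y₀, deriv (deriv R) y < deriv (deriv R) y₀ / 2 ∧
      y ∈ Ioo (-1 : ℝ) 1 ∧ y ∈ Ioo (y₀ - r) (y₀ + r) :=
    (hcont.eventually_lt continuousAt_const (by linarith)).and
      (Filter.Eventually.and (Ioo_mem_nhds hy₀.1 hy₀.2) (Ioo_mem_nhds hmem.1 hmem.2))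
  obtain ⟨η, hη, hball⟩ := Metric.eventually_nhds_iff_ball.mp hev
  have hsub : ∀ y ∈ Icc (y₀ - η / 2) (y₀ + η / 2), deriv (deriv R) y < deriv (deriv R) y₀ / 2 ∧
      y ∈ Ioo (-1 : ℝ) 1 ∧ y ∈ Ioo (y₀ - r) (y₀ + r) := fun y hy =>
    hball y (by rw [Metric.mem_ball, Real.dist_eq, abs_lt]; constructor <;> linarith [hy.1, hy.2])
  -- The radius is half that of the middle interval, so the outer intervals, where nothing changes,
  -- overlap it.
  refine ⟨η / 4, by positivity, fun χ hχ hsupp => ?_⟩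
  have hχd : ∀ y, HasDerivAt χ (deriv χ y) y ∧ HasDerivAt (deriv χ) (deriv (deriv χ) y) y ∧
      ContinuousAt (deriv (deriv χ)) y := fun y =>
    hasDerivAt_of_contDiffOn_two (hχ.contDiffOn (s := Icc (y - 1) (y + 1)))
      ⟨by linarith, by linarith⟩
  obtain ⟨M, hM⟩ := (isCompact_Icc (a := y₀ - η / 2) (b := y₀ + η / 2)).exists_bound_of_continuousOn
    (f := deriv (deriv χ)) fun y _ => (hχd y).2.2.continuousWithinAt
  have hM0 : 0 ≤ M := (norm_nonneg _).trans (hM y₀ ⟨by linarith, by linarith⟩)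
  have hsmall : ∀ᶠ ε in 𝓝 (0 : ℝ), |ε| * M < -(deriv (deriv R) y₀ / 2) :=
    ((continuous_abs.mul continuous_const).continuousAt (x := (0 : ℝ))).eventually_lt
      continuousAt_const (by simp; linarith)
  filter_upwards [hsmall] with ε hε
  have hmid : ConcaveOn ℝ (Icc (y₀ - η / 2) (y₀ + η / 2)) fun y => R y + ε * χ y := by
    have hRd : ∀ y ∈ Icc (y₀ - η / 2) (y₀ + η / 2), HasDerivAt R (deriv R y) y ∧
        HasDerivAt (deriv R) (deriv (deriv R) y) y := fun y hy =>
      ⟨(hasDerivAt_of_contDiffOn_two hcd (hsub y hy).2.2).1,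
        (hasDerivAt_of_contDiffOn_two hcd (hsub y hy).2.2).2.1⟩
    refine concaveOn_of_hasDerivWithinAt2_nonpos (convex_Icc _ _)
      (f' := fun y => deriv R y + ε * deriv χ y)
      (f'' := fun y => deriv (deriv R) y + ε * deriv (deriv χ) y) ?_ ?_ ?_ ?_
    · exact fun y hy => ((hRd y hy).1.add ((hχd y).1.const_mul ε)).continuousAt.continuousWithinAt
    · exact fun y hy => ((hRd y (interior_subset hy)).1.add
        ((hχd y).1.const_mul ε)).hasDerivWithinAt
    · exact fun y hy => ((hRd y (interior_subset hy)).2.add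
        ((hχd y).2.1.const_mul ε)).hasDerivWithinAt
    · intro y hy
      have hy := interior_subset hy
      have h1 := (hsub y hy).1
      have h2 : ε * deriv (deriv χ) y ≤ |ε| * M := (le_abs_self _).trans (by
        rw [abs_mul]; exact mul_le_mul_of_nonneg_left (hM y hy) (abs_nonneg _))
      linarith
  have hlo := (hsub (y₀ - η / 2) ⟨le_rfl, by linarith⟩).2.1
  have hhi := (hsub (y₀ + η / 2) ⟨by linarith, le_rfl⟩).2.1
  have hleft : ConcaveOn ℝ (Icc (-1) (y₀ - η / 4)) fun y => R y + ε * χ y := by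
    refine (hR.subset (Icc_subset_Icc le_rfl (by linarith [hhi.2])) (convex_Icc _ _)).congr
      fun y hy => ?_
    simp [hsupp y (by rw [abs_of_nonpos] <;> linarith [hy.2])]
  have hright : ConcaveOn ℝ (Icc (y₀ + η / 4) 1) fun y => R y + ε * χ y := by
    refine (hR.subset (Icc_subset_Icc (by linarith [hlo.1]) le_rfl) (convex_Icc _ _)).congr
      fun y hy => ?_
    simp [hsupp y (by rw [abs_of_nonneg] <;> linarith [hy.1])]
  exact concaveOn_Icc_of_overlap
    (concaveOn_Icc_of_overlap hleft hmid hlo.1.le (by linarith) (by linarith)) hright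
    (by linarith [hlo.1]) (by linarith) hhi.2.le

theorem deriv_deriv_nonpos_of_concaveOn {R : ℝ → ℝ} {s : Set ℝ} (hR : ConcaveOn ℝ s R) {y₀ : ℝ}
    (hs : s ∈ 𝓝 y₀) (hd : ContDiffAt ℝ 2 R y₀) : deriv (deriv R) y₀ ≤ 0 := by
  obtain ⟨r, hr, hcd⟩ := exists_contDiffOn_Icc hd
  obtain ⟨η, hη, hball⟩ := Metric.mem_nhds_iff.mp hs
  set ρ := min r η with hρ
  have hρ0 : 0 < ρ := lt_min hr hη
  have hmem : ∀ y ∈ Ioo (y₀ - ρ) (y₀ + ρ), y ∈ Ioo (y₀ - r) (y₀ + r) := fun y hy =>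
    ⟨by linarith [hy.1, min_le_left r η], by linarith [hy.2, min_le_left r η]⟩
  have hc : ConcaveOn ℝ (Ioo (y₀ - ρ) (y₀ + ρ)) R := by
    refine hR.subset (fun y hy => hball ?_) (convex_Ioo _ _)
    rw [Metric.mem_ball, Real.dist_eq, abs_lt]
    constructor <;> linarith [hy.1, hy.2, min_le_right r η]
  have hanti : AntitoneOn (deriv R) (Ioo (y₀ - ρ) (y₀ + ρ)) := hc.antitoneOn_deriv
    fun y hy => (hasDerivAt_of_contDiffOn_two hcd (hmem y hy)).1.differentiableAt
  have hy₀ : y₀ ∈ Ioo (y₀ - ρ) (y₀ + ρ) := ⟨by linarith, by linarith⟩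
  have := hanti.derivWithin_nonpos (x := y₀)
  rwa [derivWithin_of_isOpen isOpen_Ioo hy₀] at this

/-! ### The profile near the two arcs -/

namespace IsSkewGraph

variable {B : Set Plane} {X : ℝ → ℝ} {a r : ℝ}

/-- The uniform margin `η` is the room needed to replace `X` by `X + ε n` without leaving the flat
side. -/
theorem exists_flat (h : IsSkewGraph B X a r) : ∃ δ > 0, δ ≤ r ∧ ∃ η > 0,
    ∀ τ ∈ Ioo (a - δ) (a + δ), ∀ ξ, |ξ - X τ| ≤ η → !₂[ξ, 1] ∈ B := by
  obtain ⟨η, hη, hball⟩ := Metric.eventually_nhds_iff_ball.mp h.flat_mem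
  have ha : a ∈ Ioo (a - r) (a + r) := ⟨by linarith [h.r_pos], by linarith [h.r_pos]⟩
  have hc : ContinuousAt X a := (hasDerivAt_of_contDiffOn_two h.contDiffOn ha).1.continuousAt
  obtain ⟨δ, hδ, hX⟩ := Metric.continuousAt_iff.mp hc (η / 2) (by positivity)
  refine ⟨min δ r, lt_min hδ h.r_pos, min_le_right _ _, η / 4, by positivity, fun τ hτ ξ hξ => ?_⟩
  have h1 : |X τ - X a| < η / 2 := by
    rw [← Real.dist_eq]
    refine hX ?_
    rw [Real.dist_eq, abs_lt]
    constructor <;> linarith [hτ.1, hτ.2, min_le_left δ r]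
  refine h.isSymmBody.isCompact.isClosed.frontier_subset (hball ξ ?_)
  rw [Metric.mem_ball, Real.dist_eq]
  calc |ξ - X a| ≤ |ξ - X τ| + |X τ - X a| := abs_sub_le _ _ _
    _ < η := by linarith

/-- The profile is determined by the arcs. -/
theorem profile_eq (h : IsSkewGraph B X a r) {R : ℝ → ℝ} (hR : IsProfile R B) {e τ : ℝ}
    (he : e = 1 ∨ e = -1) (hτ : τ ∈ Ioo (a - r) (a + r)) (hflat : !₂[X τ, 1] ∈ B) :
    R ((τ + e) / 2) = √3 / 2 + (τ + e) / 2 * X τ := by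
  have hp := h.skewPoint_mem e he τ hτ
  have hpB := (hR.mem_iff _).mp (h.isSymmBody.isCompact.isClosed.frontier_subset hp)
  have hpi : skewPoint (X τ) τ e ∉ interior B := hp.2
  rw [hR.mem_interior_iff] at hpi
  rw [skewPoint_zero, skewPoint_one] at hpB hpi
  have hlt : |(τ + e) / 2| < 1 := by
    rw [abs_lt]
    rcases he with rfl | rfl <;>
      constructor <;> linarith [hτ.1, hτ.2, h.left_mem, h.right_mem]
  have hle := abs_lt.mp hlt
  -- the left boundary lies to the left of a segment through the origin
  have hseg : -((τ + e) / 2 * X τ) ≤ R (-((τ + e) / 2)) := by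
    have := h.isSymmBody.convex hflat (h.isSymmBody.neg_mem _ hflat) (a := (1 + (τ + e) / 2) / 2)
      (b := (1 - (τ + e) / 2) / 2) (by linarith) (by linarith) (by ring)
    have := ((hR.mem_iff _).mp this).2.2
    simp only [PiLp.add_apply, PiLp.smul_apply, PiLp.neg_apply, smul_eq_mul,
      Matrix.cons_val_zero, Matrix.cons_val_one] at this
    convert this using 1
    · ring
    · congr 1; ring
  have h3 : 0 < √3 := by positivity
  refine le_antisymm ?_ (by linarith [hpB.2.1])
  -- The arc point is at distance `√3 / 2` to the right of the segment joining `±(X τ, 1)`, hence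
  -- off the left boundary; if it were also off the right boundary, it would be interior.
  by_contra! hcon
  exact hpi ⟨hlt, by linarith, by linarith⟩

/-- The profile has negative second derivative on the arcs. -/
theorem deriv_deriv_profile_neg (h : IsSkewGraph B X a r) {R : ℝ → ℝ} (hR : IsProfile R B) {e : ℝ}
    (he : e = 1 ∨ e = -1) : (a + e) / 2 ∈ Ioo (-1 : ℝ) 1 ∧ ContDiffAt ℝ 2 R ((a + e) / 2) ∧
      deriv (deriv R) ((a + e) / 2) < 0 := by
  have hr := h.r_pos
  have hy : (a + e) / 2 ∈ Ioo (-1 : ℝ) 1 := by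
    rcases he with rfl | rfl <;>
      constructor <;> linarith [h.left_mem, h.right_mem]
  obtain ⟨δ, hδ, hδr, η, hη, hflat⟩ := h.exists_flat
  have hIoo : ∀ y ∈ Ioo ((a + e) / 2 - δ / 2) ((a + e) / 2 + δ / 2),
      2 * y - e ∈ Ioo (a - δ) (a + δ) := fun y hy => ⟨by linarith [hy.1], by linarith [hy.2]⟩
  have hIr : ∀ y ∈ Ioo ((a + e) / 2 - δ / 2) ((a + e) / 2 + δ / 2),
      2 * y - e ∈ Ioo (a - r) (a + r) := fun y hy =>
    ⟨by linarith [(hIoo y hy).1], by linarith [(hIoo y hy).2]⟩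
  have heq : ∀ y ∈ Ioo ((a + e) / 2 - δ / 2) ((a + e) / 2 + δ / 2),
      R y = √3 / 2 + y * X (2 * y - e) := by
    intro y hy
    have := h.profile_eq hR he (hIr y hy) (hflat _ (hIoo y hy) _ (by simpa using hη.le))
    rwa [show (2 * y - e + e) / 2 = y by ring] at this
  have hmem : (a + e) / 2 ∈ Ioo ((a + e) / 2 - δ / 2) ((a + e) / 2 + δ / 2) :=
    ⟨by linarith, by linarith⟩
  have hev : ∀ y ∈ Ioo ((a + e) / 2 - δ / 2) ((a + e) / 2 + δ / 2),
      R =ᶠ[𝓝 y] fun y => √3 / 2 + y * X (2 * y - e) := fun y hy =>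
    eventually_of_mem (Ioo_mem_nhds hy.1 hy.2) heq
  have hlin : ∀ y : ℝ, HasDerivAt (fun y => 2 * y - e) 2 y := fun y => by
    simpa using ((hasDerivAt_id y).const_mul 2).sub_const e
  have dX := fun y hy => hasDerivAt_of_contDiffOn_two h.contDiffOn (hIr y hy)
  have d0 : ∀ y ∈ Ioo ((a + e) / 2 - δ / 2) ((a + e) / 2 + δ / 2),
      HasDerivAt (fun y => X (2 * y - e)) (deriv X (2 * y - e) * 2) y := fun y hy =>
    (dX y hy).1.comp y (hlin y)
  have d1 : ∀ y ∈ Ioo ((a + e) / 2 - δ / 2) ((a + e) / 2 + δ / 2),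
      deriv R y = X (2 * y - e) + y * (deriv X (2 * y - e) * 2) := fun y hy => by
    rw [(hev y hy).deriv_eq]
    have := (((hasDerivAt_id y).mul (d0 y hy)).const_add (√3 / 2)).deriv
    simpa using this
  have d2 : deriv (deriv R) ((a + e) / 2) =
      2 * ((a + e) * deriv (deriv X) a + 2 * deriv X a) := by
    have hev' : deriv R =ᶠ[𝓝 ((a + e) / 2)]
        fun y => X (2 * y - e) + y * (deriv X (2 * y - e) * 2) :=
      eventually_of_mem (Ioo_mem_nhds hmem.1 hmem.2) d1
    have d3 : HasDerivAt (fun y => deriv X (2 * y - e)) (deriv (deriv X) (2 * ((a + e) / 2) - e) * 2)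
        ((a + e) / 2) := HasDerivAt.comp ((a + e) / 2) (h := fun y => 2 * y - e)
          (dX _ hmem).2.1 (hlin _)
    have := ((d0 _ hmem).add ((hasDerivAt_id _).mul (d3.mul_const 2))).deriv
    rw [hev'.deriv_eq]
    refine this.trans ?_
    rw [show 2 * ((a + e) / 2) - e = a by ring]
    simp only [id]; ring
  have hcd : ContDiffAt ℝ 2 R ((a + e) / 2) := by
    refine ContDiffAt.congr_of_eventuallyEq ?_ (hev _ hmem)
    have hX : ContDiffAt ℝ 2 X (2 * ((a + e) / 2) - e) :=
      h.contDiffOn.contDiffAt (Icc_mem_nhds (hIr _ hmem).1 (hIr _ hmem).2)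
    have : ContDiffAt ℝ 2 (fun y : ℝ => X (2 * y - e)) ((a + e) / 2) :=
      ContDiffAt.comp ((a + e) / 2) hX (by fun_prop)
    exact contDiffAt_const.add (contDiffAt_id.mul this)
  -- Concavity gives a nonpositive second derivative, and the curvature condition excludes zero.
  refine ⟨hy, hcd, lt_of_le_of_ne (deriv_deriv_nonpos_of_concaveOn hR.concaveOn
    (Icc_mem_nhds hy.1 hy.2) hcd) ?_⟩
  rw [d2]
  exact mul_ne_zero two_ne_zero (h.curved e he)

end IsSkewGraph

/-- A point outside a symmetric body is a vertex of an inscribed triangle with another vertex on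
the line of height `±1`, if it is close to the two arcs of the boundary. -/
theorem IsProfile.exists_triangle {R : ℝ → ℝ} {B : Set Plane} (h : IsProfile R B)
    (hB : IsSymmBody B) {e x₀ x₁ : ℝ} (he : e = 1 ∨ e = -1) {p : Plane} (hpe : e * p 1 < 0)
    (hp1 : |p 1| < 1) (hflat : ∀ ξ ∈ uIcc x₀ x₁, !₂[ξ, 1] ∈ B)
    (hlow : √3 / 2 + p 1 * x₁ ≤ p 0) (hup : p 0 ≤ √3 / 2 + p 1 * x₀)
    (hR : R (p 1 + e) = √3 / 2 + (p 1 + e) * x₁) :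
    ∃ q ∈ B, p + q ∈ B ∧ √3 / 2 ≤ |wedge p q| := by
  have h3 : 0 < √3 := by positivity
  have hy : p 1 ≠ 0 := by rintro h0; simp [h0] at hpe
  have hlt := abs_lt.mp hp1
  -- `ξ` is the value of the skew parameter whose boundary line passes through `p`; the two bounds
  -- on `p 0` place it between `x₀` and `x₁`.
  obtain ⟨ξ, hξ⟩ : ∃ ξ, p 0 = √3 / 2 + p 1 * ξ := ⟨(p 0 - √3 / 2) / p 1, by field_simp; ring⟩
  rw [hξ] at hlow hup
  have hu : p 1 * x₁ ≤ p 1 * ξ := by linarith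
  have hu' : p 1 * ξ ≤ p 1 * x₀ := by linarith
  have hmem : ξ ∈ uIcc x₀ x₁ := by
    rw [mem_uIcc]
    rcases lt_or_gt_of_ne hy with hy | hy
    · exact Or.inl ⟨(mul_le_mul_left_of_neg hy).mp hu', (mul_le_mul_left_of_neg hy).mp hu⟩
    · exact Or.inr ⟨(mul_le_mul_iff_right₀ hy).mp hu, (mul_le_mul_iff_right₀ hy).mp hu'⟩
  have hq := hflat ξ hmem
  have hnq := hB.neg_mem _ hq
  have hseg : -((p 1 + e) * ξ) ≤ R (-(p 1 + e)) := by
    have := hB.convex hq hnq (a := (1 + (p 1 + e)) / 2) (b := (1 - (p 1 + e)) / 2)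
      (by rcases he with rfl | rfl <;> linarith) (by rcases he with rfl | rfl <;> linarith) (by ring)
    have := ((h.mem_iff _).mp this).2.2
    simp only [PiLp.add_apply, PiLp.smul_apply, PiLp.neg_apply, smul_eq_mul,
      Matrix.cons_val_zero, Matrix.cons_val_one] at this
    convert this using 1
    · ring
    · congr 1; ring
  refine ⟨e • !₂[ξ, 1], ?_, ?_, ?_⟩
  · rcases he with rfl | rfl
    · simpa using hq
    · simpa only [neg_smul, one_smul] using hnq
  · rw [h.mem_iff]
    simp only [PiLp.add_apply, PiLp.smul_apply, smul_eq_mul, Matrix.cons_val_zero,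
      Matrix.cons_val_one, mul_one, hR, hξ]
    refine ⟨?_, ?_, by linarith⟩
    · rw [abs_le]
      rcases he with rfl | rfl <;> constructor <;> linarith
    -- `p 1` and `p 1 + e` have opposite signs, so `p` being beyond the new boundary on one arc puts
    -- `p + q` inside it on the other.
    · rcases he with rfl | rfl
      · have := (mul_le_mul_left_of_neg (show p 1 < 0 by linarith)).mp hu
        nlinarith
      · have := (mul_le_mul_iff_right₀ (show 0 < p 1 by linarith)).mp hu
        nlinarith
  · have : wedge p (e • !₂[ξ, 1]) = e * (√3 / 2) := by
      simp only [wedge, PiLp.smul_apply, smul_eq_mul, Matrix.cons_val_zero,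
        Matrix.cons_val_one, hξ]; ring
    rw [this, abs_mul, abs_of_pos (by positivity : 0 < √3 / 2)]
    rcases he with rfl | rfl <;> simp

/-! ### The perturbed body -/

/-- The perturbation of the profile attached to a bump function. -/
def profileBump (n : ℝ → ℝ) (ε y : ℝ) : ℝ := ε * (y * n (2 * y + 1) + y * n (2 * y - 1))

theorem abs_profileBump_le {n : ℝ → ℝ} (hn : ∀ τ, n τ ∈ Icc (0 : ℝ) 1) (ε : ℝ) {y : ℝ}
    (hy : |y| ≤ 1) : |profileBump n ε y| ≤ 2 * |ε| := by
  have h1 := hn (2 * y + 1)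
  have h2 := hn (2 * y - 1)
  have h3 : |n (2 * y + 1) + n (2 * y - 1)| ≤ 2 :=
    abs_le.mpr ⟨by linarith [h1.1, h2.1], by linarith [h1.2, h2.2]⟩
  rw [profileBump, ← mul_add y, abs_mul, abs_mul, mul_comm]
  refine mul_le_mul_of_nonneg_right ?_ (abs_nonneg ε)
  calc |y| * |n (2 * y + 1) + n (2 * y - 1)| ≤ 1 * 2 :=
        mul_le_mul hy h3 (abs_nonneg _) zero_le_one
    _ = 2 := one_mul 2

/-- The heights `y` and `y + 1` carry the same parameter `τ = 2 * y + 1`, and their weights add up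
to `τ`. The paired integrand is `ε * τ * n τ`, which has the sign of `ε * a` where `n` does not
vanish, since the support avoids 0. -/
theorem integral_profileBump_neg {n : ℝ → ℝ} {a δ ε : ℝ} (hn : ∀ τ, n τ ∈ Icc (0 : ℝ) 1)
    (hc : Continuous n) (hna : n a = 1) (hsupp : ∀ τ, τ ∉ Ioo (a - δ) (a + δ) → n τ = 0)
    (hl : -1 < a - δ) (hr : a + δ < 1) (hδ : 0 < δ) (hδa : δ < |a|) (hε : ε * a < 0) :
    ∫ y in Ioo (-1 : ℝ) 1, profileBump n ε y < 0 := by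
  have hcont : Continuous (profileBump n ε) := by unfold profileBump; fun_prop
  have hout : ∀ τ, (τ ≤ -1 ∨ 1 ≤ τ) → n τ = 0 := fun τ hτ => hsupp τ fun h => by
    rcases hτ with hτ | hτ <;> linarith [h.1, h.2]
  rw [← integral_Ioc_eq_integral_Ioo, ← intervalIntegral.integral_of_le (by norm_num),
    ← intervalIntegral.integral_add_adjacent_intervals (b := 0)
      (hcont.intervalIntegrable _ _) (hcont.intervalIntegrable _ _)]
  have hshift : ∫ y in (0 : ℝ)..1, profileBump n ε y =
      ∫ y in (-1 : ℝ)..0, profileBump n ε (y + 1) := by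
    rw [intervalIntegral.integral_comp_add_right]; norm_num
  have hcont' : Continuous fun y => profileBump n ε (y + 1) := by fun_prop
  rw [hshift, ← intervalIntegral.integral_add (hcont.intervalIntegrable _ _)
    (hcont'.intervalIntegrable _ _)]
  have heq : ∀ y ∈ Icc (-1 : ℝ) 0, profileBump n ε y + profileBump n ε (y + 1) =
      ε * ((2 * y + 1) * n (2 * y + 1)) := by
    intro y hy
    rw [profileBump, profileBump, hout (2 * y - 1) (Or.inl (by linarith [hy.2])),
      hout (2 * (y + 1) + 1) (Or.inr (by linarith [hy.1])),
      show 2 * (y + 1) - 1 = 2 * y + 1 by ring]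
    ring
  have ha1 : (a - 1) / 2 ∈ Icc (-1 : ℝ) 0 := ⟨by linarith, by linarith⟩
  have := intervalIntegral.integral_pos (a := -1) (b := 0)
    (f := fun y => -(profileBump n ε y + profileBump n ε (y + 1))) (by norm_num)
    (by fun_prop) (fun y hy => ?_) ⟨(a - 1) / 2, ha1, ?_⟩
  · rw [intervalIntegral.integral_neg] at this
    linarith
  · rw [heq y (Ioc_subset_Icc_self hy)]
    by_cases hτ : 2 * y + 1 ∈ Ioo (a - δ) (a + δ)
    · have h0 := (hn (2 * y + 1)).1
      have : ε * (2 * y + 1) ≤ 0 := by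
        rcases lt_abs.mp hδa with h | h
        · have : ε ≤ 0 := by by_contra! h'; nlinarith
          nlinarith [hτ.1]
        · have : 0 ≤ ε := by by_contra! h'; nlinarith
          nlinarith [hτ.2]
      nlinarith
    · rw [hsupp _ hτ]; simp
  · rw [heq _ ha1, show 2 * ((a - 1) / 2) + 1 = a by ring, hna]
    linarith

/-- The body with skew boundary arcs can be replaced by one of smaller area, in such a way that
the minimal inscribed hexagons do not become smaller. -/
theorem IsSkewGraph.exists_smaller {B : Set Plane} {X : ℝ → ℝ} {a r : ℝ}
    (h : IsSkewGraph B X a r) : ∃ B', IsSymmBody B' ∧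
      (∀ p ∈ interior B, p ∉ interior B' → (1 / 2 : ℝ) • p ∈ interior B' ∧
        ∃ q ∈ B', p + q ∈ B' ∧ √3 / 2 ≤ |wedge p q|) ∧ volume B' < volume B := by
  have hB := h.isSymmBody
  have hr := h.r_pos
  have hξ : !₂[X a, 1] ∈ B := hB.isCompact.isClosed.frontier_subset h.flat_mem.self_of_nhds
  obtain ⟨R, hR, hRm⟩ := hB.exists_isProfile h.abs_le hξ
  obtain ⟨δ₀, hδ₀, hδr, η, hη, hflat⟩ := h.exists_flat
  obtain ⟨y1, cd1, dd1⟩ := h.deriv_deriv_profile_neg hR (e := -1) (Or.inr rfl)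
  obtain ⟨y2, cd2, dd2⟩ := h.deriv_deriv_profile_neg hR (e := 1) (Or.inl rfl)
  obtain ⟨ρ₁, hρ₁, hpert1⟩ := exists_concaveOn_perturbation hR.concaveOn y1 cd1 dd1
  obtain ⟨ρ₂, hρ₂, hpert2⟩ := exists_concaveOn_perturbation hR.concaveOn y2 cd2 dd2
  obtain ⟨δ, hδ, hδ0, hδ1, hδ2⟩ : ∃ δ > 0, δ ≤ δ₀ ∧ δ ≤ ρ₁ ∧ δ ≤ ρ₂ :=
    ⟨min δ₀ (min ρ₁ ρ₂), lt_min hδ₀ (lt_min hρ₁ hρ₂), min_le_left _ _,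
      (min_le_right _ _).trans (min_le_left _ _), (min_le_right _ _).trans (min_le_right _ _)⟩
  let n : ContDiffBump a := ⟨δ / 2, δ, by positivity, by linarith⟩
  have hn : ∀ τ, n τ ∈ Icc (0 : ℝ) 1 := fun τ => ⟨n.nonneg, n.le_one⟩
  have hnc : ContDiff ℝ 2 n := n.contDiff
  have hnz : ∀ τ, δ ≤ |τ - a| → n τ = 0 := fun τ hτ =>
    n.zero_of_le_dist (by rwa [Real.dist_eq])
  have hsupp : ∀ τ, τ ∉ Ioo (a - δ) (a + δ) → n τ = 0 := fun τ hτ => hnz τ (by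
    by_contra! hlt
    rw [abs_lt] at hlt
    exact hτ ⟨by linarith, by linarith⟩)
  have hna : n a = 1 := n.one_of_mem_closedBall (Metric.mem_closedBall_self (by positivity))
  have hl : -1 < a - δ := by linarith [h.left_mem]
  have hr' : a + δ < 1 := by linarith [h.right_mem]
  have hδa : δ < |a| := by linarith [h.r_lt]
  have h0R : 0 < R 0 := by
    have := (hR.mem_interior_iff.mp hB.zero_mem).2.1
    simpa using this
  have ev1 := hpert1 (fun y => 2 * (y * n (2 * y + 1))) (by fun_prop) fun y hy => by
    rw [hnz, mul_zero, mul_zero]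
    rw [show 2 * y + 1 - a = 2 * (y - (a + -1) / 2) by ring, abs_mul, abs_two]
    linarith [abs_nonneg (y - (a + -1) / 2)]
  have ev2 := hpert2 (fun y => 2 * (y * n (2 * y - 1))) (by fun_prop) fun y hy => by
    rw [hnz, mul_zero, mul_zero]
    rw [show 2 * y - 1 - a = 2 * (y - (a + 1) / 2) by ring, abs_mul, abs_two]
    linarith [abs_nonneg (y - (a + 1) / 2)]
  have ev3 : ∀ b : ℝ, 0 < b → ∀ᶠ ε in 𝓝 (0 : ℝ), |ε| < b := fun b hb =>
    (continuous_abs.continuousAt (x := (0 : ℝ))).eventually_lt continuousAt_const (by simpa)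
  have ha0 : a ≠ 0 := by rintro rfl; simp at hδa; linarith
  -- The sign of `ε` makes the area decrease. Its size is limited by concavity near each arc, by the
  -- flat margin `η`, and by the inner width `R 0`.
  obtain ⟨ε, hεa, hε1, hε2, hε3, hε4⟩ : ∃ ε : ℝ, ε * a < 0 ∧
      ConcaveOn ℝ (Icc (-1) 1) (fun y => R y + ε * (2 * (y * n (2 * y + 1)))) ∧
      ConcaveOn ℝ (Icc (-1) 1) (fun y => R y + ε * (2 * (y * n (2 * y - 1)))) ∧
      |ε| < η ∧ |ε| < R 0 / 4 := by
    have htend : Tendsto (fun k : ℝ => -k * a) (𝓝[>] 0) (𝓝 0) := by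
      refine Tendsto.mono_left ?_ nhdsWithin_le_nhds
      have : ContinuousAt (fun k : ℝ => -k * a) 0 := by fun_prop
      simpa [ContinuousAt] using this
    obtain ⟨k, ⟨hk1, hk2, hk3, hk4⟩, hk⟩ := ((htend.eventually (ev1.and (ev2.and ((ev3 η hη).and
      (ev3 (R 0 / 4) (by positivity)))))).and self_mem_nhdsWithin).exists
    have hk : 0 < k := hk
    exact ⟨-k * a, by nlinarith [mul_pos hk (mul_self_pos.mpr ha0)], hk1, hk2, hk3, hk4⟩
  set ψ := profileBump n ε with hψ
  have hψc : Continuous ψ := by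
    have := hnc.continuous
    rw [hψ]; unfold profileBump; fun_prop
  have hψb : ∀ y, |y| ≤ 1 → |ψ y| < R 0 / 2 := fun y hy =>
    (abs_profileBump_le hn ε hy).trans_lt (by linarith)
  have hconc : ConcaveOn ℝ (Icc (-1) 1) fun y => R y + ψ y := by
    -- The new profile is the mean of two profiles, each perturbed at one arc by twice the required
    -- amount.
    refine ((hε1.smul (c := (1 / 2 : ℝ)) (by norm_num)).add
      (hε2.smul (c := (1 / 2 : ℝ)) (by norm_num))).congr fun y _ => ?_
    simp only [Pi.add_apply, smul_eq_mul, hψ, profileBump]; ring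
  let B' : Set Plane := {p | |p 1| ≤ 1 ∧ p 0 ≤ R (p 1) + ψ (p 1) ∧ -p 0 ≤ R (-p 1) + ψ (-p 1)}
  have hR' : IsProfile (fun y => R y + ψ y) B' := ⟨hconc, fun p => Iff.rfl⟩
  have hψ0 := abs_lt.mp (hψb 0 (by simp))
  have hB' : IsSymmBody B' := hR.isSymmBody_add hB hRm hψc hR' (by linarith)
  have hout : ∀ τ, (τ ≤ -1 ∨ 1 ≤ τ) → n τ = 0 := fun τ hτ => hsupp τ fun h => by
    rcases hτ with hτ | hτ <;> linarith [h.1, h.2]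
  have hψneg : ∀ y ≤ 0, ψ y = ε * (y * n (2 * y + 1)) := fun y hy => by
    rw [hψ, profileBump, hout (2 * y - 1) (Or.inl (by linarith))]; ring
  have hψpos : ∀ y, 0 ≤ y → ψ y = ε * (y * n (2 * y - 1)) := fun y hy => by
    rw [hψ, profileBump, hout (2 * y + 1) (Or.inr (by linarith))]; ring
  have hψ1 : ψ 1 = 0 := by rw [hψpos 1 zero_le_one, hout _ (Or.inr (by norm_num))]; ring
  have hψ1' : ψ (-1) = 0 := by rw [hψneg (-1) (by norm_num), hout _ (Or.inl (by norm_num))]; ring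
  have hflat' : ∀ τ ∈ Ioo (a - δ) (a + δ), ∀ ξ ∈ uIcc (X τ) (X τ + ε * n τ), !₂[ξ, 1] ∈ B' := by
    intro τ hτ ξ hξ
    have hm : |ξ - X τ| ≤ η := by
      have h1 := abs_sub_left_of_mem_uIcc hξ
      rw [add_sub_cancel_left, abs_mul, abs_of_nonneg (hn τ).1] at h1
      nlinarith [(hn τ).2, (hn τ).1, abs_nonneg ε]
    have := (hR.mem_iff _).mp (hflat τ ⟨by linarith [hτ.1], by linarith [hτ.2]⟩ ξ hm)
    rw [hR'.mem_iff]
    simpa [hψ1, hψ1'] using this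
  have hRarc : ∀ e : ℝ, e = 1 ∨ e = -1 → ∀ τ ∈ Ioo (a - δ) (a + δ),
      R ((τ + e) / 2) = √3 / 2 + (τ + e) / 2 * X τ := fun e he τ hτ =>
    h.profile_eq hR he ⟨by linarith [hτ.1], by linarith [hτ.2]⟩
      (hflat τ ⟨by linarith [hτ.1], by linarith [hτ.2]⟩ _ (by simpa using hη.le))
  have hψarc : ∀ e : ℝ, e = 1 ∨ e = -1 → ∀ τ ∈ Ioo (a - δ) (a + δ),
      ψ ((τ + e) / 2) = ε * ((τ + e) / 2 * n τ) := by
    rintro e (rfl | rfl) τ hτ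
    · rw [hψpos _ (by linarith [hτ.1])]; congr 3; ring
    · rw [hψneg _ (by linarith [hτ.2])]; congr 3; ring
  -- the points between the two boundaries on the right side
  have htri : ∀ p : Plane, |p 1| < 1 → p 0 < R (p 1) → R (p 1) + ψ (p 1) ≤ p 0 →
      ∃ q ∈ B', p + q ∈ B' ∧ √3 / 2 ≤ |wedge p q| := by
    intro p hp1 hp2 hp3
    have hlt := abs_lt.mp hp1
    have hψp : ψ (p 1) < 0 := by linarith
    -- The height of `p` has sign opposite to `e`: `p` is next to the arc of index `-e`, and its
    -- partner `p + q` next to the arc of index `e`.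
    obtain ⟨e, he, hep⟩ : ∃ e : ℝ, (e = 1 ∨ e = -1) ∧ e * p 1 < 0 := by
      rcases lt_trichotomy (p 1) 0 with hp | hp | hp
      · exact ⟨1, Or.inl rfl, by linarith⟩
      · rw [hp, hψneg 0 le_rfl] at hψp; simp at hψp
      · exact ⟨-1, Or.inr rfl, by linarith⟩
    have hτ : 2 * p 1 + e ∈ Ioo (a - δ) (a + δ) := by
      by_contra hτ
      have h0 := hsupp _ hτ
      rcases he with rfl | rfl
      · rw [hψneg _ (by linarith), h0] at hψp; simp at hψp
      · rw [← sub_eq_add_neg] at h0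
        rw [hψpos _ (by linarith), h0] at hψp; simp at hψp
    have he' : -e = 1 ∨ -e = -1 := by rcases he with rfl | rfl <;> simp
    have e1 : (2 * p 1 + e + -e) / 2 = p 1 := by ring
    have e2 : (2 * p 1 + e + e) / 2 = p 1 + e := by ring
    have r1 := hRarc _ he' _ hτ
    have r2 := hψarc _ he' _ hτ
    have r3 := hRarc _ he _ hτ
    have r4 := hψarc _ he _ hτ
    rw [e1] at r1 r2
    rw [e2] at r3 r4
    refine hR'.exists_triangle hB' he hep hp1 (hflat' _ hτ) ?_ ?_ ?_
    · rw [r1, r2] at hp3; linarith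
    · rw [r1] at hp2; linarith
    · rw [r3, r4]; ring
  refine ⟨B', hB', fun p hp hp' => ⟨?_, ?_⟩, ?_⟩
  · obtain ⟨h1, h2, h3⟩ := hR.mem_interior_iff.mp hp
    have hlt := abs_lt.mp h1
    rw [hR'.mem_interior_iff]
    simp only [PiLp.smul_apply, smul_eq_mul]
    -- Halving a point of the old interior gains `R 0 / 2` by concavity, more than the perturbation
    -- can take away.
    have hmid : ∀ y ∈ Icc (-1 : ℝ) 1, (R y + R 0) / 2 ≤ R (1 / 2 * y) := by
      intro y hy
      have := hR.concaveOn.2 hy (show (0 : ℝ) ∈ Icc (-1 : ℝ) 1 by simp)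
        (show (0 : ℝ) ≤ 1 / 2 by norm_num) (show (0 : ℝ) ≤ 1 / 2 by norm_num) (by norm_num)
      simp only [smul_eq_mul, mul_zero, add_zero] at this
      linarith
    have hh : |1 / 2 * p 1| < 1 := abs_lt.mpr ⟨by linarith, by linarith⟩
    have b1 := abs_lt.mp (hψb (1 / 2 * p 1) hh.le)
    have b2 := abs_lt.mp (hψb (-(1 / 2 * p 1)) (by rw [abs_neg]; exact hh.le))
    have m1 := hmid (p 1) ⟨hlt.1.le, hlt.2.le⟩
    have m2 := hmid (-p 1) ⟨by linarith, by linarith⟩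
    rw [show 1 / 2 * -p 1 = -(1 / 2 * p 1) by ring] at m2
    exact ⟨hh, by linarith, by linarith⟩
  · obtain ⟨h1, h2, h3⟩ := hR.mem_interior_iff.mp hp
    rw [hR'.mem_interior_iff, not_and_or, not_and_or, not_lt, not_lt, not_lt] at hp'
    rcases hp' with hp' | hp' | hp'
    · exact absurd h1 (not_lt.mpr hp')
    · exact htri p h1 h2 hp'
    · obtain ⟨q, hq, hpq, hw⟩ := htri (-p) (by simpa using h1) (by simpa using h3)
        (by simpa using hp')
      refine ⟨-q, hB'.neg_mem q hq, ?_, ?_⟩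
      · have := hB'.neg_mem _ hpq
        rwa [neg_add, neg_neg] at this
      · rwa [wedge_neg_left, ← wedge_neg_right] at hw
  · obtain ⟨-, -, hRi⟩ := hR.integrableOn hB hRm
    have hψi : IntegrableOn ψ (Ioo (-1) 1) := (hψc.continuousOn.integrableOn_Icc).mono_set
      Ioo_subset_Icc_self
    have hsum : ∀ {S : ℝ → ℝ} {A : Set Plane}, IsProfile S A → IsSymmBody A → !₂[X a, 1] ∈ A →
        ∀ y ∈ Ioo (-1 : ℝ) 1, 0 ≤ S y + S (-y) := by
      intro S A hS hA hX y hy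
      have := hA.convex hX (hA.neg_mem _ hX) (a := (1 + y) / 2) (b := (1 - y) / 2)
        (by linarith [hy.1]) (by linarith [hy.2]) (by ring)
      obtain ⟨-, h1, h2⟩ := (hS.mem_iff _).mp this
      have hval : (((1 + y) / 2) • (!₂[X a, 1] : Plane) + ((1 - y) / 2) • -!₂[X a, 1]) 1 = y := by
        simp only [PiLp.add_apply, PiLp.smul_apply, PiLp.neg_apply, smul_eq_mul,
          Matrix.cons_val_one, Matrix.cons_val_zero]
        ring
      rw [hval] at h1 h2
      linarith
    have hXB' : !₂[X a, 1] ∈ B' := hflat' a ⟨by linarith, by linarith⟩ _ left_mem_uIcc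
    have v1 := hR.volume_eq hRi (hsum hR hB hξ)
    have v2 := hR'.volume_eq (hRi.add hψi) (hsum hR' hB' hXB')
    have hpos : 0 < 2 * ∫ y in Ioo (-1 : ℝ) 1, R y := by
      rw [← ENNReal.ofReal_pos, ← v1]
      exact Measure.measure_pos_of_mem_nhds volume (mem_interior_iff_mem_nhds.mp hB.zero_mem)
    rw [v1, v2, ENNReal.ofReal_lt_ofReal_iff hpos, integral_add hRi hψi]
    have := integral_profileBump_neg hn hnc.continuous hna hsupp hl hr' hδ hδa hεa
    linarith

/-- The boundary of a miserly domain has no arcs of rank two. -/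
theorem IsMiserly.not_parametrizesBoundary {K : Set Plane} (hK : IsMiserly K)
    {σ : ZMod 6 → ℝ → Plane} {t₀ t₁ : ℝ} (hσ : HasRank σ t₀ t₁ 2) :
    ¬ ParametrizesBoundary K σ t₀ t₁ := by
  intro hp
  obtain ⟨k, c, r, hr, g, x, s, hc, -, -, -, -, hB⟩ := hσ.exists_skewCoordinates hK.1 hp
  obtain ⟨X, a, ρ, h⟩ := hB.exists_isSkewGraph
  obtain ⟨B', hB', htri, hvol⟩ := h.exists_smaller
  have ha : a ∈ Ioo (a - ρ) (a + ρ) := ⟨by linarith [h.r_pos], by linarith [h.r_pos]⟩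
  let E : Plane ≃L[ℝ] Plane :=
    (actEquiv g).symm.trans (ContinuousLinearEquiv.smulLeft (Units.mk0 r hr))
  have hN : ∀ p, normalize c hr g p = c + E p := fun p => normalize_apply c hr g p
  have hE : ∀ p q, wedge (E p) (E q) = r ^ 2 * wedge p q := by
    intro p q
    have h1 : ∀ p, E p = r • (actEquiv g).symm p := fun p => rfl
    have h2 := wedge_act g ((actEquiv g).symm p) ((actEquiv g).symm q)
    have h3 : ∀ p, act g ((actEquiv g).symm p) = p := fun p => (actEquiv g).apply_symm_apply p
    rw [h3, h3] at h2
    rw [h1, h1, wedge_smul_left, wedge_smul_right, ← h2]; ring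
  -- The two arc points at parameter `a` and their difference, a flat point, span the inscribed
  -- hexagon that defines the comparison lattice.
  have hw : wedge (skewPoint (X a) a (-1)) (skewPoint (X a) a 1) = √3 / 2 := by
    rw [wedge, skewPoint_zero, skewPoint_zero, skewPoint_one, skewPoint_one]; ring
  have hsub : skewPoint (X a) a 1 - skewPoint (X a) a (-1) = !₂[X a, 1] := by
    apply plane_ext
    · rw [PiLp.sub_apply, skewPoint_zero, skewPoint_zero]
      simp; ring
    · rw [PiLp.sub_apply, skewPoint_one, skewPoint_one]
      simp; ring
  have hpos : 0 < √3 / 2 := by positivity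
  have hlt := deltaLat_image_lt hK.1 hc hN (by positivity : 0 < r ^ 2) hE h.isSymmBody hB'
    (h.skewPoint_mem (-1) (Or.inr rfl) a ha) (h.skewPoint_mem 1 (Or.inl rfl) a ha)
    (by rw [hsub]; exact h.flat_mem.self_of_nhds) (by rw [hw]; exact hpos.ne')
    (by rw [hw, abs_of_pos hpos]; exact htri) hvol
  rw [hK.2] at hlt
  exact hlt.not_ge (deltaMin_le (hB'.isSymmetricConvexDomain hN).1)

end Reinhardt

end

theorem mainTheorem3 :
    -- no segment of the boundary of a miserly domain is parametrized by a rank two multi-curve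
    (∀ K : Set Reinhardt.Plane, Reinhardt.IsMiserly K →
      ¬ ∃ (σ : ZMod 6 → ℝ → Reinhardt.Plane) (t₀ t₁ : ℝ),
        Reinhardt.HasRank σ t₀ t₁ 2 ∧ Reinhardt.ParametrizesBoundary K σ t₀ t₁) ∧
    -- the first variation of the area is nonzero at every rank two multi-curve
    (∀ (σ : ZMod 6 → ℝ → Reinhardt.Plane) (t₀ t₁ : ℝ), Reinhardt.HasRank σ t₀ t₁ 2 →
      ∃ (Φ : ℝ → ZMod 6 → ℝ → Reinhardt.Plane) (d : ℝ),
        Reinhardt.IsRankPreservingVariation σ t₀ t₁ 2 Φ ∧ d ≠ 0 ∧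
        HasDerivAt (fun ε => ∑ j, Reinhardt.signedArea (Φ ε j) t₀ t₁) (2 * d) 0 ∧
        ∀ k, Reinhardt.IsLineSegment (σ k) t₀ t₁ →
          HasDerivAt (fun ε => Reinhardt.signedArea (Φ ε (k + 1)) t₀ t₁ +
            Reinhardt.signedArea (Φ ε (k + 2)) t₀ t₁) d 0) ∧
    -- skew coordinates and areas for rank two segments of the boundary of a convex domain
    (∀ (K : Set Reinhardt.Plane) (σ : ZMod 6 → ℝ → Reinhardt.Plane) (t₀ t₁ : ℝ),
      Reinhardt.IsSymmetricConvexDomain K → Reinhardt.HasRank σ t₀ t₁ 2 →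
      Reinhardt.ParametrizesBoundary K σ t₀ t₁ → Reinhardt.IsCounterclockwise σ t₀ t₁ →
      (∃ (k : ZMod 6) (g : Matrix.SpecialLinearGroup (Fin 2) ℝ) (x s : ℝ → ℝ),
        Reinhardt.SkewCoordinates σ t₀ t₁ k g x s ∧
        Reinhardt.sectorArea (σ (k + 1)) t₀ t₁ + Reinhardt.sectorArea (σ (k + 2)) t₀ t₁ =
          ∫ t in t₀..t₁, (1 / 4) * (√3 * deriv s t - (1 + s t ^ 2) * deriv x t)) ∧
      (∀ Φ : ℝ → ZMod 6 → ℝ → Reinhardt.Plane,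
        Reinhardt.IsRankPreservingVariation σ t₀ t₁ 2 Φ →
        ∀ᶠ ε in 𝓝 (0 : ℝ), ∀ j,
          Reinhardt.sectorArea (Φ ε j) t₀ t₁ = Reinhardt.signedArea (Φ ε j) t₀ t₁)) := by
  refine ⟨fun K hK ⟨σ, t₀, t₁, hσ, hp⟩ => hK.not_parametrizesBoundary hσ hp,
    fun σ t₀ t₁ hσ => hσ.exists_variation, fun K σ t₀ t₁ hK hσ hp hccw => ?_⟩
  obtain ⟨hsw, hcoord⟩ := hσ.exists_skewCoordinates_of_counterclockwise hK hp hccw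
  exact ⟨hcoord, fun Φ hΦ => hΦ.eventually_sectorArea_eq hsw⟩
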